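/- **Conventions.** Let $k$ be a field. All categories and functors are $k$-linear. Let $(\mathcal D,\Sigma,\Delta)$ be a triangulated category with a Serre structure $(\mathbb S,\kappa)$: an autoequivalence $\mathbb S$ of $\mathcal D$ with isomorphisms $\kappa_{x,y}:\mathcal D(x,y)\to\mathcal D(y,\mathbb Sx)^*$ natural in $x$ and $y$, where $(-)^*=\operatorname{Hom}_k(-,k)$. Let $\mathrm{sgn}:\mathbb Z\to k^\times$ be the character with $\mathrm{sgn}(1)=-1$. *Fractional Calabi-Yau.* For an autoequivalence $F$ with quasi-inverse $F^-$ let $\zeta_F:\mathbb SF\cong F\mathbb S$ be the natural isomorphism such that precomposition of functionals with $\zeta_{F,y}^{-1}\circ-$ is the composite $$\mathcal D(x,\mathbb SFy)^*\cong\mathcal D(Fy,x)\cong\mathcal D(y,F^-x)\cong\mathcal D(F^-x,\mathbb Sy)^*\cong\mathcal D(x,F\mathbb Sy)^*$$ given by $\kappa$ and the adjunctions $F\dashv F^-\dashv F$. Consider pairs $(\Phi,\phi)$ with $\Phi$ an autoequivalence of $\mathcal D$ and $\phi:\Phi\Sigma\cong\Sigma\Phi$ a natural isomorphism. They are composed by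 $(\Psi,\psi)(\Phi,\phi)=(\Psi\Phi,\ \Psi\Phi\Sigma\cong\Psi\Sigma\Phi\cong\Sigma\Psi\Phi)$, have quasi-inverses, hence integer powers, and an isomorphism $(\Phi,\phi)\cong(\Phi',\phi')$ is a natural isomorphism $\theta:\Phi\cong\Phi'$ with $\Sigma\theta\circ\phi=\phi'\circ\theta\Sigma$. For integers $N,m$, the category $\mathcal D$ is *fractional Calabi-Yau of dimension $N/m$* if $(\mathbb S,s)^m\cong(\Sigma,-\mathrm{id}_{\Sigma^2})^N$, where $s=\mathrm{sgn}(1)\,\zeta_\Sigma$. *Orbit category.* Let $\mathbb T=\mathbb S^-\Sigma$ and let $\mathcal C=\mathcal D/\mathbb T$ be the orbit category of $\mathcal D$ by the $\mathbb Z$-action generated by $\mathbb T$. It is $\mathbb Z$-hom-graded: $\mathcal C(x,y)=\bigoplus_p\mathcal C(x,y)_p$ with $\mathcal C(x,y)_p=\mathcal D(x,\mathbb T^py)$, and composition adds degrees. *Base algebra.* Suppose $\mathcal C$ is finite: it has finitely many isomorphism classes of indecomposable objects and finite-dimensional hom spaces. Let $\mathrm{ic}\,\mathcal C$ be its graded idempotent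 completion: the objects are pairs $(x,e)$ with $e$ an idempotent endomorphism of $x$ of degree $0$, and the morphisms $(x,e)\to(y,d)$ are the $f:x\to y$ with $f=dfe$. Let $X_i$ ($i\in I$, $I$ finite) be a complete irredundant list of representatives of the isomorphism classes of indecomposable objects of $\mathrm{ic}\,\mathcal C$. The base algebra is $A=\bigoplus_{i,j\in I}\mathrm{ic}\,\mathcal C(X_i,X_j)$, with multiplication given by composition ($ab$ is "$a$ after $b$", and zero if they are not composable) and the $\mathbb Z$-grading of the hom spaces. Let $A^p$ be its part of degree $p$ and let $e_i=\mathrm{id}_{X_i}$. *Graded Frobenius algebras.* A *degree-adjusted automorphism* $(\alpha,\ell)$ of $A$ is an algebra automorphism $\alpha$ that permutes the $e_i$, written $\alpha(e_i)=e_{\alpha i}$, with a function $\ell:I\to\mathbb Z$, such that, for all $i,j\in I$, $p\in\mathbb Z$ and $a\in e_jAe_i$, one has $\alpha(a)\in A^{p+\ell(j)-\ell(i)}$ if and only if $a\in A^p$. These form a group under $(\beta,\ell')(\alpha,\ell)=(\beta\alpha,\ i\mapsto\ell(i)+\ell'(\alpha i))$. An isomorphism $(\alpha,\ell)\cong(\alpha',\ell')$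 is a unit $b\in A$ with $\alpha'(a)b=b\alpha(a)$ for all $a\in A$ and $\alpha'(e_i)\,b\,\alpha(e_i)\in A^{\ell'(i)-\ell(i)}$ for all $i$. Write $\underline N$ for the constant function with value $N$. The algebra $A$ is *$\mathrm{sgn}$-graded Frobenius with Nakayama automorphism $(\alpha,\ell)$* if there is a $k$-linear isomorphism $\varphi:A\to A^*$ with $$\varphi(ba)(m)=\mathrm{sgn}(p)\,\varphi(a)(mb)\ \ (b\in A^p),\qquad \varphi(ab)(m)=\varphi(a)(\alpha(b)m)$$ for all $a,m\in A$ (and all $b\in A$ in the second equation), such that for $a\in A^pe_i$ the functional $\varphi(a)$ has degree $p-\ell(i)$, i.e. vanishes on $A^q$ for all $q\neq\ell(i)-p$. **Corollary 4.14.** Let $(\mathcal D,\Sigma,\Delta)$ be a triangulated category with a Serre structure whose orbit category $\mathcal C=\mathcal D/\mathbb T$ is finite, let $A$ be the $\mathbb Z$-graded base algebra of $\mathcal C$, and let $N,m\in\mathbb Z$. Then the following are equivalent: (a) $\mathcal D$ is fractional Calabi-Yau of dimension $N/m$; (b) $A$ is a $\mathrm{sgn}$-graded Frobenius algebra with a Nakayama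 automorphism $(\alpha,\ell)$ satisfying $(\alpha,\ell)^{m-N}\cong(\mathrm{id}_A,\underline N)$. -/

import Mathlib

open CategoryTheory CategoryTheory.Limits CategoryTheory.Idempotents

universe w v u t

noncomputable section

namespace FracCY

/-! ## Characters of the integers -/

/-- The value `χ(p) ∈ k` of a character `χ : ℤ → kˣ` (`ℤ` is written multiplicatively). -/
def charVal {k : Type w} [Field k] (χ : Multiplicative ℤ →* kˣ) (p : ℤ) : k :=
  (χ (Multiplicative.ofAdd p) : kˣ)

/-- The sign character `ℤ → kˣ`, sending `1` to `-1`. -/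
def sgn (k : Type w) [Field k] : Multiplicative ℤ →* kˣ := zpowersHom kˣ (-1)

/-! ## Hom-graded categories -/

/-- A `ℤ`-hom-graded `k`-category: every hom space is the direct sum of its homogeneous
pieces `gr x y p`, and composition adds degrees. -/
class HomGraded (k : Type w) [Field k] (C : Type u) [Category.{v} C] [Preadditive C]
    [Linear k C] where
  gr (x y : C) (p : ℤ) : Submodule k (x ⟶ y)
  isInternal (x y : C) : DirectSum.IsInternal (gr x y)
  id_mem (x : C) : 𝟙 x ∈ gr x x 0
  comp_mem {x y z : C} {p q : ℤ} {f : x ⟶ y} {g : y ⟶ z} :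
    f ∈ gr x y p → g ∈ gr y z q → f ≫ g ∈ gr x z (p + q)

/-- An object is indecomposable if it is nonzero and in every biproduct decomposition
`x ≅ y ⊕ z` one of `y`, `z` is zero. -/
def IsIndec {C : Type u} [Category.{v} C] [Preadditive C] (x : C) : Prop :=
  ¬ IsZero x ∧ ∀ (y z : C) (b : BinaryBicone y z), Nonempty b.IsBilimit →
    Nonempty (x ≅ b.pt) → IsZero y ∨ IsZero z

/-- A finite `k`-category: finitely many isomorphism classes of indecomposable objects, and
finite-dimensional hom spaces. -/
structure IsFiniteCat (k : Type w) [Field k] (C : Type u) [Category.{v} C] [Preadditive C]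
    [Linear k C] : Prop where
  finite_indec : ∃ s : Set C, s.Finite ∧ ∀ x : C, IsIndec x → ∃ y ∈ s, Nonempty (x ≅ y)
  hom_finite : ∀ x y : C, Module.Finite k (x ⟶ y)

/-- A criterion for a family of submodules to be a direct sum decomposition. -/
theorem isInternal_of_proj {k : Type w} [Field k] {M : Type v} [AddCommGroup M] [Module k M]
    (N : ℤ → Submodule k M) (π : ℤ → M →ₗ[k] M)
    (hid : ∀ p, ∀ x ∈ N p, π p x = x) (hzero : ∀ p q, p ≠ q → ∀ x ∈ N q, π p x = 0)
    (htop : ∀ x, x ∈ ⨆ p, N p) : DirectSum.IsInternal N := by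
  rw [DirectSum.isInternal_submodule_iff_iSupIndep_and_iSup_eq_top]
  refine ⟨?_, eq_top_iff.2 fun x _ => htop x⟩
  rw [iSupIndep_def]
  intro p
  rw [Submodule.disjoint_def]
  intro x hx hx'
  have hle : (⨆ (q) (_ : q ≠ p), N q) ≤ LinearMap.ker (π p) :=
    iSup₂_le fun q hq y hy => hzero p q (Ne.symm hq) y hy
  rw [← hid p x hx]
  exact hle hx'

/-! ## Idempotent completion of a hom-graded category -/

section Karoubi

variable {k : Type w} [Field k] {C : Type u} [Category.{v} C] [Preadditive C] [Linear k C]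

/-- The idempotent completion of a `k`-category is a `k`-category. -/
instance karoubiHomModule (P Q : Karoubi C) : Module k (P ⟶ Q) where
  smul r f := ⟨r • f.f, by simp⟩
  one_smul f := by
    apply Karoubi.hom_ext
    exact one_smul k f.f
  mul_smul r s f := by
    apply Karoubi.hom_ext
    exact mul_smul r s f.f
  smul_zero r := by
    apply Karoubi.hom_ext
    exact smul_zero r
  smul_add r f g := by
    apply Karoubi.hom_ext
    exact smul_add r f.f g.f
  add_smul r s f := by
    apply Karoubi.hom_ext
    exact add_smul r s f.f
  zero_smul f := by
    apply Karoubi.hom_ext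
    exact zero_smul k f.f

instance karoubiLinear : Linear k (Karoubi C) where
  smul_comp P Q R r f g := by
    apply Karoubi.hom_ext
    exact Linear.smul_comp _ _ _ r f.f g.f
  comp_smul P Q R f r g := by
    apply Karoubi.hom_ext
    exact Linear.comp_smul _ _ _ f.f r g.f

variable (k C)

/-- The idempotent completion of a hom-graded category `C`: the objects are the pairs `(x, e)`
with `e` an idempotent endomorphism of `x` of degree `0`, and the morphisms from `(x, e)` to
`(y, d)` are the `f : x ⟶ y` with `f = d f e`. -/
abbrev GrKaroubi [HomGraded k C] : Type _ :=
  ObjectProperty.FullSubcategory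
    (fun P : Karoubi C => P.p ∈ HomGraded.gr (k := k) P.X P.X 0)

variable {k C}

/-- The underlying morphism in `C`, as a linear map. -/
def grKaroubiHomMap [HomGraded k C] (P Q : GrKaroubi k C) :
    (P ⟶ Q) →ₗ[k] (P.obj.X ⟶ Q.obj.X) where
  toFun f := f.hom.f
  map_add' _ _ := rfl
  map_smul' _ _ := rfl

/-- The projection `f ↦ d f e` onto the morphisms of the idempotent completion. -/
def grKaroubiProj [HomGraded k C] (P Q : GrKaroubi k C) :
    (P.obj.X ⟶ Q.obj.X) →ₗ[k] (P ⟶ Q) where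
  toFun f := ObjectProperty.homMk ⟨P.obj.p ≫ f ≫ Q.obj.p, by simp⟩
  map_add' f g := by
    apply ObjectProperty.hom_ext
    apply Karoubi.hom_ext
    change P.obj.p ≫ (f + g) ≫ Q.obj.p = P.obj.p ≫ f ≫ Q.obj.p + P.obj.p ≫ g ≫ Q.obj.p
    simp
  map_smul' r f := by
    apply ObjectProperty.hom_ext
    apply Karoubi.hom_ext
    change P.obj.p ≫ (r • f) ≫ Q.obj.p = r • (P.obj.p ≫ f ≫ Q.obj.p)
    simp

/-- The idempotent completion is hom-graded: a morphism has degree `p` if it has degree `p`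
in `C`. -/
instance grKaroubiHomGraded [HomGraded k C] : HomGraded k (GrKaroubi k C) where
  gr P Q p := (HomGraded.gr (k := k) P.obj.X Q.obj.X p).comap (grKaroubiHomMap P Q)
  isInternal P Q := by
    have hC := HomGraded.isInternal (k := k) P.obj.X Q.obj.X
    rw [DirectSum.isInternal_submodule_iff_iSupIndep_and_iSup_eq_top] at hC ⊢
    obtain ⟨hind, htop⟩ := hC
    have hinj : ∀ f : P ⟶ Q, grKaroubiHomMap (k := k) P Q f = 0 → f = 0 := by
      intro f hf
      apply ObjectProperty.hom_ext
      apply Karoubi.hom_ext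
      exact hf
    constructor
    · rw [iSupIndep_def] at hind ⊢
      intro p
      have hp := hind p
      rw [Submodule.disjoint_def] at hp ⊢
      intro f hf hf'
      apply hinj
      refine hp _ hf ?_
      have hle : (⨆ (q) (_ : q ≠ p),
          (HomGraded.gr (k := k) P.obj.X Q.obj.X q).comap (grKaroubiHomMap P Q)) ≤
          (⨆ (q) (_ : q ≠ p), HomGraded.gr (k := k) P.obj.X Q.obj.X q).comap
            (grKaroubiHomMap P Q) :=
        iSup₂_le fun q hq =>
          Submodule.comap_mono (le_iSup₂_of_le q hq le_rfl)
      exact hle hf'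
    · rw [eq_top_iff]
      intro f _
      have hle : (⨆ q, HomGraded.gr (k := k) P.obj.X Q.obj.X q) ≤
          (⨆ q, (HomGraded.gr (k := k) P.obj.X Q.obj.X q).comap
            (grKaroubiHomMap P Q)).comap (grKaroubiProj P Q) := by
        refine iSup_le fun q g hg => ?_
        refine Submodule.mem_iSup_of_mem q ?_
        change P.obj.p ≫ g ≫ Q.obj.p ∈ HomGraded.gr (k := k) P.obj.X Q.obj.X q
        have h1 := HomGraded.comp_mem (k := k) P.property
          (HomGraded.comp_mem (k := k) hg Q.property)
        simpa using h1
      have hf : f.hom.f ∈ (⨆ q, HomGraded.gr (k := k) P.obj.X Q.obj.X q) := by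
        rw [htop]
        trivial
      have h2 := hle hf
      have h3 : grKaroubiProj (k := k) P Q f.hom.f = f := by
        apply ObjectProperty.hom_ext
        apply Karoubi.hom_ext
        exact f.hom.comm
      rw [Submodule.mem_comap, h3] at h2
      exact h2
  id_mem P := P.property
  comp_mem hf hg := HomGraded.comp_mem (k := k) hf hg

end Karoubi

/-! ## The algebra of a category with finitely many objects -/

section Algebra

variable {k : Type w} [Field k] {E : Type u} [Category.{v} E] [Preadditive E] [Linear k E]
  {ι : Type t}

/-- The algebra `⨁_{i, j} E(X i, X j)` of the full subcategory of `E` on a finite family of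
objects `X`. -/
def CatAlg (X : ι → E) : Type _ := ∀ i j, X i ⟶ X j

namespace CatAlg

variable (X : ι → E)

instance : AddCommGroup (CatAlg X) := inferInstanceAs (AddCommGroup (∀ i j, X i ⟶ X j))

instance : Module k (CatAlg X) := inferInstanceAs (Module k (∀ i j, X i ⟶ X j))

variable {X}

set_option linter.unusedSectionVars false in
@[ext] theorem ext {a b : CatAlg X} (h : ∀ i j, a i j = b i j) : a = b :=
  funext fun i => funext fun j => h i j

@[simp] theorem add_apply (a b : CatAlg X) (i j : ι) : (a + b) i j = a i j + b i j := rfl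

@[simp] theorem zero_apply (i j : ι) : (0 : CatAlg X) i j = 0 := rfl

@[simp] theorem smul_apply (r : k) (a : CatAlg X) (i j : ι) : (r • a) i j = r • a i j := rfl

variable [Fintype ι] [DecidableEq ι]

/-- The product `a * b` is "`a` after `b`"; products of non-composable morphisms vanish. -/
instance : Mul (CatAlg X) where
  mul a b := fun i l => ∑ j, b i j ≫ a j l

instance : One (CatAlg X) where
  one := fun i j => if h : i = j then eqToHom (congrArg X h) else 0

set_option linter.unusedSectionVars false in
theorem mul_apply (a b : CatAlg X) (i l : ι) : (a * b) i l = ∑ j, b i j ≫ a j l := rfl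

set_option linter.unusedSectionVars false in
theorem one_apply (i j : ι) :
    (1 : CatAlg X) i j = if h : i = j then eqToHom (congrArg X h) else 0 := rfl

instance : Ring (CatAlg X) :=
  { (inferInstance : AddCommGroup (CatAlg X)) with
    mul := (· * ·)
    one := 1
    left_distrib := fun a b c => by
      ext i l
      simp [mul_apply, Finset.sum_add_distrib]
    right_distrib := fun a b c => by
      ext i l
      simp [mul_apply, Finset.sum_add_distrib]
    zero_mul := fun a => by
      ext i l
      simp [mul_apply]
    mul_zero := fun a => by
      ext i l
      simp [mul_apply]
    mul_assoc := fun a b c => by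
      ext i l
      simp only [mul_apply, Preadditive.sum_comp, Preadditive.comp_sum, Category.assoc]
      rw [Finset.sum_comm]
    one_mul := fun a => by
      ext i l
      rw [mul_apply, Finset.sum_eq_single l]
      · simp [one_apply]
      · intro j _ hj
        simp [one_apply, hj]
      · simp
    mul_one := fun a => by
      ext i l
      rw [mul_apply, Finset.sum_eq_single i]
      · simp [one_apply]
      · intro j _ hj
        simp [one_apply, Ne.symm hj]
      · simp }

instance : Algebra k (CatAlg X) :=
  Algebra.ofModule
    (fun r a b => by
      ext i l
      simp [mul_apply, Finset.smul_sum])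
    (fun r a b => by
      ext i l
      simp [mul_apply, Finset.smul_sum])

/-- The idempotent of the algebra given by the identity morphism of `X i`. -/
def vertex (X : ι → E) (i : ι) : CatAlg X := fun j l =>
  if h : j = l then (if j = i then eqToHom (congrArg X h) else 0) else 0

/-- The homogeneous piece of degree `p`: all entries are homogeneous of degree `p`. -/
def grading (k : Type w) [Field k] [Linear k E] [HomGraded k E] (X : ι → E) (p : ℤ) :
    Submodule k (CatAlg X) where
  carrier := {a | ∀ i j, a i j ∈ HomGraded.gr (k := k) (X i) (X j) p}
  add_mem' ha hb i j := Submodule.add_mem _ (ha i j) (hb i j)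
  zero_mem' _ _ := Submodule.zero_mem _
  smul_mem' r _ ha i j := Submodule.smul_mem _ r (ha i j)

end CatAlg

/-- The family `X` consists of exactly one object from each isomorphism class of
indecomposable objects of `E`. -/
structure IsIndecSkeleton (X : ι → E) : Prop where
  indec : ∀ i, IsIndec (X i)
  inj : ∀ i j, Nonempty (X i ≅ X j) → i = j
  surj : ∀ y : E, IsIndec y → ∃ i, Nonempty (y ≅ X i)

end Algebra

/-! ## Graded Frobenius algebras -/

section Frobenius

variable {k : Type w} [Field k] {A : Type v} [Ring A] [Algebra k A] {ι : Type t}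

/-- A degree-adjusted automorphism `(α, ℓ)` of an algebra `A` with homogeneous pieces `𝒜 p`
and vertex idempotents `e i`: an algebra automorphism `α` which permutes the `e i`, and a
function `ℓ` on the vertices, such that `α` identifies the degree `p` part of `e j * A * e i`
with the degree `p + ℓ j - ℓ i` part of its image. -/
@[ext] structure DegAdjAut (𝒜 : ℤ → Submodule k A) (e : ι → A) where
  toAlgEquiv : A ≃ₐ[k] A
  perm : Equiv.Perm ι
  adj : ι → ℤ
  map_vertex : ∀ i, toAlgEquiv (e i) = e (perm i)
  map_mem_iff : ∀ (i j : ι) (p : ℤ) (a : A), e j * a = a → a * e i = a →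
    (toAlgEquiv a ∈ 𝒜 (p + adj j - adj i) ↔ a ∈ 𝒜 p)

namespace DegAdjAut

variable {𝒜 : ℤ → Submodule k A} {e : ι → A}

/-- The pair `(id, N)` with constant degree adjuster `N`. -/
def const (𝒜 : ℤ → Submodule k A) (e : ι → A) (N : ℤ) : DegAdjAut 𝒜 e where
  toAlgEquiv := 1
  perm := 1
  adj _ := N
  map_vertex _ := rfl
  map_mem_iff i j p a _ _ := by
    rw [add_sub_cancel_right]
    rfl

/-- Composition: `(β, ℓ') (α, ℓ) = (β α, i ↦ ℓ i + ℓ' (α i))`. -/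
instance : Mul (DegAdjAut 𝒜 e) where
  mul F G :=
    { toAlgEquiv := F.toAlgEquiv * G.toAlgEquiv
      perm := F.perm * G.perm
      adj := fun i => G.adj i + F.adj (G.perm i)
      map_vertex := fun i => by
        change F.toAlgEquiv (G.toAlgEquiv (e i)) = e (F.perm (G.perm i))
        rw [G.map_vertex, F.map_vertex]
      map_mem_iff := fun i j p a hj hi => by
        rw [← G.map_mem_iff i j p a hj hi, ← F.map_mem_iff (G.perm i) (G.perm j)
          (p + G.adj j - G.adj i) (G.toAlgEquiv a)
          (by rw [← G.map_vertex, ← map_mul, hj]) (by rw [← G.map_vertex, ← map_mul, hi])]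
        have h : p + (G.adj j + F.adj (G.perm j)) - (G.adj i + F.adj (G.perm i)) =
            p + G.adj j - G.adj i + F.adj (G.perm j) - F.adj (G.perm i) := by ring
        rw [h]
        rfl }

instance : One (DegAdjAut 𝒜 e) where
  one := const 𝒜 e 0

instance : Inv (DegAdjAut 𝒜 e) where
  inv F :=
    { toAlgEquiv := F.toAlgEquiv⁻¹
      perm := F.perm⁻¹
      adj := fun i => - F.adj (F.perm⁻¹ i)
      map_vertex := fun i => by
        change F.toAlgEquiv.symm (e i) = e (F.perm.symm i)
        rw [AlgEquiv.symm_apply_eq, F.map_vertex, Equiv.apply_symm_apply]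
      map_mem_iff := fun i j p a hj hi => by
        have hv : ∀ i, F.toAlgEquiv.symm (e i) = e (F.perm.symm i) := fun i => by
          rw [AlgEquiv.symm_apply_eq, F.map_vertex, Equiv.apply_symm_apply]
        change F.toAlgEquiv.symm a ∈
          𝒜 (p + - F.adj (F.perm.symm j) - - F.adj (F.perm.symm i)) ↔ _
        rw [← F.map_mem_iff (F.perm.symm i) (F.perm.symm j) _ (F.toAlgEquiv.symm a)
          (by rw [← hv, ← map_mul, hj]) (by rw [← hv, ← map_mul, hi]),
          AlgEquiv.apply_symm_apply]
        have h : p + - F.adj (F.perm.symm j) - - F.adj (F.perm.symm i) +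
            F.adj (F.perm.symm j) - F.adj (F.perm.symm i) = p := by ring
        rw [h] }

/-- Degree-adjusted automorphisms form a group, so integer powers make sense. -/
instance : Group (DegAdjAut 𝒜 e) where
  mul_assoc F G H := by
    ext i
    · rfl
    · rfl
    · change H.adj i + (G.adj (H.perm i) + F.adj (G.perm (H.perm i))) = _
      rw [← add_assoc]
      rfl
  one_mul F := by
    ext i
    · rfl
    · rfl
    · exact add_zero (F.adj i)
  mul_one F := by
    ext i
    · rfl
    · rfl
    · exact zero_add (F.adj i)
  inv_mul_cancel F := by
    ext i
    · exact F.toAlgEquiv.symm_apply_apply _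
    · exact F.perm.symm_apply_apply i
    · change F.adj i + - F.adj (F.perm.symm (F.perm i)) = 0
      rw [Equiv.symm_apply_apply, add_neg_cancel]

/-- An isomorphism `(f, γ) ≅ (g, δ)`: an invertible `b` with `g(a) b = b f(a)` for all `a`,
whose component `g(e i) b f(e i)` is homogeneous of degree `δ i - γ i` for all `i`. -/
def IsIsomorphic (F G : DegAdjAut 𝒜 e) : Prop :=
  ∃ b : Aˣ, (∀ a : A, G.toAlgEquiv a * b = b * F.toAlgEquiv a) ∧
    ∀ i, G.toAlgEquiv (e i) * b * F.toAlgEquiv (e i) ∈ 𝒜 (G.adj i - F.adj i)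

end DegAdjAut

/-- A `χ`-graded Frobenius structure `(φ, α, ℓ)` on `A`: a degree-adjusted automorphism
`(α, ℓ)` and an isomorphism `φ` of graded bimodules from `A` to the `χ`-twisted dual of `A`,
with right action twisted by `(α, ℓ)`.  The actions on the dual are
`(b ξ)(m) = χ(deg b) ξ(m b)` and `(ξ a)(m) = ξ(a m)`, and a functional has degree `p` if it
vanishes on all homogeneous elements of degree other than `-p`; the twist by `ℓ` means
that `φ` sends `a ∈ A * e i` of degree `p` to a functional of degree `p - ℓ i`. -/
structure GradedFrobeniusStructure (χ : Multiplicative ℤ →* kˣ) (𝒜 : ℤ → Submodule k A)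
    (e : ι → A) where
  nakayama : DegAdjAut 𝒜 e
  φ : A ≃ₗ[k] Module.Dual k A
  map_left : ∀ (p : ℤ) (b : A), b ∈ 𝒜 p → ∀ a m : A, φ (b * a) m = charVal χ p * φ a (m * b)
  map_right : ∀ a b m : A, φ (a * b) m = φ a (nakayama.toAlgEquiv b * m)
  map_degree : ∀ (i : ι) (p q : ℤ) (a m : A), a ∈ 𝒜 p → a * e i = a → m ∈ 𝒜 q →
    q ≠ - (p - nakayama.adj i) → φ a m = 0

end Frobenius

/-! ## Orbit categories -/

section Orbit

variable {D : Type u} [Category.{v} D]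

/-- The objects of the orbit category of `D` by an autoequivalence `T`, after replacing the
action of `T` by a strict action of `ℤ`: sequences `(x i)` of objects with isomorphisms
`T (x i) ≅ x (i + 1)`.  The strict action shifts such sequences.  As `T` is an equivalence,
every object of `D` is the term `x 0` of such a sequence, in an essentially unique way. -/
structure OrbitCat (T : D ⥤ D) where
  obj : ℤ → D
  str : ∀ i, T.obj (obj i) ≅ obj (i + 1)

namespace OrbitCat

variable [Preadditive D] {T : D ⥤ D}

/-- Morphisms of the orbit category.  A morphism of degree `p` from `x` to `y` is a
`T`-compatible family of morphisms `x i ⟶ y (i + p)`, i.e. a morphism from `x` to the `p`-fold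
shift of `y`, and is determined by the morphism `x 0 ⟶ y p`.  A general morphism is a finite
sum of such, which is recorded as a matrix with entries `x i ⟶ y j`. -/
@[ext] structure Hom (x y : OrbitCat T) where
  mat : ∀ i j : ℤ, x.obj i ⟶ y.obj j
  compat : ∀ i j, T.map (mat i j) ≫ (y.str j).hom = (x.str i).hom ≫ mat (i + 1) (j + 1)
  finite : ∀ i, {j | mat i j ≠ 0}.Finite

namespace Hom

variable {x y z : OrbitCat T}

/-- The composite of two matrices. -/
def compMat (f : Hom x y) (g : Hom y z) (i l : ℤ) : x.obj i ⟶ z.obj l :=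
  ∑ j ∈ (f.finite i).toFinset, f.mat i j ≫ g.mat j l

theorem compMat_eq (f : Hom x y) (g : Hom y z) (i l : ℤ) (s : Finset ℤ)
    (hs : ∀ j, f.mat i j ≠ 0 → j ∈ s) :
    compMat f g i l = ∑ j ∈ s, f.mat i j ≫ g.mat j l := by
  refine Finset.sum_subset (fun j hj => hs j (by simpa using hj)) fun j _ hj => ?_
  have h0 : f.mat i j = 0 := by simpa using hj
  rw [h0, zero_comp]

end Hom

variable [T.Additive]

theorem Hom.mat_succ_eq_zero {x y : OrbitCat T} (f : Hom x y) {i j : ℤ} (h : f.mat i j = 0) :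
    f.mat (i + 1) (j + 1) = 0 := by
  have h1 := f.compat i j
  rw [h, T.map_zero, zero_comp] at h1
  exact (cancel_epi (x.str i).hom).1 (by rw [← h1, comp_zero])

instance : Category (OrbitCat T) where
  Hom := Hom
  id x :=
    { mat := fun i j => if h : i = j then eqToHom (congrArg x.obj h) else 0
      compat := fun i j => by
        by_cases h : i = j
        · subst h
          simp
        · have h' : i + 1 ≠ j + 1 := fun h' => h (by omega)
          simp [h]
      finite := fun i => (Set.finite_singleton i).subset fun j hj => by
        by_contra h
        exact hj (dif_neg fun h' => h h'.symm) }
  comp {x y z} f g :=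
    { mat := Hom.compMat f g
      compat := fun i l => by
        rw [Hom.compMat_eq f g (i + 1) (l + 1)
          ((f.finite i).toFinset.map (addRightEmbedding 1)), Hom.compMat, Functor.map_sum,
          Preadditive.sum_comp, Finset.sum_map, Preadditive.comp_sum]
        · refine Finset.sum_congr rfl fun j _ => ?_
          rw [T.map_comp, Category.assoc, g.compat j l, ← Category.assoc, f.compat i j,
            Category.assoc]
          rfl
        · intro j hj
          rw [Finset.mem_map]
          refine ⟨j - 1, ?_, by simp⟩
          rw [Set.Finite.mem_toFinset]
          intro h0
          have h1 := f.mat_succ_eq_zero h0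
          rw [sub_add_cancel] at h1
          exact hj h1
      finite := fun i => by
        refine ((f.finite i).toFinset.finite_toSet.biUnion fun j _ => g.finite j).subset ?_
        intro l hl
        by_contra h
        apply hl
        refine Finset.sum_eq_zero fun j hj => ?_
        have h0 : g.mat j l = 0 := by
          by_contra h1
          exact h (Set.mem_biUnion hj h1)
        rw [h0, comp_zero] }
  id_comp {x y} f := by
    apply Hom.ext
    funext i l
    refine (Hom.compMat_eq _ f i l {i} fun j hj => ?_).trans ?_
    · by_contra h
      exact hj (dif_neg fun h' => h (by simp [h']))
    · simp
  comp_id {x y} f := by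
    apply Hom.ext
    funext i l
    refine (Hom.compMat_eq f _ i l (insert l (f.finite i).toFinset) fun j hj => ?_).trans ?_
    · exact Finset.mem_insert_of_mem (by simpa using hj)
    · rw [Finset.sum_eq_single l]
      · simp
      · intro j _ hj
        simp [hj]
      · simp
  assoc {w x y z} f g h := by
    apply Hom.ext
    funext i n
    have hs : ∀ l, Hom.compMat f g i l ≠ 0 →
        l ∈ (f.finite i).toFinset.biUnion fun j => (g.finite j).toFinset := by
      intro l hl
      by_contra hn
      apply hl
      refine Finset.sum_eq_zero fun j hj => ?_
      have h0 : g.mat j l = 0 := by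
        by_contra h1
        exact hn (Finset.mem_biUnion.2 ⟨j, hj, by simpa using h1⟩)
      rw [h0, comp_zero]
    refine (Hom.compMat_eq _ h i n _ hs).trans ?_
    change _ = ∑ j ∈ (f.finite i).toFinset, f.mat i j ≫ Hom.compMat g h j n
    change ∑ l ∈ _, (∑ j ∈ (f.finite i).toFinset, f.mat i j ≫ g.mat j l) ≫ h.mat l n = _
    simp only [Preadditive.sum_comp, Category.assoc]
    rw [Finset.sum_comm]
    refine Finset.sum_congr rfl fun j hj => ?_
    rw [← Preadditive.comp_sum, ← Hom.compMat_eq g h j n _ fun l hl =>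
      Finset.mem_biUnion.2 ⟨j, hj, by simpa using hl⟩]

theorem comp_mat {x y z : OrbitCat T} (f : x ⟶ y) (g : y ⟶ z) (i l : ℤ) (s : Finset ℤ)
    (hs : ∀ j, f.mat i j ≠ 0 → j ∈ s) :
    (f ≫ g).mat i l = ∑ j ∈ s, f.mat i j ≫ g.mat j l :=
  Hom.compMat_eq f g i l s hs

theorem id_mat (x : OrbitCat T) (i j : ℤ) :
    Hom.mat (𝟙 x) i j = if h : i = j then eqToHom (congrArg x.obj h) else 0 := rfl

theorem hom_ext {x y : OrbitCat T} {f g : x ⟶ y} (h : ∀ i j, f.mat i j = g.mat i j) : f = g :=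
  Hom.ext (funext fun i => funext fun j => h i j)

/-- Morphisms are added entrywise. -/
instance (x y : OrbitCat T) : Add (x ⟶ y) where
  add f g :=
    { mat := fun i j => f.mat i j + g.mat i j
      compat := fun i j => by
        rw [T.map_add, Preadditive.add_comp, f.compat, g.compat, Preadditive.comp_add]
      finite := fun i => ((f.finite i).union (g.finite i)).subset fun j hj => by
        by_contra h
        obtain ⟨h1, h2⟩ := not_or.1 h
        exact hj (by rw [not_not.1 h1, not_not.1 h2, add_zero]) }

instance (x y : OrbitCat T) : Zero (x ⟶ y) where
  zero :=
    { mat := fun _ _ => 0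
      compat := fun i j => by simp
      finite := fun i => by simp }

instance (x y : OrbitCat T) : Neg (x ⟶ y) where
  neg f :=
    { mat := fun i j => - f.mat i j
      compat := fun i j => by
        rw [T.map_neg, Preadditive.neg_comp, f.compat, Preadditive.comp_neg]
      finite := fun i => (f.finite i).subset fun j hj h => hj (by rw [h, neg_zero]) }

instance (x y : OrbitCat T) : AddCommGroup (x ⟶ y) where
  nsmul := nsmulRec
  zsmul := zsmulRec
  add_assoc f g h := hom_ext fun i j => add_assoc _ _ _
  zero_add f := hom_ext fun i j => zero_add _
  add_zero f := hom_ext fun i j => add_zero _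
  add_comm f g := hom_ext fun i j => add_comm _ _
  neg_add_cancel f := hom_ext fun i j => neg_add_cancel _

theorem add_mat {x y : OrbitCat T} (f g : x ⟶ y) (i j : ℤ) :
    (f + g).mat i j = f.mat i j + g.mat i j := rfl

theorem zero_mat {x y : OrbitCat T} (i j : ℤ) : (0 : x ⟶ y).mat i j = 0 := rfl

instance : Preadditive (OrbitCat T) where
  homGroup x y := inferInstance
  add_comp x y z f g h := hom_ext fun i l => by
    let s := (f.finite i).toFinset ∪ (g.finite i).toFinset
    have hf : ∀ j, f.mat i j ≠ 0 → j ∈ s := fun j hj =>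
      Finset.mem_union_left _ (by simpa using hj)
    have hg : ∀ j, g.mat i j ≠ 0 → j ∈ s := fun j hj =>
      Finset.mem_union_right _ (by simpa using hj)
    rw [comp_mat (f + g) h i l s, add_mat, comp_mat f h i l s hf, comp_mat g h i l s hg,
      ← Finset.sum_add_distrib]
    · exact Finset.sum_congr rfl fun j _ => by rw [add_mat, Preadditive.add_comp]
    · intro j hj
      by_contra hn
      apply hj
      rw [add_mat, not_not.1 fun h1 => hn (hf j h1), not_not.1 fun h1 => hn (hg j h1), add_zero]
  comp_add x y z f g h := hom_ext fun i l => by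
    have hf : ∀ j, f.mat i j ≠ 0 → j ∈ (f.finite i).toFinset := fun j hj => by simpa using hj
    rw [add_mat, comp_mat f _ i l _ hf, comp_mat f _ i l _ hf, comp_mat f _ i l _ hf,
      ← Finset.sum_add_distrib]
    exact Finset.sum_congr rfl fun j _ => by rw [add_mat, Preadditive.comp_add]

variable {k : Type w} [Field k] [Linear k D] [T.Linear k]

instance (x y : OrbitCat T) : Module k (x ⟶ y) where
  smul r f :=
    { mat := fun i j => r • f.mat i j
      compat := fun i j => by
        rw [T.map_smul, Linear.smul_comp, f.compat, Linear.comp_smul]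
      finite := fun i => (f.finite i).subset fun j hj h => hj (by rw [h, smul_zero]) }
  one_smul f := hom_ext fun i j => one_smul k _
  mul_smul r s f := hom_ext fun i j => mul_smul r s _
  smul_zero r := hom_ext fun i j => smul_zero r
  smul_add r f g := hom_ext fun i j => smul_add r _ _
  add_smul r s f := hom_ext fun i j => add_smul r s _
  zero_smul f := hom_ext fun i j => zero_smul k _

theorem smul_mat {x y : OrbitCat T} (r : k) (f : x ⟶ y) (i j : ℤ) :
    (r • f).mat i j = r • f.mat i j := rfl

/-- The orbit category is a `k`-category. -/
instance : Linear k (OrbitCat T) where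
  homModule x y := inferInstance
  smul_comp x y z r f g := hom_ext fun i l => by
    have hf : ∀ j, f.mat i j ≠ 0 → j ∈ (f.finite i).toFinset := fun j hj => by simpa using hj
    rw [smul_mat, comp_mat f g i l _ hf, comp_mat (r • f) g i l (f.finite i).toFinset,
      Finset.smul_sum]
    · exact Finset.sum_congr rfl fun j _ => by rw [smul_mat, Linear.smul_comp]
    · intro j hj
      exact hf j fun h => hj (by rw [smul_mat, h, smul_zero])
  comp_smul x y z f r g := hom_ext fun i l => by
    have hf : ∀ j, f.mat i j ≠ 0 → j ∈ (f.finite i).toFinset := fun j hj => by simpa using hj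
    rw [smul_mat, comp_mat f g i l _ hf, comp_mat f _ i l _ hf, Finset.smul_sum]
    exact Finset.sum_congr rfl fun j _ => by rw [smul_mat, Linear.comp_smul]

/-- The component of degree `p` of a morphism. -/
def component (k : Type w) [Field k] [Linear k D] [T.Linear k] (x y : OrbitCat T) (p : ℤ) :
    (x ⟶ y) →ₗ[k] (x ⟶ y) where
  toFun f :=
    { mat := fun i j => if j = i + p then f.mat i j else 0
      compat := fun i j => by
        by_cases h : j = i + p
        · have h' : j + 1 = i + 1 + p := by omega
          rw [if_pos h, if_pos h', f.compat]
        · have h' : ¬ (j + 1 = i + 1 + p) := by omega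
          rw [if_neg h, if_neg h', T.map_zero, zero_comp, comp_zero]
      finite := fun i => (f.finite i).subset fun j hj h => hj (by rw [h, ite_self]) }
  map_add' f g := hom_ext fun i j => by
    change (if j = i + p then f.mat i j + g.mat i j else 0) =
      (if j = i + p then f.mat i j else 0) + (if j = i + p then g.mat i j else 0)
    split_ifs <;> simp
  map_smul' r f := hom_ext fun i j => by
    change (if j = i + p then r • f.mat i j else 0) = r • (if j = i + p then f.mat i j else 0)
    split_ifs <;> simp

theorem component_mat (x y : OrbitCat T) (p : ℤ) (f : x ⟶ y) (i j : ℤ) :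
    (component k x y p f).mat i j = if j = i + p then f.mat i j else 0 := rfl

/-- The morphisms of degree `p`. -/
def gr (k : Type w) [Field k] [Linear k D] [T.Linear k] (x y : OrbitCat T) (p : ℤ) :
    Submodule k (x ⟶ y) where
  carrier := {f | ∀ i j, j ≠ i + p → f.mat i j = 0}
  add_mem' hf hg i j h := by rw [add_mat, hf i j h, hg i j h, add_zero]
  zero_mem' _ _ _ := rfl
  smul_mem' r f hf i j h := by rw [smul_mat, hf i j h, smul_zero]

theorem sum_mat {x y : OrbitCat T} {α : Type*} (s : Finset α) (f : α → (x ⟶ y)) (i j : ℤ) :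
    (∑ a ∈ s, f a).mat i j = ∑ a ∈ s, (f a).mat i j := by
  classical
  induction s using Finset.induction_on with
  | empty => rfl
  | insert a s ha ih => rw [Finset.sum_insert ha, Finset.sum_insert ha, add_mat, ih]

variable [T.IsEquivalence]

theorem component_eq_zero (x y : OrbitCat T) (p : ℤ) (f : x ⟶ y) (h : f.mat 0 p = 0) :
    component k x y p f = 0 := by
  have h0 : ∀ a b : ℤ, a = 0 → b = p → f.mat a b = 0 := by
    intro a b ha hb
    subst ha hb
    exact h
  have hup : ∀ n : ℕ, f.mat n (n + p) = 0 := by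
    intro n
    induction n with
    | zero => exact h0 _ _ (by simp) (by simp)
    | succ n ih =>
      have h1 := f.mat_succ_eq_zero ih
      have h2 : ((n + 1 : ℕ) : ℤ) + p = n + p + 1 := by push_cast; ring
      rw [h2]
      exact_mod_cast h1
  have hdown : ∀ n : ℕ, f.mat (-n) (-n + p) = 0 := by
    intro n
    induction n with
    | zero => exact h0 _ _ (by simp) (by simp)
    | succ n ih =>
      have h1 := f.compat (-((n + 1 : ℕ) : ℤ)) (-((n + 1 : ℕ) : ℤ) + p)
      have h2 : -((n + 1 : ℕ) : ℤ) + 1 = -n := by push_cast; ring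
      have h3 : -((n + 1 : ℕ) : ℤ) + p + 1 = -n + p := by push_cast; ring
      have h4 : f.mat (-((n + 1 : ℕ) : ℤ) + 1) (-((n + 1 : ℕ) : ℤ) + p + 1) = 0 := by
        rw [h2, h3]
        exact ih
      rw [h4, comp_zero] at h1
      apply T.map_injective
      rw [T.map_zero]
      exact (cancel_mono (y.str _).hom).1 (by rw [h1, zero_comp])
  refine hom_ext fun i j => ?_
  rw [component_mat, zero_mat]
  split_ifs with hj
  · subst hj
    obtain ⟨n, hn | hn⟩ := i.eq_nat_or_neg
    · subst hn
      exact hup n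
    · subst hn
      exact hdown n
  · rfl

theorem eq_sum_component (x y : OrbitCat T) (f : x ⟶ y) :
    f = ∑ p ∈ (f.finite 0).toFinset, component k x y p f := by
  refine hom_ext fun i j => ?_
  rw [sum_mat]
  have h1 : ∀ p ∈ (f.finite 0).toFinset, p ≠ j - i →
      (component k x y p f).mat i j = 0 := by
    intro p _ hp
    rw [component_mat, if_neg]
    omega
  have h3 : (component k x y (j - i) f).mat i j = f.mat i j := by
    rw [component_mat, if_pos (by omega)]
  rw [Finset.sum_eq_single (j - i) h1, h3]
  intro h2
  rw [component_eq_zero x y (j - i) f (by simpa using h2), zero_mat]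

/-- The orbit category is a hom-graded category. -/
instance : HomGraded k (OrbitCat T) where
  gr := gr k
  isInternal x y := by
    refine isInternal_of_proj (gr k x y) (component k x y) ?_ ?_ ?_
    · intro p f hf
      refine hom_ext fun i j => ?_
      rw [component_mat]
      split_ifs with h
      · rfl
      · exact (hf i j h).symm
    · intro p q hpq f hf
      refine hom_ext fun i j => ?_
      rw [component_mat, zero_mat]
      split_ifs with h
      · exact hf i j (by omega)
      · rfl
    · intro f
      rw [eq_sum_component (k := k) x y f]
      refine Submodule.sum_mem _ fun p _ => Submodule.mem_iSup_of_mem p ?_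
      intro i j h
      rw [component_mat, if_neg h]
  id_mem x i j h := by
    rw [id_mat, dif_neg]
    omega
  comp_mem {x y z p q f g} hf hg i l h := by
    rw [comp_mat f g i l {i + p}]
    · rw [Finset.sum_singleton, hg (i + p) l (by omega), comp_zero]
    · intro j hj
      rw [Finset.mem_singleton]
      by_contra hn
      exact hj (hf i j hn)

end OrbitCat

end Orbit

/-! ## Equivariant autoequivalences -/

section Equivariant

variable {D : Type u} [Category.{v} D]

/-- An equivariant autoequivalence `(Φ, φ)` of `(D, F)`: an autoequivalence `Φ` of `D` and a
natural isomorphism `φ : Φ F ≅ F Φ`. -/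
structure EquivariantAut (F : D ⥤ D) where
  Φ : D ≌ D
  comm : F ⋙ Φ.functor ≅ Φ.functor ⋙ F

namespace EquivariantAut

variable {F : D ⥤ D}

/-- The identity. -/
def one (F : D ⥤ D) : EquivariantAut F where
  Φ := CategoryTheory.Equivalence.refl
  comm := NatIso.ofComponents (fun x => Iso.refl (F.obj x))
    (fun f => (Category.comp_id (F.map f)).trans (Category.id_comp (F.map f)).symm)

/-- The composite `B A` ("`B` after `A`"), with commutation isomorphism
`B A F ≅ B F A ≅ F B A`. -/
def comp (B A : EquivariantAut F) : EquivariantAut F where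
  Φ := A.Φ.trans B.Φ
  comm := NatIso.ofComponents
    (fun x => B.Φ.functor.mapIso (A.comm.app x) ≪≫ B.comm.app (A.Φ.functor.obj x))
    (fun {x y} f => by
      have h1 := A.comm.hom.naturality f
      have h2 := B.comm.hom.naturality (A.Φ.functor.map f)
      simp only [Functor.comp_obj, Functor.comp_map] at h1 h2
      change B.Φ.functor.map (A.Φ.functor.map (F.map f)) ≫
          (B.Φ.functor.map (A.comm.hom.app y) ≫ B.comm.hom.app (A.Φ.functor.obj y)) =
        (B.Φ.functor.map (A.comm.hom.app x) ≫ B.comm.hom.app (A.Φ.functor.obj x)) ≫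
          F.map (B.Φ.functor.map (A.Φ.functor.map f))
      rw [Category.assoc, ← h2, ← Functor.map_comp_assoc, ← Functor.map_comp_assoc, h1])

/-- The quasi-inverse, with commutation isomorphism
`Φ⁻ F ≅ Φ⁻ F Φ Φ⁻ ≅ Φ⁻ Φ F Φ⁻ ≅ F Φ⁻`. -/
def inv (A : EquivariantAut F) : EquivariantAut F where
  Φ := A.Φ.symm
  comm := NatIso.ofComponents
    (fun x => A.Φ.inverse.mapIso (F.mapIso (A.Φ.counitIso.symm.app x)) ≪≫
      A.Φ.inverse.mapIso (A.comm.symm.app (A.Φ.inverse.obj x)) ≪≫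
      A.Φ.unitIso.symm.app (F.obj (A.Φ.inverse.obj x)))
    (fun {x y} f => by
      have h1 := A.Φ.counitIso.inv.naturality f
      have h2 := A.comm.inv.naturality (A.Φ.inverse.map f)
      have h3 := A.Φ.unitIso.inv.naturality (F.map (A.Φ.inverse.map f))
      simp only [Functor.comp_obj, Functor.comp_map, Functor.id_obj, Functor.id_map] at h1 h2 h3
      simp only [Equivalence.symm_functor, Functor.comp_obj, Functor.comp_map,
        Iso.trans_hom, Functor.mapIso_hom, Iso.app_hom, Iso.symm_hom, Category.assoc]
      rw [← h3, ← Functor.map_comp_assoc, ← Functor.map_comp_assoc, ← Functor.map_comp_assoc,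
        ← Functor.map_comp_assoc, ← F.map_comp, h1, F.map_comp, Category.assoc, Category.assoc,
        h2])

/-- Powers with natural number exponents. -/
def npow (A : EquivariantAut F) : ℕ → EquivariantAut F
  | 0 => one F
  | n + 1 => A.comp (A.npow n)

/-- Powers with integer exponents. -/
def zpow (A : EquivariantAut F) : ℤ → EquivariantAut F
  | Int.ofNat n => A.npow n
  | Int.negSucc n => A.inv.npow (n + 1)

/-- Existence of an isomorphism of equivariant functors: a natural isomorphism compatible with
the commutation isomorphisms. -/
def IsIsomorphic (A B : EquivariantAut F) : Prop :=
  ∃ θ : A.Φ.functor ≅ B.Φ.functor, ∀ x : D,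
    A.comm.hom.app x ≫ F.map (θ.hom.app x) = θ.hom.app (F.obj x) ≫ B.comm.hom.app x

end EquivariantAut

end Equivariant

/-! ## Serre structures and the fractional Calabi-Yau property -/

section Serre

variable (k : Type w) [Field k] (D : Type u) [Category.{v} D] [Preadditive D] [Linear k D]

/-- A Serre structure `(S, κ)` on a `k`-category: a `k`-linear autoequivalence `S` with binatural
isomorphisms `κ : D(x, y) ≅ D(y, S x)^*`. -/
structure SerreStructure where
  S : D ≌ D
  additive : S.functor.Additive
  linear : S.functor.Linear k
  κ (x y : D) : (x ⟶ y) ≃ₗ[k] Module.Dual k (y ⟶ S.functor.obj x)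
  κ_left {x y z : D} (g : x ⟶ y) (h : y ⟶ z) (m : z ⟶ S.functor.obj x) :
    κ x z (g ≫ h) m = κ x y g (h ≫ m)
  κ_right {x y z : D} (f : x ⟶ y) (g : y ⟶ z) (m : z ⟶ S.functor.obj x) :
    κ x z (f ≫ g) m = κ y z g (m ≫ S.functor.map f)

attribute [instance] SerreStructure.additive SerreStructure.linear

variable {k D}

namespace SerreStructure

variable (𝒮 : SerreStructure k D)

/-- `ζ` is the canonical commutation isomorphism `S F ≅ F S` of the Serre functor with an
autoequivalence `F` with quasi-inverse `G`: precomposing functionals with `ζ⁻¹` is the composite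
`D(x, S F y)^* ≅ D(F y, x) ≅ D(y, G x) ≅ D(G x, S y)^* ≅ D(x, F S y)^*` of the maps given by
`κ`, the adjunction `F ⊣ G`, `κ`, and the adjunction `G ⊣ F`. -/
def IsCanonicalComm (F : D ≌ D)
    (ζ : F.functor ⋙ 𝒮.S.functor ≅ 𝒮.S.functor ⋙ F.functor) : Prop :=
  ∀ (x y : D) (a : F.functor.obj y ⟶ x) (v : x ⟶ F.functor.obj (𝒮.S.functor.obj y)),
    𝒮.κ (F.functor.obj y) x a (v ≫ ζ.inv.app y) =
      𝒮.κ y (F.inverse.obj x) (F.toAdjunction.homEquiv y x a)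
        ((F.symm.toAdjunction.homEquiv x (𝒮.S.functor.obj y)).symm v)

/-- `(S, s, κ)` is a `χ`-equivariant Serre structure on `(D, F)`: the isomorphism
`s : S F ≅ F S` is `χ(1)` times the canonical one. -/
def IsEquivariant (χ : Multiplicative ℤ →* kˣ) (F : D ≌ D)
    (s : F.functor ⋙ 𝒮.S.functor ≅ 𝒮.S.functor ⋙ F.functor) : Prop :=
  ∃ ζ : F.functor ⋙ 𝒮.S.functor ≅ 𝒮.S.functor ⋙ F.functor, 𝒮.IsCanonicalComm F ζ ∧
    ∀ x : D, s.hom.app x = charVal χ 1 • ζ.hom.app x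

variable [HasShift D ℤ]

/-- The Auslander-Reiten functor `T = S⁻ Σ`. -/
abbrev arFunctor : D ⥤ D := shiftFunctor D (1 : ℤ) ⋙ 𝒮.S.inverse

end SerreStructure

/-- The equivariant functor `(Σ, -id)` of `(D, Σ)`. -/
def suspension (D : Type u) [Category.{v} D] [Preadditive D] [HasShift D ℤ] :
    EquivariantAut (shiftEquiv D (1 : ℤ)).functor where
  Φ := shiftEquiv D (1 : ℤ)
  comm := - Iso.refl _

/-- `D` is fractional Calabi-Yau of dimension `N / m`: for the `sgn`-equivariant Serre structure
`(S, s, κ)` there is an isomorphism `(S, s)^m ≅ (Σ, -id)^N` of equivariant functors. -/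
def IsFractionalCalabiYau [HasShift D ℤ] (𝒮 : SerreStructure k D) (N m : ℤ) : Prop :=
  ∃ s : (shiftEquiv D (1 : ℤ)).functor ⋙ 𝒮.S.functor ≅
      𝒮.S.functor ⋙ (shiftEquiv D (1 : ℤ)).functor,
    𝒮.IsEquivariant (sgn k) (shiftEquiv D (1 : ℤ)) s ∧
    EquivariantAut.IsIsomorphic
      (EquivariantAut.zpow ⟨𝒮.S, s⟩ m) ((suspension D).zpow N)

end Serre

end FracCY
end

open FracCY

/-!
A linear autoequivalence `Φ` of `D` which commutes with the suspension, together with the canonical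
commutation isomorphism of `Φ` with the Serre functor `S`, acts on the orbit category of
`T = S⁻ Σ` by applying `Φ` to all entries of a morphism, and hence on its graded idempotent
completion. An equivalence of the latter permutes the indecomposable objects `X i` up to homogeneous
isomorphisms (`exists_realizes`; indecomposables which are isomorphic are isomorphic through a
homogeneous morphism), and so is recorded by a degree-adjusted automorphism of the base algebra.
This assignment is compatible with composition and turns isomorphisms of equivariant
autoequivalences into isomorphisms of degree-adjusted automorphisms, in both directions
(`EquivariantAut.Induces.isIsomorphic_iff`): the `X i` generate, and every morphism of `D` is an
entry of a homogeneous morphism of the orbit category.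

The Serre functor, with commutation isomorphism `s = -ζ`, induces a Nakayama automorphism `ν` of the
base algebra, because the functionals `f ↦ κ(id)(f₀₀)` form a sign-graded, nondegenerate and cyclic
trace (`SerreStructure.signedTrace`, `SignedTrace.exists_frobenius`). The defining isomorphisms
`Σ (x i) ≅ S (x (i + 1))` of the objects of the orbit category form an isomorphism of degree `1`
between the functors induced by `(Σ, -id)` and `(S, s)`, the two signs being matched
(`SerreStructure.exists_shift_lift_iso_serre_lift`), so the suspension induces `ν` with its degree
adjuster raised by `1`. As `const 1` is central, `(S, s)^m ≅ (Σ, -id)^N` becomes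
`ν^m ≅ ν^N const N`, that is `ν^(m - N) ≅ const N`. Finally the Nakayama automorphism does not
depend on the Frobenius structure, up to isomorphism
(`GradedFrobeniusStructure.nakayama_isIsomorphic`), and the canonical commutation isomorphism exists
because `D` is hom-finite (`SerreStructure.exists_isTraceComm`).
-/

set_option linter.unusedSectionVars false

noncomputable section

namespace FracCY

/-! ### Homogeneous components in hom-graded categories -/

namespace HomGraded

section Components

variable {k : Type w} [Field k] {E : Type u} [Category.{v} E] [Preadditive E] [Linear k E]
  [HomGraded k E]

variable (k) in
/-- A hom space as the external direct sum of its homogeneous pieces. -/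
def sumEquiv (x y : E) : (DirectSum ℤ fun p => gr (k := k) x y p) ≃ₗ[k] (x ⟶ y) :=
  LinearEquiv.ofBijective (DirectSum.coeLinearMap (gr (k := k) x y))
    (show Function.Bijective _ from isInternal x y)

variable (k) in
/-- The homogeneous component of degree `p` of a morphism. -/
def proj {x y : E} (p : ℤ) : (x ⟶ y) →ₗ[k] (x ⟶ y) :=
  (gr (k := k) x y p).subtype ∘ₗ DirectSum.component k ℤ (fun q => gr (k := k) x y q) p ∘ₗ
    (sumEquiv k x y).symm.toLinearMap

theorem proj_mem {x y : E} (p : ℤ) (f : x ⟶ y) : proj k p f ∈ gr (k := k) x y p :=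
  Submodule.coe_mem _

theorem symm_of_mem {x y : E} {p : ℤ} {f : x ⟶ y} (hf : f ∈ gr (k := k) x y p) :
    (sumEquiv k x y).symm f = DirectSum.lof k ℤ (fun q => gr (k := k) x y q) p ⟨f, hf⟩ := by
  rw [LinearEquiv.symm_apply_eq]
  exact (DirectSum.coeLinearMap_lof (gr (k := k) x y) p ⟨f, hf⟩).symm

theorem proj_of_mem {x y : E} {p : ℤ} {f : x ⟶ y} (hf : f ∈ gr (k := k) x y p) :
    proj k p f = f := by
  simp only [proj, LinearMap.comp_apply, LinearEquiv.coe_coe, symm_of_mem hf]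
  simp [DirectSum.component.lof_self]

theorem proj_of_mem_ne {x y : E} {p q : ℤ} {f : x ⟶ y} (hf : f ∈ gr (k := k) x y p)
    (h : p ≠ q) : proj k q f = 0 := by
  simp only [proj, LinearMap.comp_apply, LinearEquiv.coe_coe, symm_of_mem hf]
  rw [DirectSum.component.of, dif_neg h]
  simp

theorem mem_iSup_gr {x y : E} (f : x ⟶ y) : f ∈ ⨆ p, gr (k := k) x y p := by
  rw [(isInternal (k := k) x y).submodule_iSup_eq_top]
  trivial

/-- Every morphism is the sum of its components. -/
theorem exists_sum_proj {x y : E} (f : x ⟶ y) :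
    ∃ s : Finset ℤ, f = ∑ p ∈ s, proj k p f ∧ ∀ p ∉ s, proj k p f = 0 := by
  classical
  refine Submodule.iSup_induction' (gr (k := k) x y)
    (motive := fun f _ => ∃ s : Finset ℤ, f = ∑ p ∈ s, proj k p f ∧ ∀ p ∉ s, proj k p f = 0)
    (fun p f hf => ?_) ?_ ?_ (mem_iSup_gr (k := k) f)
  · refine ⟨{p}, by simp [proj_of_mem hf], fun q hq => proj_of_mem_ne hf ?_⟩
    simpa [eq_comm] using hq
  · exact ⟨∅, by simp, by simp⟩
  · rintro f g - - ⟨s, hs, hs'⟩ ⟨t, ht, ht'⟩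
    refine ⟨s ∪ t, ?_, fun p hp => ?_⟩
    · rw [Finset.sum_congr rfl (fun p _ => map_add (proj k p) f g), Finset.sum_add_distrib,
        ← Finset.sum_subset (Finset.subset_union_left (s₂ := t)) (fun p _ h => hs' p h),
        ← Finset.sum_subset (Finset.subset_union_right (s₁ := s)) (fun p _ h => ht' p h),
        ← hs, ← ht]
    · rw [Finset.mem_union, not_or] at hp
      rw [map_add, hs' p hp.1, ht' p hp.2, add_zero]

theorem mem_gr_of_proj {x y : E} {p : ℤ} {f : x ⟶ y} (h : ∀ q, q ≠ p → proj k q f = 0) :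
    f ∈ gr (k := k) x y p := by
  obtain ⟨s, hs, -⟩ := exists_sum_proj (k := k) f
  rw [hs]
  refine Submodule.sum_mem _ fun q _ => ?_
  by_cases hq : q = p
  · subst hq
    exact proj_mem q f
  · rw [h q hq]
    exact Submodule.zero_mem _

theorem eq_zero_of_proj {x y : E} {f : x ⟶ y} (h : ∀ q, proj k q f = 0) : f = 0 := by
  obtain ⟨s, hs, -⟩ := exists_sum_proj (k := k) f
  rw [hs]
  exact Finset.sum_eq_zero fun q _ => h q

/-- Two linear maps which agree on homogeneous morphisms are equal. -/
theorem linearMap_ext {x y : E} {M : Type*} [AddCommGroup M] [Module k M]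
    {a b : (x ⟶ y) →ₗ[k] M} (h : ∀ p, ∀ f ∈ gr (k := k) x y p, a f = b f) : a = b := by
  ext f
  obtain ⟨s, hs, -⟩ := exists_sum_proj (k := k) f
  rw [hs, map_sum, map_sum]
  exact Finset.sum_congr rfl fun p _ => h p _ (proj_mem p f)

theorem proj_comp_of_mem {x y z : E} {p : ℤ} {f : x ⟶ y} (hf : f ∈ gr (k := k) x y p)
    (q : ℤ) (g : y ⟶ z) : proj k (p + q) (f ≫ g) = f ≫ proj k q g := by
  refine LinearMap.congr_fun (linearMap_ext (k := k)
    (a := proj k (p + q) ∘ₗ Linear.leftComp k z f)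
    (b := Linear.leftComp k z f ∘ₗ proj k q) fun r g hg => ?_) g
  simp only [LinearMap.comp_apply, Linear.leftComp_apply]
  by_cases hr : r = q
  · subst hr
    rw [proj_of_mem hg, proj_of_mem (comp_mem hf hg)]
  · rw [proj_of_mem_ne hg hr, proj_of_mem_ne (comp_mem hf hg) (by omega), comp_zero]

/-- The degree `0` component of a composite. -/
theorem exists_proj_zero_comp {x y z : E} (f : x ⟶ y) (g : y ⟶ z) :
    ∃ s : Finset ℤ, proj k 0 (f ≫ g) = ∑ p ∈ s, proj k p f ≫ proj k (-p) g := by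
  obtain ⟨s, hs, -⟩ := exists_sum_proj (k := k) f
  refine ⟨s, ?_⟩
  conv_lhs => rw [hs, Preadditive.sum_comp, map_sum]
  refine Finset.sum_congr rfl fun p _ => ?_
  rw [← proj_comp_of_mem (proj_mem p f), add_neg_cancel]

/-- The inverse of a homogeneous isomorphism is homogeneous of the opposite degree. -/
theorem inv_mem {x y : E} {p : ℤ} (e : x ≅ y) (h : e.hom ∈ gr (k := k) x y p) :
    e.inv ∈ gr (k := k) y x (-p) := by
  refine mem_gr_of_proj fun q hq => ?_
  have h1 := proj_comp_of_mem h q e.inv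
  rw [e.hom_inv_id, proj_of_mem_ne (id_mem x) (by omega)] at h1
  rw [← cancel_epi e.hom, ← h1, comp_zero]

theorem comp_mem_of_eq {x y z : E} {p q r : ℤ} {f : x ⟶ y} {g : y ⟶ z}
    (hf : f ∈ gr (k := k) x y p) (hg : g ∈ gr (k := k) y z q) (h : p + q = r) :
    f ≫ g ∈ gr (k := k) x z r := h ▸ comp_mem hf hg

variable (k) in
/-- The sign operator, multiplying a morphism of degree `p` by `(-1) ^ p`. -/
def signOp {x y : E} : (x ⟶ y) →ₗ[k] (x ⟶ y) :=
  DirectSum.toModule k ℤ (x ⟶ y)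
    (fun p => charVal (sgn k) p • (gr (k := k) x y p).subtype) ∘ₗ
    (sumEquiv k x y).symm.toLinearMap

theorem signOp_of_mem {x y : E} {p : ℤ} {f : x ⟶ y} (hf : f ∈ gr (k := k) x y p) :
    signOp k f = charVal (sgn k) p • f := by
  simp only [signOp, LinearMap.comp_apply, LinearEquiv.coe_coe, symm_of_mem hf]
  simp [DirectSum.toModule_lof]

end Components

end HomGraded

theorem charVal_add {k : Type w} [Field k] (χ : Multiplicative ℤ →* kˣ) (p q : ℤ) :
    charVal χ (p + q) = charVal χ p * charVal χ q := by
  simp [charVal, ofAdd_add]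

theorem charVal_zero {k : Type w} [Field k] (χ : Multiplicative ℤ →* kˣ) :
    charVal χ 0 = 1 := by
  simp [charVal]

theorem charVal_sgn_one {k : Type w} [Field k] : charVal (sgn k) 1 = -1 := by
  simp [charVal, sgn]

theorem charVal_sgn_mul_self {k : Type w} [Field k] (p : ℤ) :
    charVal (sgn k) p * charVal (sgn k) p = 1 := by
  simp [charVal, sgn, ← mul_zpow]

namespace HomGraded

section Sign

variable {k : Type w} [Field k] {E : Type u} [Category.{v} E] [Preadditive E] [Linear k E]
  [HomGraded k E]

theorem signOp_signOp {x y : E} (f : x ⟶ y) : signOp k (signOp k f) = f := by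
  refine LinearMap.congr_fun (linearMap_ext (k := k) (a := signOp k ∘ₗ signOp k)
    (b := LinearMap.id) fun p f hf => ?_) f
  simp [signOp_of_mem hf, smul_smul, charVal_sgn_mul_self]

theorem signOp_comp {x y z : E} (f : x ⟶ y) (g : y ⟶ z) :
    signOp k (f ≫ g) = signOp k f ≫ signOp k g := by
  obtain ⟨s, hs, -⟩ := exists_sum_proj (k := k) f
  obtain ⟨t, ht, -⟩ := exists_sum_proj (k := k) g
  rw [hs, ht]
  simp only [Preadditive.sum_comp, Preadditive.comp_sum, map_sum]
  refine Finset.sum_congr rfl fun p _ => Finset.sum_congr rfl fun q _ => ?_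
  rw [signOp_of_mem (proj_mem _ f), signOp_of_mem (proj_mem _ g),
    signOp_of_mem (comp_mem (proj_mem _ f) (proj_mem _ g)), Linear.smul_comp, Linear.comp_smul,
    smul_smul, charVal_add]

end Sign

end HomGraded

/-! ### Entries of the algebra of a finite family of objects -/

namespace CatAlg

section Single

variable {k : Type w} [Field k] {E : Type u} [Category.{v} E] [Preadditive E] [Linear k E]
  {ι : Type t} [DecidableEq ι] {X : ι → E}

/-- The element with a single nonzero entry `f : X i ⟶ X j`. -/
def single (i j : ι) (f : X i ⟶ X j) : CatAlg X := fun i' j' =>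
  if h : i = i' ∧ j = j' then eqToHom (congrArg X h.1.symm) ≫ f ≫ eqToHom (congrArg X h.2)
  else 0

@[simp] theorem single_self (i j : ι) (f : X i ⟶ X j) : single i j f i j = f := by
  simp [single]

theorem single_of_ne {i j i' j' : ι} (f : X i ⟶ X j) (h : ¬ (i = i' ∧ j = j')) :
    single i j f i' j' = 0 := dif_neg h

theorem single_add (i j : ι) (f g : X i ⟶ X j) :
    single i j (f + g) = single i j f + single i j g := by
  ext i' j'
  rw [add_apply]
  by_cases h : i = i' ∧ j = j'
  · obtain ⟨rfl, rfl⟩ := h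
    simp
  · rw [single_of_ne _ h, single_of_ne _ h, single_of_ne _ h, add_zero]

theorem single_smul (c : k) (i j : ι) (f : X i ⟶ X j) :
    single i j (c • f) = c • single i j f := by
  ext i' j'
  rw [smul_apply]
  by_cases h : i = i' ∧ j = j'
  · obtain ⟨rfl, rfl⟩ := h
    simp
  · rw [single_of_ne _ h, single_of_ne _ h, smul_zero]

theorem single_zero (i j : ι) : single i j (0 : X i ⟶ X j) = 0 := by
  ext i' j'
  by_cases h : i = i' ∧ j = j'
  · obtain ⟨rfl, rfl⟩ := h
    simp
  · rw [single_of_ne _ h, zero_apply]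

variable [Fintype ι]

theorem vertex_eq_single (i : ι) : vertex X i = single i i (𝟙 (X i)) := by
  ext j l
  unfold vertex single
  by_cases h : j = l
  · subst h
    by_cases h' : j = i
    · subst h'
      simp
    · simp [h', Ne.symm h']
  · rw [dif_neg h, dif_neg]
    rintro ⟨rfl, rfl⟩
    exact h rfl

@[simp] theorem mul_single_apply (a : CatAlg X) (i j l : ι) (f : X i ⟶ X j) :
    (a * single i j f) i l = f ≫ a j l := by
  rw [mul_apply, Finset.sum_eq_single j]
  · simp
  · intro j' _ hj
    rw [single_of_ne _ (by simpa using Ne.symm hj), zero_comp]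
  · simp

theorem mul_single_apply_of_ne (a : CatAlg X) {i i' : ι} (j l : ι) (f : X i ⟶ X j)
    (h : i ≠ i') : (a * single i j f) i' l = 0 := by
  rw [mul_apply]
  refine Finset.sum_eq_zero fun j' _ => ?_
  rw [single_of_ne _ (by simp [h]), zero_comp]

@[simp] theorem single_mul_apply (a : CatAlg X) (i j l : ι) (f : X i ⟶ X j) :
    (single i j f * a) l j = a l i ≫ f := by
  rw [mul_apply, Finset.sum_eq_single i]
  · simp
  · intro j' _ hj
    rw [single_of_ne _ (by simpa using Ne.symm hj), comp_zero]
  · simp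

theorem single_mul_apply_of_ne (a : CatAlg X) {j j' : ι} (i l : ι) (f : X i ⟶ X j)
    (h : j ≠ j') : (single i j f * a) l j' = 0 := by
  rw [mul_apply]
  refine Finset.sum_eq_zero fun i' _ => ?_
  rw [single_of_ne _ (by simp [h]), comp_zero]

theorem single_mul_single (i j l : ι) (f : X i ⟶ X j) (g : X j ⟶ X l) :
    single j l g * single i j f = single i l (f ≫ g) := by
  ext i' l'
  by_cases hi : i = i'
  · subst hi
    by_cases hl : l = l'
    · subst hl
      simp
    · rw [single_mul_apply_of_ne _ _ _ _ hl, single_of_ne _ (by simp [hl])]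
  · rw [mul_single_apply_of_ne _ _ _ _ hi, single_of_ne _ (by simp [hi])]

theorem one_apply_self (i : ι) : (1 : CatAlg X) i i = 𝟙 (X i) := by
  simp [one_apply]

theorem one_apply_ne {i j : ι} (h : i ≠ j) : (1 : CatAlg X) i j = 0 := by
  simp [one_apply, h]

theorem sum_apply {α : Type*} (s : Finset α) (f : α → CatAlg X) (i j : ι) :
    (∑ r ∈ s, f r) i j = ∑ r ∈ s, f r i j := by
  classical
  induction s using Finset.induction_on with
  | empty => rfl
  | insert a s ha ih => rw [Finset.sum_insert ha, Finset.sum_insert ha, add_apply, ih]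

theorem vertex_mul_apply (a : CatAlg X) (i j : ι) : (vertex X j * a) i j = a i j := by
  rw [vertex_eq_single, single_mul_apply, Category.comp_id]

theorem mul_vertex_apply (a : CatAlg X) (i j : ι) : (a * vertex X i) i j = a i j := by
  rw [vertex_eq_single, mul_single_apply, Category.id_comp]

/-- The elements `a` with `a * e i = a` have entries only at source `X i`. -/
theorem apply_eq_zero_of_mul_vertex {a : CatAlg X} {i i' : ι} (h : a * vertex X i = a)
    (hi : i ≠ i') (j : ι) : a i' j = 0 := by
  rw [← h, vertex_eq_single, mul_single_apply_of_ne _ _ _ _ hi]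

variable [HomGraded k E]

theorem single_mem_grading {p : ℤ} {i j : ι} {f : X i ⟶ X j} :
    single i j f ∈ grading k X p ↔ f ∈ HomGraded.gr (k := k) (X i) (X j) p := by
  refine ⟨fun h => by simpa using h i j, fun h i' j' => ?_⟩
  by_cases hij : i = i' ∧ j = j'
  · obtain ⟨rfl, rfl⟩ := hij
    simpa using h
  · rw [single_of_ne _ hij]
    exact Submodule.zero_mem _

theorem vertex_mem_grading (i : ι) : vertex X i ∈ grading k X 0 := by
  rw [vertex_eq_single, single_mem_grading]
  exact HomGraded.id_mem _

theorem mul_mem_grading {p q : ℤ} {a b : CatAlg X} (ha : a ∈ grading k X p)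
    (hb : b ∈ grading k X q) : a * b ∈ grading k X (p + q) := by
  intro i l
  rw [mul_apply]
  refine Submodule.sum_mem _ fun j _ => ?_
  rw [add_comm]
  exact HomGraded.comp_mem (hb i j) (ha j l)

end Single

end CatAlg

/-! ### Degree-adjusted automorphisms acting on morphisms -/

namespace DegAdjAut

section MapHom

variable {k : Type w} [Field k] {E : Type u} [Category.{v} E] [Preadditive E] [Linear k E]
  [HomGraded k E] {ι : Type t} [Fintype ι] [DecidableEq ι] {X : ι → E}

open CatAlg

/-- The action of a degree-adjusted automorphism on the morphisms between the objects `X i`. -/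
def mapHom (F : DegAdjAut (CatAlg.grading k X) (CatAlg.vertex X)) {i j : ι} (f : X i ⟶ X j) :
    X (F.perm i) ⟶ X (F.perm j) :=
  F.toAlgEquiv (single i j f) (F.perm i) (F.perm j)

variable (F G : DegAdjAut (CatAlg.grading k X) (CatAlg.vertex X))

theorem vertex_mul_mul_vertex (a : CatAlg X) (i j : ι) :
    vertex X j * (a * vertex X i) = single i j (a i j) := by
  ext i' j'
  by_cases hj : j = j'
  · subst hj
    rw [vertex_mul_apply]
    by_cases hi : i = i'
    · subst hi
      rw [mul_vertex_apply, single_self]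
    · rw [vertex_eq_single, mul_single_apply_of_ne _ _ _ _ hi, single_of_ne _ (by simp [hi])]
  · rw [vertex_eq_single j, single_mul_apply_of_ne _ _ _ _ hj, single_of_ne _ (by simp [hj])]

theorem apply_perm_perm (a : CatAlg X) (i j : ι) :
    F.toAlgEquiv a (F.perm i) (F.perm j) = F.mapHom (a i j) := by
  rw [mapHom, ← vertex_mul_mul_vertex, map_mul, map_mul, F.map_vertex, F.map_vertex,
    vertex_mul_apply, mul_vertex_apply]

theorem apply_single {i j : ι} (f : X i ⟶ X j) :
    F.toAlgEquiv (single i j f) = single (F.perm i) (F.perm j) (F.mapHom f) := by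
  ext i' j'
  obtain ⟨i', rfl⟩ := F.perm.surjective i'
  obtain ⟨j', rfl⟩ := F.perm.surjective j'
  rw [apply_perm_perm]
  by_cases h : i = i' ∧ j = j'
  · obtain ⟨rfl, rfl⟩ := h
    simp
  · rw [single_of_ne _ h, single_of_ne _ (by simpa using h)]
    simp only [mapHom]
    rw [single_zero, map_zero, CatAlg.zero_apply]

theorem mapHom_comp {i j l : ι} (f : X i ⟶ X j) (g : X j ⟶ X l) :
    F.mapHom (f ≫ g) = F.mapHom f ≫ F.mapHom g := by
  have h := congrFun (congrFun (congrArg F.toAlgEquiv (single_mul_single i j l f g))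
    (F.perm i)) (F.perm l)
  rw [map_mul, apply_single, apply_single, single_mul_single, single_self] at h
  exact h.symm

theorem mapHom_id (i : ι) : F.mapHom (𝟙 (X i)) = 𝟙 (X (F.perm i)) := by
  rw [mapHom, ← vertex_eq_single, F.map_vertex, vertex_eq_single, single_self]

theorem mapHom_mem_iff {i j : ι} {f : X i ⟶ X j} {p : ℤ} :
    F.mapHom f ∈ HomGraded.gr (k := k) (X (F.perm i)) (X (F.perm j)) (p + F.adj j - F.adj i) ↔
      f ∈ HomGraded.gr (k := k) (X i) (X j) p := by
  rw [← single_mem_grading, ← single_mem_grading, ← apply_single]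
  exact F.map_mem_iff i j p _ (by rw [vertex_eq_single, single_mul_single, Category.comp_id])
    (by rw [vertex_eq_single, single_mul_single, Category.id_comp])

theorem mul_mapHom {i j : ι} (f : X i ⟶ X j) : (G * F).mapHom f = G.mapHom (F.mapHom f) := by
  change G.toAlgEquiv (F.toAlgEquiv (single i j f)) _ _ = _
  rw [apply_single]
  rfl

theorem const_mapHom (N : ℤ) {i j : ι} (f : X i ⟶ X j) :
    (const (CatAlg.grading k X) (CatAlg.vertex X) N).mapHom f = f :=
  single_self i j f

/-- The action on an isomorphism. -/
def mapIso {i j : ι} (f : X i ≅ X j) : X (F.perm i) ≅ X (F.perm j) where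
  hom := F.mapHom f.hom
  inv := F.mapHom f.inv
  hom_inv_id := by rw [← mapHom_comp, f.hom_inv_id, mapHom_id]
  inv_hom_id := by rw [← mapHom_comp, f.inv_hom_id, mapHom_id]

/-- An isomorphism of degree-adjusted automorphisms amounts to a family of homogeneous
isomorphisms of objects, natural for the actions on morphisms. -/
theorem isIsomorphic_iff : IsIsomorphic F G ↔
    ∃ β : ∀ i, X (F.perm i) ≅ X (G.perm i),
      (∀ i, (β i).hom ∈ HomGraded.gr (k := k) _ _ (G.adj i - F.adj i)) ∧
      ∀ i j (f : X i ⟶ X j), (β i).hom ≫ G.mapHom f = F.mapHom f ≫ (β j).hom := by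
  constructor
  · rintro ⟨b, hb, hdeg⟩
    have hb' : ∀ a : CatAlg X, F.toAlgEquiv a * ↑b⁻¹ = ↑b⁻¹ * G.toAlgEquiv a := fun a => by
      rw [Units.eq_inv_mul_iff_mul_eq, ← mul_assoc, ← hb, mul_assoc, Units.mul_inv, mul_one]
    have h0 : ∀ i j, j ≠ G.perm i → (b : CatAlg X) (F.perm i) j = 0 := fun i j hj => by
      have h := congrFun (congrFun (hb (vertex X i)) (F.perm i)) j
      rw [G.map_vertex, F.map_vertex, mul_vertex_apply] at h
      rw [← h, vertex_eq_single, single_mul_apply_of_ne _ _ _ _ hj.symm]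
    have h0' : ∀ i j, j ≠ F.perm i → (↑b⁻¹ : CatAlg X) (G.perm i) j = 0 := fun i j hj => by
      have h := congrFun (congrFun (hb' (vertex X i)) (G.perm i)) j
      rw [G.map_vertex, F.map_vertex, mul_vertex_apply] at h
      rw [← h, vertex_eq_single, single_mul_apply_of_ne _ _ _ _ hj.symm]
    refine ⟨fun i => ⟨(b : CatAlg X) (F.perm i) (G.perm i),
      (↑b⁻¹ : CatAlg X) (G.perm i) (F.perm i), ?_, ?_⟩, fun i => ?_, fun i j f => ?_⟩
    · have h := congrFun (congrFun b.inv_mul (F.perm i)) (F.perm i)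
      rw [one_apply_self, mul_apply, Finset.sum_eq_single (G.perm i)] at h
      · exact h
      · intro j _ hj
        rw [h0 i j hj, zero_comp]
      · simp
    · have h := congrFun (congrFun b.mul_inv (G.perm i)) (G.perm i)
      rw [one_apply_self, mul_apply, Finset.sum_eq_single (F.perm i)] at h
      · exact h
      · intro j _ hj
        rw [h0' i j hj, zero_comp]
      · simp
    · have h := hdeg i
      rw [G.map_vertex, F.map_vertex, mul_assoc, vertex_mul_mul_vertex,
        single_mem_grading] at h
      exact h
    · have h := congrFun (congrFun (hb (single i j f)) (F.perm i)) (G.perm j)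
      rw [apply_single, apply_single, single_mul_apply, mul_single_apply] at h
      exact h
  · rintro ⟨β, hdeg, hβ⟩
    let b : CatAlg X := ∑ i, single (F.perm i) (G.perm i) (β i).hom
    let c : CatAlg X := ∑ i, single (G.perm i) (F.perm i) (β i).inv
    have hm : ∀ (a : CatAlg X) i j, (a * b) (F.perm i) j = (β i).hom ≫ a (G.perm i) j := by
      intro a i j
      simp only [b]
      rw [Finset.mul_sum, CatAlg.sum_apply, Finset.sum_eq_single i]
      · rw [mul_single_apply]
      · intro l _ hl
        rw [mul_single_apply_of_ne _ _ _ _ (by simpa using hl)]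
      · simp
    have hm' : ∀ (a : CatAlg X) i j, (b * a) i (G.perm j) = a i (F.perm j) ≫ (β j).hom := by
      intro a i j
      simp only [b]
      rw [Finset.sum_mul, CatAlg.sum_apply, Finset.sum_eq_single j]
      · rw [single_mul_apply]
      · intro l _ hl
        rw [single_mul_apply_of_ne _ _ _ _ (by simpa using hl)]
      · simp
    have hb0 : ∀ i j, i ≠ j → b (F.perm i) (G.perm j) = 0 := by
      intro i j hij
      simp only [b]
      rw [CatAlg.sum_apply]
      refine Finset.sum_eq_zero fun l _ => single_of_ne _ ?_
      rintro ⟨h1, h2⟩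
      exact hij ((F.perm.injective h1).symm.trans (G.perm.injective h2))
    have hb1 : ∀ i, b (F.perm i) (G.perm i) = (β i).hom := by
      intro i
      have h := hm 1 i (G.perm i)
      rwa [one_mul, one_apply_self, Category.comp_id] at h
    have hc0 : ∀ i j, i ≠ j → c (G.perm i) (F.perm j) = 0 := by
      intro i j hij
      simp only [c]
      rw [CatAlg.sum_apply]
      refine Finset.sum_eq_zero fun l _ => single_of_ne _ ?_
      rintro ⟨h1, h2⟩
      exact hij ((G.perm.injective h1).symm.trans (F.perm.injective h2))
    have hc1 : ∀ i, c (G.perm i) (F.perm i) = (β i).inv := by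
      intro i
      simp only [c]
      rw [CatAlg.sum_apply, Finset.sum_eq_single i]
      · rw [single_self]
      · intro l _ hl
        exact single_of_ne _ (by simp [hl])
      · simp
    have hcb : c * b = 1 := by
      ext i j
      obtain ⟨i, rfl⟩ := F.perm.surjective i
      obtain ⟨j, rfl⟩ := F.perm.surjective j
      rw [hm]
      by_cases hij : i = j
      · subst hij
        rw [hc1, one_apply_self, Iso.hom_inv_id]
      · rw [hc0 i j hij, comp_zero, one_apply_ne (by simpa using hij)]
    have hbc : b * c = 1 := by
      ext i j
      obtain ⟨i, rfl⟩ := G.perm.surjective i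
      obtain ⟨j, rfl⟩ := G.perm.surjective j
      rw [hm']
      by_cases hij : i = j
      · subst hij
        rw [hc1, one_apply_self, Iso.inv_hom_id]
      · rw [hc0 i j hij, zero_comp, one_apply_ne (by simpa using hij)]
    refine ⟨⟨b, c, hbc, hcb⟩, fun a => ?_, fun i => ?_⟩
    · ext i j
      obtain ⟨i, rfl⟩ := F.perm.surjective i
      obtain ⟨j, rfl⟩ := G.perm.surjective j
      change (_ * b) _ _ = (b * _) _ _
      rw [hm, hm', apply_perm_perm, apply_perm_perm, hβ]
    · change _ * b * _ ∈ _
      rw [G.map_vertex, F.map_vertex, mul_assoc, vertex_mul_mul_vertex, single_mem_grading, hb1]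
      exact hdeg i

variable (k X) in
/-- Isomorphism is a congruence on the group of degree-adjusted automorphisms. -/
def isoCon :
    Con (DegAdjAut (CatAlg.grading k X) (CatAlg.vertex X)) where
  r := IsIsomorphic
  iseqv :=
    { refl := fun F => (isIsomorphic_iff F F).2 ⟨fun i => Iso.refl _, fun i => by
        rw [sub_self]
        exact HomGraded.id_mem _, fun i j f => by simp⟩
      symm := fun {F G} h => by
        obtain ⟨β, hdeg, hβ⟩ := (isIsomorphic_iff F G).1 h
        refine (isIsomorphic_iff G F).2 ⟨fun i => (β i).symm, fun i => ?_, fun i j f => ?_⟩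
        · have h := HomGraded.inv_mem (β i) (hdeg i)
          rwa [neg_sub] at h
        · simp only [Iso.symm_hom, Iso.inv_comp_eq]
          rw [← Category.assoc, hβ, Category.assoc, Iso.hom_inv_id, Category.comp_id]
      trans := fun {F G H} h h' => by
        obtain ⟨β, hdeg, hβ⟩ := (isIsomorphic_iff F G).1 h
        obtain ⟨γ, hdeg', hγ⟩ := (isIsomorphic_iff G H).1 h'
        refine (isIsomorphic_iff F H).2 ⟨fun i => β i ≪≫ γ i, fun i =>
          HomGraded.comp_mem_of_eq (hdeg i) (hdeg' i) (by ring), fun i j f => ?_⟩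
        simp [hγ, reassoc_of% hβ i j f] }
  mul' := fun {F' G' F G} h' h => by
    obtain ⟨β, hdeg, hβ⟩ := (isIsomorphic_iff F G).1 h
    obtain ⟨γ, hdeg', hγ⟩ := (isIsomorphic_iff F' G').1 h'
    refine (isIsomorphic_iff (F' * F) (G' * G)).2
      ⟨fun i => γ (F.perm i) ≪≫ G'.mapIso (β i), fun i => ?_, fun i j f => ?_⟩
    · have h := (G'.mapHom_mem_iff).2 (hdeg i)
      refine HomGraded.comp_mem_of_eq (hdeg' (F.perm i)) h ?_
      change _ = (G.adj i + G'.adj (G.perm i)) - (F.adj i + F'.adj (F.perm i))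
      ring
    · rw [mul_mapHom, mul_mapHom]
      change ((γ (F.perm i)).hom ≫ G'.mapHom (β i).hom) ≫ _ = _ ≫ (γ (F.perm j)).hom ≫
        G'.mapHom (β j).hom
      rw [Category.assoc, ← mapHom_comp, hβ, mapHom_comp, ← Category.assoc, hγ, Category.assoc]

theorem const_mul_comm (N : ℤ) : const _ _ N * F = F * const _ _ N := by
  ext i
  · rfl
  · rfl
  · exact add_comm _ _

theorem const_mul_const (M N : ℤ) :
    const (CatAlg.grading k X) (CatAlg.vertex X) M * const _ _ N = const _ _ (M + N) := by
  ext i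
  · rfl
  · rfl
  · exact add_comm _ _

theorem const_one_zpow (N : ℤ) :
    const (CatAlg.grading k X) (CatAlg.vertex X) 1 ^ N = const _ _ N := by
  induction N with
  | zero => rfl
  | succ n ih => rw [zpow_add_one, ih, const_mul_const]
  | pred n ih =>
    rw [zpow_sub_one, ih, mul_inv_eq_iff_eq_mul, const_mul_const, sub_add_cancel]

end MapHom

end DegAdjAut

/-! ### Graded functors represented by degree-adjusted automorphisms -/

section Realizes

variable {k : Type w} [Field k] {E : Type u} [Category.{v} E] [Preadditive E] [Linear k E]
  [HomGraded k E] {ι : Type t} [Fintype ι] [DecidableEq ι]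

variable (k) in
/-- A functor is graded if it preserves the degrees of morphisms. -/
def IsGradedFunctor (Ψ : E ⥤ E) : Prop :=
  ∀ {x y : E} (p : ℤ) (f : x ⟶ y), f ∈ HomGraded.gr (k := k) x y p →
    Ψ.map f ∈ HomGraded.gr (k := k) (Ψ.obj x) (Ψ.obj y) p

/-- A degree-adjusted automorphism represents a functor `Ψ` on the objects `X i` if there are
homogeneous isomorphisms `Ψ (X i) ≅ X (perm i)` of degree `adj i` which carry `Ψ` to it. -/
def Realizes {X : ι → E} (Ψ : E ⥤ E)
    (F : DegAdjAut (CatAlg.grading k X) (CatAlg.vertex X)) : Prop :=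
  ∃ u : ∀ i, Ψ.obj (X i) ≅ X (F.perm i),
    (∀ i, (u i).hom ∈ HomGraded.gr (k := k) _ _ (F.adj i)) ∧
    ∀ i j (f : X i ⟶ X j), (u i).hom ≫ F.mapHom f = Ψ.map f ≫ (u j).hom

variable {X : ι → E} {F G : DegAdjAut (CatAlg.grading k X) (CatAlg.vertex X)} {Ψ Ψ' : E ⥤ E}

theorem realizes_id : Realizes (k := k) (X := X) (𝟭 E) 1 :=
  ⟨fun i => Iso.refl _, fun i => HomGraded.id_mem _, fun i j f => by
    have h : (1 : DegAdjAut (CatAlg.grading k X) (CatAlg.vertex X)).mapHom f = f :=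
      DegAdjAut.const_mapHom 0 f
    exact (Category.id_comp _).trans (h.trans (Category.comp_id f).symm)⟩

theorem Realizes.comp (hΨ' : IsGradedFunctor k Ψ') (h : Realizes Ψ F) (h' : Realizes Ψ' G) :
    Realizes (Ψ ⋙ Ψ') (G * F) := by
  obtain ⟨u, hu, hF⟩ := h
  obtain ⟨u', hu', hG⟩ := h'
  refine ⟨fun i => Ψ'.mapIso (u i) ≪≫ u' (F.perm i), fun i =>
    HomGraded.comp_mem (hΨ' _ _ (hu i)) (hu' _), fun i j f => ?_⟩
  rw [DegAdjAut.mul_mapHom]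
  change (Ψ'.map (u i).hom ≫ (u' (F.perm i)).hom) ≫ _ =
    Ψ'.map (Ψ.map f) ≫ Ψ'.map (u j).hom ≫ (u' (F.perm j)).hom
  rw [Category.assoc, hG, ← Category.assoc, ← Category.assoc, ← Ψ'.map_comp, ← Ψ'.map_comp, hF]

/-- A natural isomorphism of degree `p` on the objects `X i` shifts the degrees by `p`. -/
theorem Realizes.of_natIso (p : ℤ) (θ : Ψ' ≅ Ψ)
    (hθ : ∀ i, θ.hom.app (X i) ∈ HomGraded.gr (k := k) _ _ p) (h : Realizes Ψ F) :
    Realizes Ψ' (F * DegAdjAut.const _ _ p) := by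
  obtain ⟨u, hu, hF⟩ := h
  refine ⟨fun i => θ.app (X i) ≪≫ u i, fun i => HomGraded.comp_mem (hθ i) (hu i),
    fun i j f => ?_⟩
  have h0 : (F * DegAdjAut.const _ _ p).mapHom f = F.mapHom f := by
    rw [DegAdjAut.mul_mapHom]
    exact congrArg F.mapHom (DegAdjAut.const_mapHom p f)
  have h1 : (θ.hom.app (X i) ≫ (u i).hom) ≫ F.mapHom f =
      Ψ'.map f ≫ θ.hom.app (X j) ≫ (u j).hom := by
    rw [Category.assoc, hF, ← Category.assoc, ← θ.hom.naturality, Category.assoc]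
  rw [h0]
  exact h1

theorem Realizes.of_natIso_zero (θ : Ψ' ≅ Ψ)
    (hθ : ∀ i, θ.hom.app (X i) ∈ HomGraded.gr (k := k) _ _ 0) (h : Realizes Ψ F) :
    Realizes Ψ' F := by
  have h' := h.of_natIso 0 θ hθ
  have : F * DegAdjAut.const _ _ 0 = F := mul_one F
  rwa [this] at h'

/-- The objects `X i` generate: every identity morphism is a sum of composites through the
`X i`. -/
def Generates (X : ι → E) : Prop :=
  ∀ P : E, ∃ (n : ℕ) (c : Fin n → ι) (f : ∀ r, P ⟶ X (c r)) (g : ∀ r, X (c r) ⟶ P),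
    ∑ r, f r ≫ g r = 𝟙 P

/-- The factorization through the `X i` can be chosen homogeneous of total degree `0`, as the
identity is the degree `0` part of the given sum. -/
theorem Generates.homogeneous (hX : Generates X) (P : E) :
    ∃ (α : Type) (s : Finset α) (c : α → ι) (d : α → ℤ) (f : ∀ r, P ⟶ X (c r))
      (g : ∀ r, X (c r) ⟶ P), (∀ r, f r ∈ HomGraded.gr (k := k) _ _ (d r)) ∧
      (∀ r, g r ∈ HomGraded.gr (k := k) _ _ (- d r)) ∧ ∑ r ∈ s, f r ≫ g r = 𝟙 P := by
  obtain ⟨n, c, f, g, h⟩ := hX P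
  choose s hs using fun r => HomGraded.exists_proj_zero_comp (k := k) (f r) (g r)
  refine ⟨Σ _ : Fin n, ℤ, Finset.univ.sigma s, fun r => c r.1, fun r => r.2,
    fun r => HomGraded.proj k r.2 (f r.1), fun r => HomGraded.proj k (- r.2) (g r.1),
    fun r => HomGraded.proj_mem _ _, fun r => HomGraded.proj_mem _ _, ?_⟩
  rw [Finset.sum_sigma]
  simp only [← hs]
  rw [← map_sum, h, HomGraded.proj_of_mem (HomGraded.id_mem P)]

/-- A family of morphisms `Ψ (X i) ⟶ Ψ' (X i)`, natural for the morphisms between generators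
`X i` and homogeneous of degree `0`, extends to a natural transformation. -/
theorem Generates.exists_natTrans [Ψ.Additive] [Ψ'.Additive] (hΨ : IsGradedFunctor k Ψ)
    (hΨ' : IsGradedFunctor k Ψ') (hX : Generates X) (θ : ∀ i, Ψ.obj (X i) ⟶ Ψ'.obj (X i))
    (hθ : ∀ i j (f : X i ⟶ X j), Ψ.map f ≫ θ j = θ i ≫ Ψ'.map f)
    (hdeg : ∀ i, θ i ∈ HomGraded.gr (k := k) _ _ 0) :
    ∃ Θ : Ψ ⟶ Ψ', (∀ i, Θ.app (X i) = θ i) ∧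
      ∀ P, Θ.app P ∈ HomGraded.gr (k := k) _ _ 0 := by
  choose α s c d f g hf hg h using hX.homogeneous (k := k)
  let η : ∀ P, Ψ.obj P ⟶ Ψ'.obj P := fun P =>
    ∑ r ∈ s P, Ψ.map (f P r) ≫ θ (c P r) ≫ Ψ'.map (g P r)
  have h1 : ∀ P i (a : P ⟶ X i), η P ≫ Ψ'.map a = Ψ.map a ≫ θ i := by
    intro P i a
    have h2 : a = ∑ r ∈ s P, f P r ≫ g P r ≫ a := by
      simp only [← Category.assoc]
      rw [← Preadditive.sum_comp, h, Category.id_comp]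
    conv_rhs => rw [h2]
    simp only [η, Preadditive.sum_comp, Functor.map_sum]
    refine Finset.sum_congr rfl fun r _ => ?_
    rw [Ψ.map_comp, Category.assoc, Category.assoc, Category.assoc, ← Ψ'.map_comp, hθ]
  refine ⟨{ app := η, naturality := fun P Q a => ?_ }, fun i => ?_, fun P => ?_⟩
  · have h2 : a = ∑ r ∈ s Q, a ≫ f Q r ≫ g Q r := by
      rw [← Preadditive.comp_sum, h, Category.comp_id]
    conv_rhs => rw [h2]
    simp only [η, Preadditive.comp_sum, Functor.map_sum]
    refine Finset.sum_congr rfl fun r _ => ?_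
    rw [← Category.assoc a, Ψ'.map_comp, ← Category.assoc (η P), h1, Ψ.map_comp]
    simp only [Category.assoc]
  · have h2 := h1 (X i) i (𝟙 _)
    simpa using h2
  · refine Submodule.sum_mem _ fun r _ => ?_
    refine HomGraded.comp_mem_of_eq (hΨ _ _ (hf P r))
      (HomGraded.comp_mem (hdeg _) (hΨ' _ _ (hg P r))) (by ring)

theorem Generates.natTrans_ext [Ψ.Additive] [Ψ'.Additive] (hX : Generates X)
    {Θ Θ' : Ψ ⟶ Ψ'} (h : ∀ i, Θ.app (X i) = Θ'.app (X i)) : Θ = Θ' := by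
  ext P
  obtain ⟨n, c, f, g, hP⟩ := hX P
  have : ∀ Θ : Ψ ⟶ Ψ', Θ.app P = ∑ r, Ψ.map (f r) ≫ Θ.app (X (c r)) ≫ Ψ'.map (g r) := by
    intro Θ
    rw [← Category.id_comp (Θ.app P), ← Ψ.map_id, ← hP, Functor.map_sum, Preadditive.sum_comp]
    refine Finset.sum_congr rfl fun r _ => ?_
    rw [Ψ.map_comp, Category.assoc, Θ.naturality]
  rw [this, this Θ']
  simp [h]

/-- Functors are isomorphic through degree `0` if and only if the degree-adjusted automorphisms
which represent them are isomorphic. -/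
theorem Realizes.isIsomorphic_iff [Ψ.Additive] [Ψ'.Additive] (hΨ : IsGradedFunctor k Ψ)
    (hΨ' : IsGradedFunctor k Ψ') (hX : Generates X) (h : Realizes Ψ F) (h' : Realizes Ψ' G) :
    DegAdjAut.IsIsomorphic F G ↔
      ∃ θ : Ψ ≅ Ψ', ∀ P, θ.hom.app P ∈ HomGraded.gr (k := k) _ _ 0 := by
  obtain ⟨u, hu, hF⟩ := h
  obtain ⟨u', hu', hG⟩ := h'
  rw [DegAdjAut.isIsomorphic_iff]
  constructor
  · rintro ⟨β, hdeg, hβ⟩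
    let θ : ∀ i, Ψ.obj (X i) ≅ Ψ'.obj (X i) := fun i => u i ≪≫ β i ≪≫ (u' i).symm
    have hθ0 : ∀ i, (θ i).hom ∈ HomGraded.gr (k := k) _ _ 0 := fun i =>
      HomGraded.comp_mem_of_eq (hu i)
        (HomGraded.comp_mem (hdeg i) (HomGraded.inv_mem _ (hu' i))) (by ring)
    have hθ : ∀ i j (f : X i ⟶ X j), Ψ.map f ≫ (θ j).hom = (θ i).hom ≫ Ψ'.map f := by
      intro i j f
      have h1 : Ψ'.map f = (u' i).hom ≫ G.mapHom f ≫ (u' j).inv := by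
        rw [← Category.assoc, hG, Category.assoc, Iso.hom_inv_id, Category.comp_id]
      simp only [θ, Iso.trans_hom, Iso.symm_hom, h1, Category.assoc, Iso.inv_hom_id_assoc]
      rw [← Category.assoc, ← hF, Category.assoc, ← reassoc_of% hβ]
    obtain ⟨Θ, hΘ, hΘ0⟩ := hX.exists_natTrans hΨ hΨ' (fun i => (θ i).hom) hθ hθ0
    obtain ⟨Θ', hΘ', -⟩ := hX.exists_natTrans hΨ' hΨ (fun i => (θ i).inv)
      (fun i j f => by rw [Iso.eq_inv_comp, ← Category.assoc, ← hθ, Category.assoc,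
        Iso.hom_inv_id, Category.comp_id])
      (fun i => by simpa using HomGraded.inv_mem _ (hθ0 i))
    refine ⟨⟨Θ, Θ', hX.natTrans_ext fun i => ?_, hX.natTrans_ext fun i => ?_⟩, hΘ0⟩
    · simp [hΘ, hΘ']
    · simp [hΘ, hΘ']
  · rintro ⟨θ, hθ⟩
    refine ⟨fun i => (u i).symm ≪≫ θ.app (X i) ≪≫ u' i, fun i =>
      HomGraded.comp_mem_of_eq (HomGraded.inv_mem _ (hu i))
        (HomGraded.comp_mem (hθ _) (hu' i)) (by ring), fun i j f => ?_⟩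
    have h1 : F.mapHom f = (u i).inv ≫ Ψ.map f ≫ (u j).hom := by rw [← hF, Iso.inv_hom_id_assoc]
    simp only [Iso.trans_hom, Iso.symm_hom, Iso.app_hom, Category.assoc, hG, h1,
      Iso.hom_inv_id_assoc]
    rw [← Category.assoc (θ.hom.app _), ← θ.hom.naturality, Category.assoc]

end Realizes

/-! ### Indecomposable objects -/

section Indec

variable {k : Type w} [Field k] {E : Type u} [Category.{v} E] [Preadditive E] [Linear k E]

/-- Indecomposability in terms of complementary retracts. -/
theorem isIndec_iff {x : E} : IsIndec x ↔ ¬ IsZero x ∧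
    ∀ (y z : E) (i₁ : y ⟶ x) (r₁ : x ⟶ y) (i₂ : z ⟶ x) (r₂ : x ⟶ z),
      i₁ ≫ r₁ = 𝟙 y → i₂ ≫ r₂ = 𝟙 z → i₁ ≫ r₂ = 0 → i₂ ≫ r₁ = 0 →
      r₁ ≫ i₁ + r₂ ≫ i₂ = 𝟙 x → IsZero y ∨ IsZero z := by
  refine and_congr_right fun _ => ⟨fun h y z i₁ r₁ i₂ r₂ h1 h2 h3 h4 h5 => ?_,
    fun h y z b ⟨hb⟩ ⟨e⟩ => ?_⟩
  · exact h y z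
      { pt := x, fst := r₁, snd := r₂, inl := i₁, inr := i₂, inl_fst := h1, inl_snd := h3
        inr_fst := h4, inr_snd := h2 } ⟨isBinaryBilimitOfTotal _ h5⟩ ⟨Iso.refl _⟩
  · refine h y z (b.inl ≫ e.inv) (e.hom ≫ b.fst) (b.inr ≫ e.inv) (e.hom ≫ b.snd)
      (by simp) (by simp) (by simp) (by simp) ?_
    have h1 := IsBilimit.binary_total hb
    have h2 : (e.hom ≫ b.fst) ≫ b.inl ≫ e.inv + (e.hom ≫ b.snd) ≫ b.inr ≫ e.inv =
        e.hom ≫ (b.fst ≫ b.inl + b.snd ≫ b.inr) ≫ e.inv := by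
      simp
    rw [h2, h1]
    simp

/-- Equivalences preserve indecomposable objects. -/
theorem IsIndec.map {x : E} (hx : IsIndec x) (Ψ : E ⥤ E) [Ψ.Additive] [Ψ.IsEquivalence] :
    IsIndec (Ψ.obj x) := by
  rw [isIndec_iff] at hx ⊢
  have hz : ∀ y, IsZero (Ψ.obj y) → IsZero y := by
    intro y hy
    rw [IsZero.iff_id_eq_zero] at hy ⊢
    apply Ψ.map_injective
    rw [Ψ.map_id, hy, Ψ.map_zero]
  refine ⟨fun h => hx.1 (hz _ h), fun y z i₁ r₁ i₂ r₂ h1 h2 h3 h4 h5 => ?_⟩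
  let a := Ψ.objObjPreimageIso y
  let b := Ψ.objObjPreimageIso z
  have h := hx.2 (Ψ.objPreimage y) (Ψ.objPreimage z) (Ψ.preimage (a.hom ≫ i₁))
    (Ψ.preimage (r₁ ≫ a.inv)) (Ψ.preimage (b.hom ≫ i₂)) (Ψ.preimage (r₂ ≫ b.inv))
    (Ψ.map_injective (by simp [reassoc_of% h1])) (Ψ.map_injective (by simp [reassoc_of% h2]))
    (Ψ.map_injective (by simp [reassoc_of% h3])) (Ψ.map_injective (by simp [reassoc_of% h4]))
    (Ψ.map_injective (by simp [Ψ.map_add, h5]))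
  have hz' : ∀ {y y' : E}, (Ψ.obj y' ≅ y) → IsZero y' → IsZero y := by
    intro y y' e hy
    rw [IsZero.iff_id_eq_zero] at hy ⊢
    rw [← e.inv_hom_id, ← Category.id_comp e.hom, ← Ψ.map_id, hy, Ψ.map_zero, zero_comp, comp_zero]
  exact h.imp (hz' a) (hz' b)

variable {ι : Type t} {X : ι → E}

/-- In a hom-finite category the indecomposable objects generate: an object which is not
indecomposable splits into two objects with smaller endomorphism algebras. -/
theorem IsIndecSkeleton.generates (hX : IsIndecSkeleton X)
    (hfin : ∀ x y : E, Module.Finite k (x ⟶ y)) : Generates X := by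
  intro P
  induction hn : Module.finrank k (P ⟶ P) using Nat.strong_induction_on generalizing P with
  | _ n ih =>
  subst hn
  by_cases h0 : IsZero P
  · exact ⟨0, Fin.elim0, fun r => r.elim0, fun r => r.elim0, by
      simpa using (IsZero.iff_id_eq_zero P).1 h0 |>.symm⟩
  by_cases hP : IsIndec P
  · obtain ⟨i, ⟨e⟩⟩ := hX.surj P hP
    exact ⟨1, fun _ => i, fun _ => e.hom, fun _ => e.inv, by simp⟩
  rw [isIndec_iff] at hP
  push Not at hP
  obtain ⟨y, z, i₁, r₁, i₂, r₂, h1, h2, h3, h4, h5, hy, hz⟩ := hP h0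
  let L : (y ⟶ y) × (z ⟶ z) →ₗ[k] (P ⟶ P) :=
    ((Linear.leftComp k P r₁ ∘ₗ Linear.rightComp k y i₁) ∘ₗ LinearMap.fst k _ _) +
    ((Linear.leftComp k P r₂ ∘ₗ Linear.rightComp k z i₂) ∘ₗ LinearMap.snd k _ _)
  have hL : ∀ a b, L (a, b) = r₁ ≫ a ≫ i₁ + r₂ ≫ b ≫ i₂ := fun a b => rfl
  have hinj : Function.Injective L := by
    rw [← LinearMap.ker_eq_bot, LinearMap.ker_eq_bot']
    rintro ⟨a, b⟩ hab
    rw [hL] at hab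
    have ha : i₁ ≫ (r₁ ≫ a ≫ i₁ + r₂ ≫ b ≫ i₂) ≫ r₁ = a := by
      simp [reassoc_of% h1, h1, reassoc_of% h3]
    have hb : i₂ ≫ (r₁ ≫ a ≫ i₁ + r₂ ≫ b ≫ i₂) ≫ r₂ = b := by
      simp [reassoc_of% h2, h2, reassoc_of% h4]
    rw [hab, zero_comp, comp_zero] at ha hb
    rw [← ha, ← hb]
    rfl
  have hle := LinearMap.finrank_le_finrank_of_injective hinj
  rw [Module.finrank_prod] at hle
  have hpos : ∀ y : E, ¬ IsZero y → 0 < Module.finrank k (y ⟶ y) := by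
    intro y hy
    rw [Module.finrank_pos_iff_exists_ne_zero]
    exact ⟨𝟙 y, fun h => hy ((IsZero.iff_id_eq_zero y).2 h)⟩
  have hy' := hpos y hy
  have hz' := hpos z hz
  obtain ⟨n, c, f, g, h⟩ := ih _ (by omega) y rfl
  obtain ⟨n', c', f', g', h'⟩ := ih _ (by omega) z rfl
  have key : ∃ (f'' : ∀ r : Fin n ⊕ Fin n', P ⟶ X (Sum.elim c c' r))
      (g'' : ∀ r : Fin n ⊕ Fin n', X (Sum.elim c c' r) ⟶ P), ∑ r, f'' r ≫ g'' r = 𝟙 P := by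
    refine ⟨fun r => match r with
      | .inl r => r₁ ≫ f r
      | .inr r => r₂ ≫ f' r, fun r => match r with
      | .inl r => g r ≫ i₁
      | .inr r => g' r ≫ i₂, ?_⟩
    have e1 : ∑ r, (r₁ ≫ f r) ≫ g r ≫ i₁ = r₁ ≫ i₁ := by
      have e : ∀ r, (r₁ ≫ f r) ≫ g r ≫ i₁ = r₁ ≫ (f r ≫ g r) ≫ i₁ := fun r => by simp
      simp only [e]
      rw [← Preadditive.comp_sum, ← Preadditive.sum_comp, h, Category.id_comp]
    have e2 : ∑ r, (r₂ ≫ f' r) ≫ g' r ≫ i₂ = r₂ ≫ i₂ := by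
      have e : ∀ r, (r₂ ≫ f' r) ≫ g' r ≫ i₂ = r₂ ≫ (f' r ≫ g' r) ≫ i₂ := fun r => by simp
      simp only [e]
      rw [← Preadditive.comp_sum, ← Preadditive.sum_comp, h', Category.id_comp]
    rw [Fintype.sum_sum_type, ← h5]
    exact congrArg₂ (· + ·) e1 e2
  obtain ⟨f'', g'', h''⟩ := key
  refine ⟨n + n', fun r => Sum.elim c c' (finSumFinEquiv.symm r),
    fun r => f'' (finSumFinEquiv.symm r), fun r => g'' (finSumFinEquiv.symm r), ?_⟩
  rw [← h'']
  exact finSumFinEquiv.symm.sum_comp (fun r => f'' r ≫ g'' r)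

end Indec

/-! ### Homogeneous isomorphisms between indecomposable objects -/

/-- An element of a finite-dimensional algebra is nilpotent or invertible, unless a nontrivial
idempotent is a polynomial in it. -/
theorem isUnit_or_isNilpotent_of_idempotent {k : Type w} [Field k] {A : Type v} [Ring A]
    [Algebra k A] [Module.Finite k A] (r : A)
    (h : ∀ e ∈ Algebra.adjoin k {r}, e * e = e → e = 0 ∨ e = 1) : IsUnit r ∨ IsNilpotent r := by
  have hint : IsIntegral k r := Algebra.IsIntegral.isIntegral r
  have hμ : minpoly k r ≠ 0 := minpoly.ne_zero hint
  obtain ⟨q, hq, hX⟩ := Polynomial.exists_eq_pow_rootMultiplicity_mul_and_not_dvd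
    (minpoly k r) hμ 0
  rw [map_zero, sub_zero] at hq hX
  set n := (minpoly k r).rootMultiplicity 0
  -- Split off the nilpotent part: `minpoly = X ^ n * q` with `X ∤ q`; the exponent `n + 1` keeps
  -- a factor `r` in the idempotent also when `n = 0`.
  have hcop : IsCoprime (Polynomial.X ^ (n + 1) : Polynomial k) q :=
    IsCoprime.pow_left ((Polynomial.irreducible_X.coprime_iff_not_dvd).2 hX)
  obtain ⟨a, b, hab⟩ := hcop
  have h0 : r ^ (n + 1) * Polynomial.aeval r q = 0 := by
    have h1 : Polynomial.aeval r (minpoly k r) = 0 := minpoly.aeval k r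
    rw [hq, map_mul, map_pow, Polynomial.aeval_X] at h1
    rw [pow_succ', mul_assoc, h1, mul_zero]
  have h1 : Polynomial.aeval r a * r ^ (n + 1) + Polynomial.aeval r b * Polynomial.aeval r q
      = 1 := by
    have := congrArg (Polynomial.aeval r) hab
    simpa using this
  have hcomm : ∀ p p' : Polynomial k, Polynomial.aeval r p * Polynomial.aeval r p' =
      Polynomial.aeval r p' * Polynomial.aeval r p := fun p p' => by
    rw [← map_mul, mul_comm, map_mul]
  have hX' : Polynomial.aeval r (Polynomial.X ^ (n + 1) : Polynomial k) = r ^ (n + 1) := by simp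
  have he0 : (Polynomial.aeval r a * r ^ (n + 1)) *
      (Polynomial.aeval r b * Polynomial.aeval r q) = 0 := by
    rw [hcomm b q, mul_assoc, ← mul_assoc (r ^ (n + 1)), h0, zero_mul, mul_zero]
  have he : (Polynomial.aeval r a * r ^ (n + 1)) * (Polynomial.aeval r a * r ^ (n + 1)) =
      Polynomial.aeval r a * r ^ (n + 1) := by
    conv_rhs => rw [← mul_one (Polynomial.aeval r a * r ^ (n + 1)), ← h1, mul_add, he0, add_zero]
  have hmem : Polynomial.aeval r a * r ^ (n + 1) ∈ Algebra.adjoin k {r} := by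
    rw [← hX', ← map_mul]
    exact Polynomial.aeval_mem_adjoin_singleton k r
  rcases h _ hmem he with h2 | h2
  · right
    rw [h2, zero_add] at h1
    refine ⟨n + 1, ?_⟩
    rw [← mul_one (r ^ (n + 1)), ← h1, hcomm, ← mul_assoc, h0, zero_mul]
  · left
    refine ⟨⟨r, Polynomial.aeval r a * r ^ n, ?_, ?_⟩, rfl⟩
    · rw [← h2, ← hX', hcomm, hX', pow_succ', mul_assoc]
      congr 1
      have : r ^ n = Polynomial.aeval r (Polynomial.X ^ n : Polynomial k) := by simp
      rw [this, hcomm]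
    · rw [mul_assoc, ← pow_succ, h2]

section HomogeneousIso

variable {k : Type w} [Field k] {E : Type u} [Category.{v} E] [Preadditive E] [Linear k E]
  [HomGraded k E]

variable (k E) in
/-- Idempotent endomorphisms of degree `0` split. -/
def DegreeZeroIdempotentsSplit : Prop :=
  ∀ (x : E) (e : x ⟶ x), e ∈ HomGraded.gr (k := k) x x 0 → e ≫ e = e →
    ∃ (y : E) (i : y ⟶ x) (r : x ⟶ y), i ≫ r = 𝟙 y ∧ r ≫ i = e

theorem IsIndec.idempotent_trivial (hE : DegreeZeroIdempotentsSplit k E) {x : E}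
    (hx : IsIndec x) (e : x ⟶ x) (he : e ∈ HomGraded.gr (k := k) x x 0) (hee : e ≫ e = e) :
    e = 0 ∨ e = 𝟙 x := by
  obtain ⟨y, i₁, r₁, h1, h1'⟩ := hE x e he hee
  obtain ⟨z, i₂, r₂, h2, h2'⟩ := hE x (𝟙 x - e) (Submodule.sub_mem _ (HomGraded.id_mem x) he)
    (by simp [hee])
  have h3 : i₁ ≫ r₂ = 0 := by
    rw [← Category.id_comp (i₁ ≫ r₂), ← h1, ← Category.comp_id r₂, ← h2]
    have : (i₁ ≫ r₁) ≫ i₁ ≫ r₂ ≫ i₂ ≫ r₂ = i₁ ≫ (r₁ ≫ i₁) ≫ (r₂ ≫ i₂) ≫ r₂ := by simp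
    rw [this, h1', h2', ← Category.assoc e]
    simp [hee]
  have h4 : i₂ ≫ r₁ = 0 := by
    rw [← Category.id_comp (i₂ ≫ r₁), ← h2, ← Category.comp_id r₁, ← h1]
    have : (i₂ ≫ r₂) ≫ i₂ ≫ r₁ ≫ i₁ ≫ r₁ = i₂ ≫ (r₂ ≫ i₂) ≫ (r₁ ≫ i₁) ≫ r₁ := by simp
    rw [this, h1', h2', ← Category.assoc (𝟙 x - e)]
    simp [hee]
  rcases (isIndec_iff.1 hx).2 y z i₁ r₁ i₂ r₂ h1 h2 h3 h4 (by rw [h1', h2']; simp) with h | h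
  · left
    rw [← h1', h.eq_of_tgt r₁ 0, zero_comp]
  · right
    rw [h.eq_of_tgt r₂ 0, zero_comp] at h2'
    exact (sub_eq_zero.1 h2'.symm).symm

/-- Endomorphisms of degree `0` of an indecomposable object are invertible or nilpotent. -/
theorem IsIndec.isIso_or_nilpotent (hE : DegreeZeroIdempotentsSplit k E)
    (hfin : ∀ x y : E, Module.Finite k (x ⟶ y)) {x : E}
    (hx : IsIndec x) (r : End x) (hr : r ∈ HomGraded.gr (k := k) x x 0) :
    IsUnit r ∨ IsNilpotent r := by
  have : Module.Finite k (End x) := hfin x x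
  refine isUnit_or_isNilpotent_of_idempotent (k := k) r fun e he hee => ?_
  refine hx.idempotent_trivial hE e ?_ hee
  let R : Subalgebra k (End x) :=
    { carrier := {e | (e : x ⟶ x) ∈ HomGraded.gr (k := k) x x 0}
      mul_mem' := fun {a b} ha hb => HomGraded.comp_mem_of_eq (f := (b : x ⟶ x))
        (g := (a : x ⟶ x)) hb ha (by ring)
      add_mem' := fun ha hb => Submodule.add_mem _ ha hb
      algebraMap_mem' := fun c => by
        rw [Algebra.algebraMap_eq_smul_one]
        exact Submodule.smul_mem _ _ (HomGraded.id_mem x) }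
  exact (Algebra.adjoin_le (S := R) (Set.singleton_subset_iff.2 hr)) he

/-- If a sum of endomorphisms of degree `0` of an indecomposable object is invertible, then one
of the summands is. -/
theorem IsIndec.exists_isIso_of_sum (hE : DegreeZeroIdempotentsSplit k E)
    (hfin : ∀ x y : E, Module.Finite k (x ⟶ y)) {x : E}
    (hx : IsIndec x) {α : Type*} (s : Finset α) (h : α → (x ⟶ x))
    (h0 : ∀ a, h a ∈ HomGraded.gr (k := k) x x 0) (hs : IsIso (∑ a ∈ s, h a)) :
    ∃ a ∈ s, IsIso (h a) := by
  classical
  induction s using Finset.induction_on with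
  | empty =>
    refine absurd ((IsZero.iff_id_eq_zero x).2 ?_) hx.1
    rw [Finset.sum_empty] at hs
    rw [← IsIso.hom_inv_id (0 : x ⟶ x), zero_comp]
  | insert a s ha ih =>
    rw [Finset.sum_insert ha] at hs
    have hv : inv (h a + ∑ a ∈ s, h a) ∈ HomGraded.gr (k := k) x x 0 := by
      have := HomGraded.inv_mem (k := k) (asIso (h a + ∑ a ∈ s, h a))
        (Submodule.add_mem _ (h0 a) (Submodule.sum_mem _ fun b _ => h0 b))
      simpa using this
    set v := h a + ∑ a ∈ s, h a
    have h1 : inv v ≫ h a + inv v ≫ ∑ a ∈ s, h a = 𝟙 x := by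
      rw [← Preadditive.comp_add, IsIso.inv_hom_id]
    have key : IsIso (inv v ≫ h a) ∨ IsIso (inv v ≫ ∑ a ∈ s, h a) := by
      rcases hx.isIso_or_nilpotent hE hfin (inv v ≫ h a)
        (HomGraded.comp_mem_of_eq hv (h0 a) (by ring)) with h2 | h2
      · exact Or.inl ((isUnit_iff_isIso _).1 h2)
      · right
        have h3 := h2.isUnit_one_sub
        have h4 : inv v ≫ ∑ a ∈ s, h a = 𝟙 x - inv v ≫ h a := eq_sub_iff_add_eq'.2 h1
        rw [h4]
        exact (isUnit_iff_isIso _).1 h3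
    rcases key with h2 | h2
    · exact ⟨a, Finset.mem_insert_self _ _, IsIso.of_isIso_comp_left (inv v) (h a)⟩
    · obtain ⟨b, hb, hb'⟩ := ih (IsIso.of_isIso_comp_left (inv v) _)
      exact ⟨b, Finset.mem_insert_of_mem hb, hb'⟩

/-- Isomorphic indecomposable objects are isomorphic through a homogeneous isomorphism. -/
theorem IsIndec.exists_homogeneous_iso (hE : DegreeZeroIdempotentsSplit k E)
    (hfin : ∀ x y : E, Module.Finite k (x ⟶ y)) {x y : E}
    (hx : IsIndec x) (hy : IsIndec y) (φ : x ≅ y) :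
    ∃ (p : ℤ) (u : x ≅ y), u.hom ∈ HomGraded.gr (k := k) x y p := by
  obtain ⟨s, hs⟩ := HomGraded.exists_proj_zero_comp (k := k) φ.hom φ.inv
  rw [φ.hom_inv_id, HomGraded.proj_of_mem (HomGraded.id_mem x)] at hs
  obtain ⟨p, -, hp⟩ := hx.exists_isIso_of_sum hE hfin s
    (fun p => HomGraded.proj k p φ.hom ≫ HomGraded.proj k (-p) φ.inv)
    (fun p => HomGraded.comp_mem_of_eq (HomGraded.proj_mem _ _) (HomGraded.proj_mem _ _)
      (by ring)) (by rw [← hs]; infer_instance)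
  set f := HomGraded.proj k p φ.hom with hf
  set g := HomGraded.proj k (-p) φ.inv with hg
  have hf0 : f ∈ HomGraded.gr (k := k) x y p := HomGraded.proj_mem _ _
  have hg0 : g ∈ HomGraded.gr (k := k) y x (-p) := HomGraded.proj_mem _ _
  have hv : inv (f ≫ g) ∈ HomGraded.gr (k := k) x x 0 := by
    have := HomGraded.inv_mem (k := k) (p := 0) (asIso (f ≫ g))
      (HomGraded.comp_mem_of_eq hf0 hg0 (by ring))
    simpa using this
  have h1 : f ≫ g ≫ inv (f ≫ g) = 𝟙 x := by rw [← Category.assoc, IsIso.hom_inv_id]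
  refine ⟨p, ⟨f, g ≫ inv (f ≫ g), h1, ?_⟩, hf0⟩
  rcases hy.idempotent_trivial hE ((g ≫ inv (f ≫ g)) ≫ f)
    (HomGraded.comp_mem_of_eq (HomGraded.comp_mem hg0 hv) hf0 (by ring))
    (by rw [Category.assoc, ← Category.assoc f, h1, Category.id_comp]) with h | h
  · refine absurd ((IsZero.iff_id_eq_zero x).2 ?_) hx.1
    rw [← h1, ← Category.comp_id (g ≫ inv (f ≫ g)), ← h1, ← Category.assoc (g ≫ _), h, zero_comp,
      comp_zero]
  · exact h

end HomogeneousIso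

/-! ### Representing equivalences by degree-adjusted automorphisms -/

section Existence

variable {k : Type w} [Field k] {E : Type u} [Category.{v} E] [Preadditive E] [Linear k E]
  [HomGraded k E] {ι : Type t} [Fintype ι] [DecidableEq ι] {X : ι → E}

/-- A faithful graded functor reflects degrees. -/
theorem IsGradedFunctor.mem_iff {Ψ : E ⥤ E} [Ψ.Additive] [Ψ.Faithful]
    (hΨ : IsGradedFunctor k Ψ) {x y : E} {p : ℤ} {f : x ⟶ y} :
    Ψ.map f ∈ HomGraded.gr (k := k) (Ψ.obj x) (Ψ.obj y) p ↔
      f ∈ HomGraded.gr (k := k) x y p := by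
  refine ⟨fun h => HomGraded.mem_gr_of_proj fun q hq => ?_, hΨ p f⟩
  have h1 : HomGraded.proj k q (Ψ.map f) = Ψ.map (HomGraded.proj k q f) := by
    obtain ⟨s, hs, hs'⟩ := HomGraded.exists_sum_proj (k := k) f
    conv_lhs => rw [hs, Functor.map_sum, map_sum]
    by_cases hqs : q ∈ s
    · rw [Finset.sum_eq_single q, HomGraded.proj_of_mem (hΨ _ _ (HomGraded.proj_mem q f))]
      · intro r _ hr
        exact HomGraded.proj_of_mem_ne (hΨ _ _ (HomGraded.proj_mem r f)) hr
      · exact fun h => absurd hqs h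
    · rw [hs' q hqs, Ψ.map_zero]
      refine Finset.sum_eq_zero fun r hr => ?_
      exact HomGraded.proj_of_mem_ne (hΨ _ _ (HomGraded.proj_mem r f))
        fun h => hqs (h ▸ hr)
  apply Ψ.map_injective
  rw [← h1, HomGraded.proj_of_mem_ne h (Ne.symm hq), Ψ.map_zero]

open CatAlg in
/-- A fully faithful graded functor which permutes the `X i` up to homogeneous isomorphisms is
represented by a degree-adjusted automorphism. -/
theorem exists_realizes_of_perm (Ψ : E ⥤ E) [Ψ.Additive] [Ψ.Linear k] [Ψ.Full] [Ψ.Faithful]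
    (hΨ : IsGradedFunctor k Ψ) (π : Equiv.Perm ι) (ℓ : ι → ℤ)
    (u : ∀ i, Ψ.obj (X i) ≅ X (π i)) (hu : ∀ i, (u i).hom ∈ HomGraded.gr (k := k) _ _ (ℓ i)) :
    ∃ F : DegAdjAut (CatAlg.grading k X) (CatAlg.vertex X), Realizes Ψ F := by
  let L : CatAlg X →ₗ[k] CatAlg X :=
    { toFun := fun a => ∑ i, ∑ j, single (π i) (π j) ((u i).inv ≫ Ψ.map (a i j) ≫ (u j).hom)
      map_add' := fun a b => by
        simp only [← Finset.sum_add_distrib, ← single_add]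
        refine Finset.sum_congr rfl fun i _ => Finset.sum_congr rfl fun j _ => ?_
        rw [CatAlg.add_apply, Ψ.map_add, Preadditive.add_comp, Preadditive.comp_add]
      map_smul' := fun c a => by
        simp only [Finset.smul_sum, ← single_smul]
        refine Finset.sum_congr rfl fun i _ => Finset.sum_congr rfl fun j _ => ?_
        rw [RingHom.id_apply, CatAlg.smul_apply, Ψ.map_smul, Linear.smul_comp,
          Linear.comp_smul] }
  have hL : ∀ a i j, L a (π i) (π j) = (u i).inv ≫ Ψ.map (a i j) ≫ (u j).hom := by
    intro a i j
    change (∑ i', ∑ j', single (π i') (π j') ((u i').inv ≫ Ψ.map (a i' j') ≫ (u j').hom)) _ _ = _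
    rw [CatAlg.sum_apply, Finset.sum_eq_single i, CatAlg.sum_apply, Finset.sum_eq_single j,
      single_self]
    · intro j' _ hj
      exact single_of_ne _ (by simp [hj])
    · simp
    · intro i' _ hi
      rw [CatAlg.sum_apply]
      exact Finset.sum_eq_zero fun j' _ => single_of_ne _ (by simp [hi])
    · simp
  have hext : ∀ a b : CatAlg X, (∀ i j, a (π i) (π j) = b (π i) (π j)) → a = b := by
    intro a b h
    ext i j
    have h1 := h (π.symm i) (π.symm j)
    rwa [Equiv.apply_symm_apply, Equiv.apply_symm_apply] at h1
  let α : CatAlg X →ₐ[k] CatAlg X := AlgHom.ofLinearMap L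
    (hext _ _ fun i j => by
      rw [hL]
      by_cases h : i = j
      · subst h
        rw [one_apply_self, one_apply_self]
        simp
      · rw [one_apply_ne h, one_apply_ne (by simpa using h)]
        simp)
    (fun a b => hext _ _ fun i l => by
      rw [hL, CatAlg.mul_apply, CatAlg.mul_apply,
        ← Equiv.sum_comp π fun j => L b (π i) j ≫ L a j (π l)]
      simp [hL, Functor.map_sum, Preadditive.sum_comp, Preadditive.comp_sum])
  have hα : Function.Bijective α := by
    constructor
    · intro a b hab
      ext i j
      have h : L a (π i) (π j) = L b (π i) (π j) := congrFun (congrFun hab _) _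
      rw [hL, hL] at h
      apply Ψ.map_injective
      simpa using h
    · intro b
      refine ⟨fun i j => Ψ.preimage ((u i).hom ≫ b (π i) (π j) ≫ (u j).inv),
        hext _ _ fun i j => ?_⟩
      refine (hL _ i j).trans ?_
      simp
  let F : DegAdjAut (CatAlg.grading k X) (CatAlg.vertex X) :=
    { toAlgEquiv := AlgEquiv.ofBijective α hα
      perm := π
      adj := ℓ
      map_vertex := fun i => hext _ _ fun j l => by
        refine (hL _ j l).trans ?_
        rw [vertex_eq_single, vertex_eq_single]
        by_cases h : i = j ∧ i = l
        · obtain ⟨rfl, rfl⟩ := h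
          simp
        · rw [single_of_ne _ h, single_of_ne _ (by simpa using h)]
          simp
      map_mem_iff := fun i j p a hj hi => by
        change L a ∈ _ ↔ _
        have h1 : a = single i j (a i j) := by
          rw [← DegAdjAut.vertex_mul_mul_vertex, hi, hj]
        have h2 : L a = single (π i) (π j) ((u i).inv ≫ Ψ.map (a i j) ≫ (u j).hom) :=
          hext _ _ fun i' j' => by
            rw [hL]
            by_cases h : i = i' ∧ j = j'
            · obtain ⟨rfl, rfl⟩ := h
              simp
            · rw [h1, single_of_ne _ h, single_of_ne _ (by simpa using h)]
              simp
        rw [h2, h1, single_mem_grading, single_mem_grading, single_self, ← hΨ.mem_iff (f := a i j)]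
        constructor
        · intro h
          have h3 := HomGraded.comp_mem (HomGraded.comp_mem (hu i) h)
            (HomGraded.inv_mem _ (hu j))
          simp only [Category.assoc, Iso.hom_inv_id, Iso.hom_inv_id_assoc,
            Category.comp_id] at h3
          have h4 : ℓ i + (p + ℓ j - ℓ i) + -ℓ j = p := by ring
          rwa [h4] at h3
        · intro h
          exact HomGraded.comp_mem_of_eq (HomGraded.inv_mem _ (hu i))
            (HomGraded.comp_mem h (hu j)) (by ring) }
  refine ⟨F, u, hu, fun i j f => ?_⟩
  have h : F.mapHom f = (u i).inv ≫ Ψ.map f ≫ (u j).hom := by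
    refine (hL _ i j).trans ?_
    rw [single_self]
  rw [h, Iso.hom_inv_id_assoc]

/-- A graded equivalence is represented by a degree-adjusted automorphism. -/
theorem exists_realizes (hX : IsIndecSkeleton X) (hE : DegreeZeroIdempotentsSplit k E)
    (hfin : ∀ x y : E, Module.Finite k (x ⟶ y))
    (Ψ : E ⥤ E) [Ψ.Additive] [Ψ.Linear k] [Ψ.IsEquivalence] (hΨ : IsGradedFunctor k Ψ) :
    ∃ F : DegAdjAut (CatAlg.grading k X) (CatAlg.vertex X), Realizes Ψ F := by
  have h : ∀ i, ∃ (j : ι) (p : ℤ) (u : Ψ.obj (X i) ≅ X j),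
      u.hom ∈ HomGraded.gr (k := k) _ _ p := by
    intro i
    have hi := (hX.indec i).map Ψ
    obtain ⟨j, ⟨e⟩⟩ := hX.surj _ hi
    exact ⟨j, hi.exists_homogeneous_iso hE hfin (hX.indec j) e⟩
  choose π ℓ u hu using h
  have hπ : Function.Injective π := by
    intro i j hij
    exact hX.inj i j ⟨Ψ.preimageIso (u i ≪≫ eqToIso (congrArg X hij) ≪≫ (u j).symm)⟩
  exact exists_realizes_of_perm Ψ hΨ (Equiv.ofBijective π (Finite.injective_iff_bijective.1 hπ))
    ℓ u hu

end Existence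

/-! ### Graded Frobenius structures and Serre functors -/

section Frobenius

variable {k : Type w} [Field k] {E : Type u} [Category.{v} E] [Preadditive E] [Linear k E]
  [HomGraded k E] {ι : Type t} [Fintype ι] [DecidableEq ι] {X : ι → E}

variable (k) in
/-- A sign-graded Serre trace for a graded functor `Ψ`: nondegenerate functionals
`τ : E(x, Ψ x) → k` of degree `0`, with `τ (f ≫ g) = (-1) ^ p τ (g ≫ Ψ f)` for `f` of
degree `p`. -/
structure SignedTrace (Ψ : E ⥤ E) where
  τ (x : E) : (x ⟶ Ψ.obj x) →ₗ[k] k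
  eq_zero {x : E} {p : ℤ} (f : x ⟶ Ψ.obj x) (hf : f ∈ HomGraded.gr (k := k) _ _ p)
    (hp : p ≠ 0) : τ x f = 0
  cyclic {x y : E} {p : ℤ} (f : x ⟶ y) (hf : f ∈ HomGraded.gr (k := k) x y p)
    (g : y ⟶ Ψ.obj x) : τ x (f ≫ g) = charVal (sgn k) p * τ y (g ≫ Ψ.map f)
  nondeg {x y : E} (f : x ⟶ y) (h : ∀ g : y ⟶ Ψ.obj x, τ x (f ≫ g) = 0) : f = 0

theorem SignedTrace.signOp_comp {Ψ : E ⥤ E} [Ψ.Additive] (t : SignedTrace k Ψ) {x y : E}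
    (f : x ⟶ y) (g : y ⟶ Ψ.obj x) :
    t.τ x (HomGraded.signOp k f ≫ g) = t.τ y (g ≫ Ψ.map f) := by
  obtain ⟨s, hs, -⟩ := HomGraded.exists_sum_proj (k := k) f
  rw [hs]
  simp only [map_sum, Preadditive.sum_comp, Functor.map_sum, Preadditive.comp_sum]
  refine Finset.sum_congr rfl fun p _ => ?_
  rw [HomGraded.signOp_of_mem (HomGraded.proj_mem p f), Linear.smul_comp, map_smul,
    t.cyclic _ (HomGraded.proj_mem p f), smul_eq_mul, ← mul_assoc, charVal_sgn_mul_self, one_mul]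

namespace CatAlg

variable (k X) in
/-- The sign automorphism, multiplying elements of degree `p` by `(-1) ^ p`. -/
def signOp : CatAlg X →ₗ[k] CatAlg X where
  toFun a := fun i j => HomGraded.signOp k (a i j)
  map_add' a b := by
    ext i j
    exact map_add _ _ _
  map_smul' c a := by
    ext i j
    exact map_smul _ _ _

theorem signOp_apply (a : CatAlg X) (i j : ι) :
    signOp k X a i j = HomGraded.signOp k (a i j) := rfl

theorem signOp_mul (a b : CatAlg X) : signOp k X (a * b) = signOp k X a * signOp k X b := by
  ext i j
  rw [signOp_apply, mul_apply, mul_apply, map_sum]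
  exact Finset.sum_congr rfl fun l _ => HomGraded.signOp_comp _ _

theorem signOp_of_mem {p : ℤ} {a : CatAlg X} (ha : a ∈ grading k X p) :
    signOp k X a = charVal (sgn k) p • a := by
  ext i j
  exact HomGraded.signOp_of_mem (ha i j)

instance [∀ x y : E, Module.Finite k (x ⟶ y)] : Module.Finite k (CatAlg X) :=
  inferInstanceAs (Module.Finite k (∀ i j, X i ⟶ X j))

end CatAlg

open CatAlg in
/-- A sign-graded Serre trace for `Ψ` makes every degree-adjusted automorphism representing `Ψ`
the Nakayama automorphism of a graded Frobenius structure. -/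
theorem SignedTrace.exists_frobenius {Ψ : E ⥤ E} [Ψ.Additive] (t : SignedTrace k Ψ)
    (hfin : ∀ x y : E, Module.Finite k (x ⟶ y))
    {F : DegAdjAut (CatAlg.grading k X) (CatAlg.vertex X)} (hF : Realizes Ψ F) :
    ∃ Fr : GradedFrobeniusStructure (sgn k) (CatAlg.grading k X) (CatAlg.vertex X),
      Fr.nakayama = F := by
  obtain ⟨u, hu, hΨ⟩ := hF
  -- The twisted trace `l` on the algebra, with `l (c * signOp b) = l (F b * c)`.
  let l : CatAlg X →ₗ[k] k :=
    { toFun := fun c => ∑ i, t.τ (X i) (c i (F.perm i) ≫ (u i).inv)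
      map_add' := fun a b => by
        rw [← Finset.sum_add_distrib]
        exact Finset.sum_congr rfl fun i _ => by
          rw [CatAlg.add_apply, Preadditive.add_comp, map_add]
      map_smul' := fun c a => by
        rw [RingHom.id_apply, Finset.smul_sum]
        exact Finset.sum_congr rfl fun i _ => by
          rw [CatAlg.smul_apply, Linear.smul_comp, map_smul] }
  have hl : ∀ c, l c = ∑ i, t.τ (X i) (c i (F.perm i) ≫ (u i).inv) := fun c => rfl
  have hcyc : ∀ c b, l (c * signOp k X b) = l (F.toAlgEquiv b * c) := by
    intro c b
    rw [hl, hl]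
    have h1 : ∀ i, t.τ (X i) ((c * signOp k X b) i (F.perm i) ≫ (u i).inv) =
        ∑ j, t.τ (X j) (c j (F.perm i) ≫ (u i).inv ≫ Ψ.map (b i j)) := by
      intro i
      rw [CatAlg.mul_apply, Preadditive.sum_comp, map_sum]
      refine Finset.sum_congr rfl fun j _ => ?_
      rw [signOp_apply, Category.assoc, t.signOp_comp, Category.assoc]
    have h2 : ∀ j, t.τ (X j) ((F.toAlgEquiv b * c) j (F.perm j) ≫ (u j).inv) =
        ∑ i, t.τ (X j) (c j (F.perm i) ≫ (u i).inv ≫ Ψ.map (b i j)) := by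
      intro j
      rw [CatAlg.mul_apply, ← Equiv.sum_comp F.perm, Preadditive.sum_comp, map_sum]
      refine Finset.sum_congr rfl fun i _ => ?_
      rw [DegAdjAut.apply_perm_perm, Category.assoc]
      congr 2
      rw [Iso.comp_inv_eq, Category.assoc, ← hΨ, Iso.inv_hom_id_assoc]
    simp only [h1, h2]
    exact Finset.sum_comm
  let φ : CatAlg X →ₗ[k] Module.Dual k (CatAlg X) :=
    LinearMap.mk₂ k (fun a m => l (m * signOp k X a))
      (fun a b m => by rw [map_add, mul_add, map_add])
      (fun c a m => by rw [map_smul, mul_smul_comm, map_smul])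
      (fun a m m' => by rw [add_mul, map_add])
      (fun c a m => by rw [smul_mul_assoc, map_smul])
  have hφ : ∀ a m, φ a m = l (m * signOp k X a) := fun a m => rfl
  have hinj : Function.Injective φ := by
    rw [← LinearMap.ker_eq_bot, LinearMap.ker_eq_bot']
    intro a ha
    ext i j
    have h1 : HomGraded.signOp k (a i j) = 0 := by
      refine t.nondeg _ fun g => ?_
      have h2 : φ a (single j (F.perm i) (g ≫ (u i).hom)) = 0 := by rw [ha]; rfl
      rw [hφ, hl, Finset.sum_eq_single i, single_mul_apply] at h2
      · simpa [signOp_apply] using h2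
      · intro i' _ hi
        rw [single_mul_apply_of_ne _ _ _ _ (by simpa using hi.symm), zero_comp, map_zero]
      · simp
    rw [← HomGraded.signOp_signOp (k := k) (a i j), h1, map_zero, CatAlg.zero_apply]
  refine ⟨{ nakayama := F
            φ := LinearEquiv.ofInjectiveOfFinrankEq φ hinj (Subspace.dual_finrank_eq).symm
            map_left := fun p b hb a m => ?_
            map_right := fun a b m => ?_
            map_degree := fun i p q a m ha hi hm hq => ?_ }, rfl⟩
  · change φ (b * a) m = _ * φ a (m * b)
    rw [hφ, hφ, signOp_mul, signOp_of_mem hb, smul_mul_assoc, mul_smul_comm, map_smul,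
      smul_eq_mul, mul_assoc]
  · change φ (a * b) m = φ a (_ * m)
    rw [hφ, hφ, signOp_mul, ← mul_assoc, hcyc, mul_assoc]
  · change φ a m = 0
    rw [hφ, signOp_of_mem ha, mul_smul_comm, map_smul, hl]
    refine smul_eq_zero_of_right _ (Finset.sum_eq_zero fun i' _ => ?_)
    by_cases h : i = i'
    · subst h
      refine t.eq_zero (p := p + q + - F.adj i) _ (HomGraded.comp_mem ?_
        (HomGraded.inv_mem _ (hu i))) (by omega)
      rw [add_comm p q]
      exact mul_mem_grading hm ha _ _
    · rw [CatAlg.mul_apply]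
      rw [Finset.sum_eq_zero fun j _ => by rw [apply_eq_zero_of_mul_vertex hi h, zero_comp],
        zero_comp, map_zero]

end Frobenius

/-! ### Uniqueness of the Nakayama automorphism -/

section Uniqueness

variable {k : Type w} [Field k] {E : Type u} [Category.{v} E] [Preadditive E] [Linear k E]
  [HomGraded k E] {ι : Type t} [Fintype ι] [DecidableEq ι] {X : ι → E}

open CatAlg

namespace CatAlg

variable (k) in
/-- The homogeneous component of degree `p` of an element. -/
def proj (p : ℤ) (a : CatAlg X) : CatAlg X := fun i j => HomGraded.proj k p (a i j)

theorem proj_mem (p : ℤ) (a : CatAlg X) : proj k p a ∈ grading k X p :=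
  fun _ _ => HomGraded.proj_mem _ _

theorem exists_sum_proj (a : CatAlg X) : ∃ s : Finset ℤ,
    a = ∑ p ∈ s, proj k p a ∧ ∀ p ∉ s, proj k p a = 0 := by
  choose s hs hs' using fun i j => HomGraded.exists_sum_proj (k := k) (a i j)
  refine ⟨Finset.univ.biUnion fun i => Finset.univ.biUnion fun j => s i j, ?_, fun p hp => ?_⟩
  · ext i j
    rw [CatAlg.sum_apply]
    refine (hs i j).trans (Finset.sum_subset (fun p hp => ?_) fun p _ hp => hs' i j p hp)
    simp only [Finset.mem_biUnion, Finset.mem_univ, true_and]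
    exact ⟨i, j, hp⟩
  · ext i j
    simp only [Finset.mem_biUnion, Finset.mem_univ, true_and, not_exists] at hp
    exact hs' i j p (hp i j)

theorem proj_mul_vertex {a : CatAlg X} {j : ι} (h : a * vertex X j = a) (p : ℤ) :
    proj k p a * vertex X j = proj k p a := by
  ext i l
  by_cases hi : j = i
  · subst hi
    rw [mul_vertex_apply]
  · rw [vertex_eq_single, mul_single_apply_of_ne _ _ _ _ hi, proj,
      apply_eq_zero_of_mul_vertex h hi, map_zero]

end CatAlg

/-- Frobenius isomorphisms are maps of left modules, hence differ by right multiplication with the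
element that matches their values at `1`. -/
theorem GradedFrobeniusStructure.apply_mul
    (Fr Fr' : GradedFrobeniusStructure (sgn k) (CatAlg.grading k X) (CatAlg.vertex X))
    {b : CatAlg X} (hb : Fr'.φ b = Fr.φ 1) (a : CatAlg X) : Fr'.φ (a * b) = Fr.φ a := by
  have key : ∀ (p : ℤ), ∀ a ∈ grading k X p, Fr'.φ (a * b) = Fr.φ a := by
    intro p a ha
    refine LinearMap.ext fun m => ?_
    rw [Fr'.map_left p a ha, hb, ← Fr.map_left p a ha, mul_one]
  obtain ⟨s, hs, -⟩ := CatAlg.exists_sum_proj (k := k) a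
  rw [hs, Finset.sum_mul, map_sum, map_sum]
  exact Finset.sum_congr rfl fun p _ => key p _ (CatAlg.proj_mem p a)

/-- The Nakayama automorphism of a graded Frobenius structure is unique up to isomorphism. -/
theorem GradedFrobeniusStructure.nakayama_isIsomorphic
    (Fr Fr' : GradedFrobeniusStructure (sgn k) (CatAlg.grading k X) (CatAlg.vertex X)) :
    DegAdjAut.IsIsomorphic Fr.nakayama Fr'.nakayama := by
  -- The two structures differ by right multiplication with a unit `b`.
  obtain ⟨b, hb⟩ := Fr'.φ.surjective (Fr.φ 1)
  obtain ⟨c, hc⟩ := Fr.φ.surjective (Fr'.φ 1)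
  have hcb : c * b = 1 := Fr'.φ.injective (by
    rw [Fr.apply_mul Fr' hb, hc])
  have hbc : b * c = 1 := Fr.φ.injective (by
    rw [Fr'.apply_mul Fr hc, hb])
  set α := Fr.nakayama
  set α' := Fr'.nakayama
  have hcomm : ∀ x, α'.toAlgEquiv (x * b) = α'.toAlgEquiv b * α.toAlgEquiv x := by
    intro x
    rw [← AlgEquiv.apply_symm_apply α'.toAlgEquiv (α.toAlgEquiv x), ← map_mul]
    congr 1
    apply Fr'.φ.injective
    refine LinearMap.ext fun m => ?_
    rw [Fr'.map_right b, AlgEquiv.apply_symm_apply, hb, Fr.apply_mul Fr' hb, ← Fr.map_right,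
      one_mul]
  have hunit : IsUnit (α'.toAlgEquiv b) := ⟨⟨α'.toAlgEquiv b, α'.toAlgEquiv c,
    by rw [← map_mul, hbc, map_one], by rw [← map_mul, hcb, map_one]⟩, rfl⟩
  refine ⟨hunit.unit, fun a => ?_, fun i => ?_⟩
  · rw [IsUnit.unit_spec, ← hcomm, map_mul]
  · rw [IsUnit.unit_spec, mul_assoc, ← hcomm, ← map_mul, ← mul_assoc]
    have hee : vertex X i * vertex X i = vertex X i := by
      rw [vertex_eq_single, single_mul_single, Category.comp_id]
    rw [hee]
    -- `e i * b` has a single entry, from `X j` to `X i`.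
    obtain ⟨j, hj⟩ := α'.perm.surjective (α.perm i)
    have hright : (vertex X i * b) * vertex X j = vertex X i * b := by
      apply α'.toAlgEquiv.injective
      rw [map_mul, hcomm, α'.map_vertex, hj, ← α.map_vertex, mul_assoc, ← map_mul, hee]
    have hleft : vertex X i * (vertex X i * b) = vertex X i * b := by rw [← mul_assoc, hee]
    have hdeg : vertex X i * b ∈ grading k X (α'.adj j - α.adj i) := by
      have h2 : ∀ p, p ≠ α'.adj j - α.adj i → CatAlg.proj k p (vertex X i * b) = 0 := by
        intro p hp
        apply Fr'.φ.injective
        rw [map_zero]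
        have key : ∀ q, ∀ m ∈ grading k X q, Fr'.φ (CatAlg.proj k p (vertex X i * b)) m = 0 := by
          intro q m hm
          have hq : ∀ p', q ≠ -(p' - α'.adj j) →
              Fr'.φ (CatAlg.proj k p' (vertex X i * b)) m = 0 := fun p' hq =>
            Fr'.map_degree j p' q _ m (CatAlg.proj_mem p' _) (proj_mul_vertex hright p') hm hq
          by_cases h : q = -(p - α'.adj j)
          · have h1 : Fr'.φ (vertex X i * b) m = 0 := by
              rw [Fr.apply_mul Fr' hb]
              exact Fr.map_degree i 0 q _ m (vertex_mem_grading i) hee hm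
                (by change q ≠ -(0 - α.adj i); omega)
            obtain ⟨s, hs, hs'⟩ := CatAlg.exists_sum_proj (k := k) (vertex X i * b)
            rw [hs, map_sum, LinearMap.sum_apply, Finset.sum_eq_single p] at h1
            · exact h1
            · exact fun p' _ hp' => hq p' (by omega)
            · intro hps
              rw [hs' p hps, map_zero, LinearMap.zero_apply]
          · exact hq p h
        refine LinearMap.ext fun m => ?_
        obtain ⟨s, hs, -⟩ := CatAlg.exists_sum_proj (k := k) m
        rw [hs, map_sum]
        exact Finset.sum_eq_zero fun q _ => key q _ (CatAlg.proj_mem q m)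
      intro i' j'
      exact HomGraded.mem_gr_of_proj fun q hq => congrFun (congrFun (h2 q hq) i') j'
    have h2 := (α'.map_mem_iff j i _ _ hleft hright).2 hdeg
    have h3 : α'.adj j - α.adj i + α'.adj i - α'.adj j = α'.adj i - α.adj i := by ring
    rwa [h3] at h2

end Uniqueness

/-! ### The trace of a Serre structure and commutation isomorphisms -/

namespace SerreStructure

section Trace

variable {k : Type w} [Field k] {D : Type u} [Category.{v} D] [Preadditive D] [Linear k D]
  (𝒮 : SerreStructure k D)

/-- The trace functionals of a Serre structure, from which `κ` is recovered by
`κ f m = tr (f ≫ m)`. -/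
def tr (x : D) : (x ⟶ 𝒮.S.functor.obj x) →ₗ[k] k := 𝒮.κ x x (𝟙 x)

theorem κ_apply {x y : D} (f : x ⟶ y) (m : y ⟶ 𝒮.S.functor.obj x) :
    𝒮.κ x y f m = 𝒮.tr x (f ≫ m) := by
  rw [tr, ← 𝒮.κ_left, Category.id_comp]

theorem tr_comp {x y : D} (f : x ⟶ y) (n : y ⟶ 𝒮.S.functor.obj x) :
    𝒮.tr x (f ≫ n) = 𝒮.tr y (n ≫ 𝒮.S.functor.map f) := by
  rw [← κ_apply, ← Category.comp_id f, 𝒮.κ_right, Category.comp_id, tr]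

theorem tr_map {x : D} (f : x ⟶ 𝒮.S.functor.obj x) :
    𝒮.tr (𝒮.S.functor.obj x) (𝒮.S.functor.map f) = 𝒮.tr x f := by
  rw [← Category.comp_id f, tr_comp, Category.id_comp, Category.comp_id]

theorem eq_zero_of_tr_comp {x y : D} {f : x ⟶ y}
    (h : ∀ m : y ⟶ 𝒮.S.functor.obj x, 𝒮.tr x (f ≫ m) = 0) : f = 0 := by
  apply (𝒮.κ x y).injective
  rw [map_zero]
  exact LinearMap.ext fun m => (𝒮.κ_apply f m).trans (h m)

theorem eq_of_tr_comp {x y : D} {m n : y ⟶ 𝒮.S.functor.obj x}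
    (h : ∀ f : x ⟶ y, 𝒮.tr x (f ≫ m) = 𝒮.tr x (f ≫ n)) : m = n := by
  rw [← sub_eq_zero]
  refine 𝒮.eq_zero_of_tr_comp fun g => ?_
  rw [← 𝒮.S.functor.map_preimage g, ← tr_comp, Preadditive.comp_sub, map_sub, h, sub_self]

/-- Every functional on a finite-dimensional hom space is a trace. -/
theorem exists_tr_comp_eq {x y : D} [Module.Finite k (y ⟶ 𝒮.S.functor.obj x)]
    (l : (x ⟶ y) →ₗ[k] k) :
    ∃ m : y ⟶ 𝒮.S.functor.obj x, ∀ f : x ⟶ y, 𝒮.tr x (f ≫ m) = l f := by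
  refine ⟨(Module.evalEquiv k _).symm (l ∘ₗ (𝒮.κ x y).symm.toLinearMap), fun f => ?_⟩
  rw [← κ_apply, Module.apply_evalEquiv_symm_apply]
  simp

/-- The trace form of the condition defining the canonical commutation isomorphism. -/
def IsTraceComm (Ψ : D ⥤ D) (ζ : Ψ ⋙ 𝒮.S.functor ≅ 𝒮.S.functor ⋙ Ψ) : Prop :=
  ∀ (y : D) (f : y ⟶ 𝒮.S.functor.obj y), 𝒮.tr (Ψ.obj y) (Ψ.map f ≫ ζ.inv.app y) = 𝒮.tr y f

theorem isCanonicalComm_iff (F : D ≌ D)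
    (ζ : F.functor ⋙ 𝒮.S.functor ≅ 𝒮.S.functor ⋙ F.functor) :
    𝒮.IsCanonicalComm F ζ ↔ 𝒮.IsTraceComm F.functor ζ := by
  have hr : ∀ (x y : D) (a : F.functor.obj y ⟶ x)
      (v : x ⟶ F.functor.obj (𝒮.S.functor.obj y)),
      F.functor.map (F.toAdjunction.homEquiv y x a ≫
        (F.symm.toAdjunction.homEquiv x (𝒮.S.functor.obj y)).symm v) = a ≫ v := by
    intro x y a v
    simp [Adjunction.homEquiv_unit, Adjunction.homEquiv_counit]
  constructor
  · intro h y f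
    have h1 := h _ y (𝟙 _) (F.functor.map f)
    rw [κ_apply, κ_apply, Category.id_comp] at h1
    rw [h1]
    congr 1
    apply F.functor.map_injective
    rw [hr, Category.id_comp]
  · intro h x y a v
    rw [κ_apply, κ_apply, ← Category.assoc, ← hr, h]

theorem isTraceComm_id (ζ : 𝟭 D ⋙ 𝒮.S.functor ≅ 𝒮.S.functor ⋙ 𝟭 D)
    (hζ : ∀ x, ζ.inv.app x = 𝟙 (𝒮.S.functor.obj x)) : 𝒮.IsTraceComm (𝟭 D) ζ := by
  intro y f
  rw [hζ]
  exact congrArg _ (Category.comp_id f)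

/-- The commutation isomorphism of a composite. -/
def commComp {Ψ Ψ' : D ⥤ D} (ζ : Ψ ⋙ 𝒮.S.functor ≅ 𝒮.S.functor ⋙ Ψ)
    (ζ' : Ψ' ⋙ 𝒮.S.functor ≅ 𝒮.S.functor ⋙ Ψ') :
    (Ψ ⋙ Ψ') ⋙ 𝒮.S.functor ≅ 𝒮.S.functor ⋙ (Ψ ⋙ Ψ') :=
  NatIso.ofComponents (fun x => ζ'.app (Ψ.obj x) ≪≫ Ψ'.mapIso (ζ.app x)) fun {x y} f => by
    have h1 := ζ'.hom.naturality (Ψ.map f)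
    have h2 := ζ.hom.naturality f
    simp only [Functor.comp_obj, Functor.comp_map] at h1 h2
    simp only [Functor.comp_obj, Functor.comp_map, Iso.trans_hom, Iso.app_hom,
      Functor.mapIso_hom, Category.assoc]
    rw [reassoc_of% h1, ← Ψ'.map_comp, h2, Ψ'.map_comp]

theorem commComp_inv_app {Ψ Ψ' : D ⥤ D} (ζ : Ψ ⋙ 𝒮.S.functor ≅ 𝒮.S.functor ⋙ Ψ)
    (ζ' : Ψ' ⋙ 𝒮.S.functor ≅ 𝒮.S.functor ⋙ Ψ') (x : D) :
    (𝒮.commComp ζ ζ').inv.app x = Ψ'.map (ζ.inv.app x) ≫ ζ'.inv.app (Ψ.obj x) := rfl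

theorem IsTraceComm.comp {Ψ Ψ' : D ⥤ D} {ζ : Ψ ⋙ 𝒮.S.functor ≅ 𝒮.S.functor ⋙ Ψ}
    {ζ' : Ψ' ⋙ 𝒮.S.functor ≅ 𝒮.S.functor ⋙ Ψ'} (h : 𝒮.IsTraceComm Ψ ζ)
    (h' : 𝒮.IsTraceComm Ψ' ζ') : 𝒮.IsTraceComm (Ψ ⋙ Ψ') (𝒮.commComp ζ ζ') := by
  intro y f
  rw [commComp_inv_app, ← h y f, ← h' _ (Ψ.map f ≫ ζ.inv.app y), Ψ'.map_comp, Category.assoc]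
  rfl

/-- Natural isomorphisms are compatible with the canonical commutation isomorphisms. -/
theorem IsTraceComm.naturality {Ψ Ψ' : D ⥤ D} [Ψ.Full]
    {ζ : Ψ ⋙ 𝒮.S.functor ≅ 𝒮.S.functor ⋙ Ψ}
    {ζ' : Ψ' ⋙ 𝒮.S.functor ≅ 𝒮.S.functor ⋙ Ψ'} (h : 𝒮.IsTraceComm Ψ ζ)
    (h' : 𝒮.IsTraceComm Ψ' ζ') (θ : Ψ ≅ Ψ') (y : D) :
    ζ.inv.app y ≫ 𝒮.S.functor.map (θ.hom.app y) =
      θ.hom.app (𝒮.S.functor.obj y) ≫ ζ'.inv.app y := by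
  refine 𝒮.eq_of_tr_comp (x := Ψ'.obj y) (y := Ψ.obj (𝒮.S.functor.obj y)) fun f => ?_
  obtain ⟨f, rfl⟩ : ∃ g : y ⟶ 𝒮.S.functor.obj y, f = θ.inv.app y ≫ Ψ.map g :=
    ⟨Ψ.preimage (θ.hom.app y ≫ f), by simp⟩
  have h1 : 𝒮.tr (Ψ'.obj y) ((θ.inv.app y ≫ Ψ.map f ≫ ζ.inv.app y) ≫
      𝒮.S.functor.map (θ.hom.app y)) = 𝒮.tr y f := by
    have e : θ.hom.app y ≫ θ.inv.app y ≫ Ψ.map f ≫ ζ.inv.app y = Ψ.map f ≫ ζ.inv.app y := by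
      simp
    have h2 := h y f
    rw [← e] at h2
    exact (𝒮.tr_comp _ _).symm.trans h2
  have h2 : 𝒮.tr (Ψ'.obj y) ((θ.inv.app y ≫ Ψ.map f) ≫ θ.hom.app (𝒮.S.functor.obj y) ≫
      ζ'.inv.app y) = 𝒮.tr y f := by
    have e : (θ.inv.app y ≫ Ψ.map f) ≫ θ.hom.app (𝒮.S.functor.obj y) ≫ ζ'.inv.app y =
        Ψ'.map f ≫ ζ'.inv.app y := by simp
    rw [e, h']
  rw [h2, ← h1]
  simp only [Category.assoc]

/-- The canonical commutation isomorphism of a linear autoequivalence exists: its inverse `z` is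
determined by Serre duality from the requirement that it preserves traces. -/
theorem exists_isTraceComm (hfin : ∀ x y : D, Module.Finite k (x ⟶ y)) (F : D ≌ D)
    [F.functor.Additive] [F.functor.Linear k] :
    ∃ ζ : F.functor ⋙ 𝒮.S.functor ≅ 𝒮.S.functor ⋙ F.functor,
      𝒮.IsTraceComm F.functor ζ := by
  have hz : ∀ y, ∃ z : F.functor.obj (𝒮.S.functor.obj y) ⟶ 𝒮.S.functor.obj (F.functor.obj y),
      ∀ f : y ⟶ 𝒮.S.functor.obj y, 𝒮.tr _ (F.functor.map f ≫ z) = 𝒮.tr y f := by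
    intro y
    let e : (y ⟶ 𝒮.S.functor.obj y) ≃ₗ[k]
        (F.functor.obj y ⟶ F.functor.obj (𝒮.S.functor.obj y)) :=
      LinearEquiv.ofBijective (F.functor.mapLinearMap k)
        ⟨F.functor.map_injective, F.functor.map_surjective⟩
    obtain ⟨z, hz⟩ := 𝒮.exists_tr_comp_eq (𝒮.tr y ∘ₗ e.symm.toLinearMap)
    refine ⟨z, fun f => (hz _).trans ?_⟩
    have : e.symm (F.functor.map f) = f := e.symm_apply_apply f
    exact congrArg _ this
  choose z hz using hz
  have hnat : ∀ {x y : D} (f : x ⟶ y), F.functor.map (𝒮.S.functor.map f) ≫ z y =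
      z x ≫ 𝒮.S.functor.map (F.functor.map f) := by
    intro x y f
    refine 𝒮.eq_of_tr_comp fun w => ?_
    obtain ⟨w, rfl⟩ := F.functor.map_surjective w
    rw [← Category.assoc, ← F.functor.map_comp, hz, ← tr_comp, ← hz,
      ← Category.assoc _ (z x), ← tr_comp, ← Category.assoc, ← F.functor.map_comp]
  have hiso : ∀ y, IsIso (z y) := by
    intro y
    -- Postcomposition with `z y` is bijective.
    have hinj : ∀ (a : D) (v : F.functor.obj a ⟶ F.functor.obj (𝒮.S.functor.obj y)),
        v ≫ z y = 0 → v = 0 := by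
      intro a v hv
      obtain ⟨v, rfl⟩ := F.functor.map_surjective v
      have h0 : v = 0 := by
        refine 𝒮.eq_of_tr_comp fun f => ?_
        rw [← hz, F.functor.map_comp, Category.assoc, hv, comp_zero, comp_zero, map_zero, map_zero]
      rw [h0, F.functor.map_zero]
    let c := F.functor.objObjPreimageIso (𝒮.S.functor.obj (F.functor.obj y))
    let a := F.functor.objPreimage (𝒮.S.functor.obj (F.functor.obj y))
    let l : (y ⟶ a) →ₗ[k] k :=
      𝒮.tr _ ∘ₗ Linear.rightComp k (F.functor.obj y) c.hom ∘ₗ F.functor.mapLinearMap k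
    obtain ⟨v, hv⟩ := 𝒮.exists_tr_comp_eq l
    have h1 : F.functor.map v ≫ z y = c.hom := by
      refine 𝒮.eq_of_tr_comp fun f => ?_
      obtain ⟨f, rfl⟩ := F.functor.map_surjective f
      rw [← Category.assoc, ← F.functor.map_comp, hz, hv]
      rfl
    refine ⟨c.inv ≫ F.functor.map v, ?_, by rw [Category.assoc, h1, Iso.inv_hom_id]⟩
    rw [← sub_eq_zero]
    refine hinj _ _ ?_
    rw [Preadditive.sub_comp, Category.assoc, Category.assoc, h1, Iso.inv_hom_id,
      Category.id_comp, Category.comp_id, sub_self]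
  let ζ' : 𝒮.S.functor ⋙ F.functor ≅ F.functor ⋙ 𝒮.S.functor :=
    NatIso.ofComponents (fun y => @asIso _ _ _ _ (z y) (hiso y)) fun f => hnat f
  exact ⟨ζ'.symm, fun y f => hz y f⟩

end Trace

end SerreStructure

/-! ### Morphisms of orbit categories from single entries -/

/-- A family indexed by `ℤ` can be built in both directions from a value at `0`. -/
theorem exists_int_section {Y : ℤ → Type*} (R : ∀ i, Y i → Y (i + 1) → Prop)
    (hr : ∀ i y, ∃ y', R i y y') (hl : ∀ i y', ∃ y, R i y y') (y₀ : Y 0) :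
    ∃ F : ∀ i, Y i, F 0 = y₀ ∧ ∀ i, R i (F i) (F (i + 1)) := by
  choose up hup using hr
  choose down hdown using hl
  let a : ∀ n : ℕ, Y (Int.ofNat n) := fun n => Nat.rec y₀ (fun n y => up (Int.ofNat n) y) n
  let b : ∀ n : ℕ, Y (Int.negSucc n) := fun n =>
    Nat.rec (down (Int.negSucc 0) y₀) (fun n y => down (Int.negSucc (n + 1)) y) n
  refine ⟨fun i => match i with
    | Int.ofNat n => a n
    | Int.negSucc n => b n, rfl, ?_⟩
  rintro (n | n)
  · exact hup (Int.ofNat n) (a n)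
  · cases n with
    | zero => exact hdown (Int.negSucc 0) y₀
    | succ n => exact hdown (Int.negSucc (n + 1)) (b n)

namespace OrbitCat

section Entries

variable {D : Type u} [Category.{v} D] [Preadditive D] {T : D ⥤ D}

/-- Every object of the original category is the term of index `0` of an object of the orbit
category. -/
theorem exists_obj_zero [T.EssSurj] (d : D) : ∃ x : OrbitCat T, x.obj 0 = d := by
  obtain ⟨F, hF, h⟩ := exists_int_section (Y := fun _ => D) (fun _ a b => Nonempty (T.obj a ≅ b))
    (fun _ a => ⟨_, ⟨Iso.refl _⟩⟩) (fun _ b => ⟨_, ⟨T.objObjPreimageIso b⟩⟩) d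
  exact ⟨⟨F, fun i => (h i).some⟩, hF⟩

variable [T.Additive] {x y z : OrbitCat T}

/-- The morphism of degree `p` with prescribed entries. -/
def homOf (p : ℤ) (θ : ∀ i j : ℤ, j = i + p → (x.obj i ⟶ y.obj j))
    (hθ : ∀ (i j : ℤ) (h : j = i + p) (h' : j + 1 = i + 1 + p),
      T.map (θ i j h) ≫ (y.str j).hom = (x.str i).hom ≫ θ (i + 1) (j + 1) h') : x ⟶ y where
  mat i j := if h : j = i + p then θ i j h else 0
  compat i j := by
    by_cases h : j = i + p
    · have h' : j + 1 = i + 1 + p := by omega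
      rw [dif_pos h, dif_pos h']
      exact hθ i j h h'
    · have h' : ¬ (j + 1 = i + 1 + p) := by omega
      rw [dif_neg h, dif_neg h', T.map_zero, zero_comp, comp_zero]
  finite i := (Set.finite_singleton (i + p)).subset fun j hj => by
    by_contra h
    exact hj (dif_neg h)

theorem homOf_mat {p : ℤ} (θ : ∀ i j : ℤ, j = i + p → (x.obj i ⟶ y.obj j))
    (hθ : ∀ (i j : ℤ) (h : j = i + p) (h' : j + 1 = i + 1 + p),
      T.map (θ i j h) ≫ (y.str j).hom = (x.str i).hom ≫ θ (i + 1) (j + 1) h')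
    (i j : ℤ) (h : j = i + p) : (homOf p θ hθ).mat i j = θ i j h := dif_pos h

/-- The morphism of degree `0` with prescribed diagonal entries. -/
def diag (θ : ∀ i, x.obj i ⟶ y.obj i)
    (hθ : ∀ i, T.map (θ i) ≫ (y.str i).hom = (x.str i).hom ≫ θ (i + 1)) : x ⟶ y :=
  homOf 0 (fun i j h => θ i ≫ eqToHom (by rw [h, add_zero])) fun i j h h' => by
    obtain rfl : i = j := by omega
    simp [hθ]

theorem diag_mat_self (θ : ∀ i, x.obj i ⟶ y.obj i)
    (hθ : ∀ i, T.map (θ i) ≫ (y.str i).hom = (x.str i).hom ≫ θ (i + 1)) (i : ℤ) :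
    (diag θ hθ).mat i i = θ i := by
  rw [diag, homOf_mat _ _ i i (by ring), eqToHom_refl, Category.comp_id]

variable {k : Type w} [Field k] [Linear k D] [T.Linear k]

theorem homOf_mem {p : ℤ} (θ : ∀ i j : ℤ, j = i + p → (x.obj i ⟶ y.obj j))
    (hθ : ∀ (i j : ℤ) (h : j = i + p) (h' : j + 1 = i + 1 + p),
      T.map (θ i j h) ≫ (y.str j).hom = (x.str i).hom ≫ θ (i + 1) (j + 1) h') :
    homOf p θ hθ ∈ gr k x y p := fun _ _ h => dif_neg h

theorem diag_mem (θ : ∀ i, x.obj i ⟶ y.obj i)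
    (hθ : ∀ i, T.map (θ i) ≫ (y.str i).hom = (x.str i).hom ≫ θ (i + 1)) :
    diag θ hθ ∈ gr k x y 0 := homOf_mem _ _

variable (k) in
theorem comp_mat_left {p : ℤ} {f : x ⟶ y} (hf : f ∈ gr k x y p) (g : y ⟶ z) (i j l : ℤ)
    (hj : j = i + p) : (f ≫ g).mat i l = f.mat i j ≫ g.mat j l := by
  rw [comp_mat f g i l {j}, Finset.sum_singleton]
  intro j' hj'
  rw [Finset.mem_singleton]
  by_contra h
  exact hj' (hf i j' (by omega))

variable (k) in
theorem comp_mat_right {q : ℤ} (f : x ⟶ y) {g : y ⟶ z} (hg : g ∈ gr k y z q) (i j l : ℤ)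
    (hl : l = j + q) : (f ≫ g).mat i l = f.mat i j ≫ g.mat j l := by
  rw [comp_mat f g i l (insert j (f.finite i).toFinset)
    (fun j' hj' => Finset.mem_insert_of_mem (by simpa using hj'))]
  rw [Finset.sum_eq_single j]
  · intro j' _ hj'
    rw [hg j' l (by omega), comp_zero]
  · simp

variable (k) in
theorem gr_ext {p : ℤ} {f g : x ⟶ y} (hf : f ∈ gr k x y p) (hg : g ∈ gr k x y p)
    (h : ∀ i j, j = i + p → f.mat i j = g.mat i j) : f = g :=
  hom_ext fun i j => by
    by_cases hj : j = i + p
    · exact h i j hj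
    · rw [hf i j hj, hg i j hj]

variable (k) in
/-- Every morphism `x i ⟶ y j` is an entry of a homogeneous morphism of the orbit category. -/
theorem exists_mat_eq [T.Full] [T.Faithful] (x y : OrbitCat T) (a b : ℤ)
    (f : x.obj a ⟶ y.obj b) : ∃ g ∈ gr k x y (b - a), g.mat a b = f := by
  obtain ⟨p, rfl⟩ : ∃ p, b = a + p := ⟨b - a, by ring⟩
  rw [add_sub_cancel_left]
  let Y : ℤ → Type v := fun i => ∀ j, j = i + p → (x.obj i ⟶ y.obj j)
  let R : ∀ i, Y i → Y (i + 1) → Prop := fun i f g =>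
    ∀ (j : ℤ) (h : j = i + p) (h' : j + 1 = i + 1 + p),
      T.map (f j h) ≫ (y.str j).hom = (x.str i).hom ≫ g (j + 1) h'
  have hr : ∀ i f, ∃ g, R i f g := by
    intro i f
    refine ⟨fun j' h' => (x.str i).inv ≫ T.map (f (i + p) rfl) ≫ (y.str (i + p)).hom ≫
      eqToHom (by rw [h']; congr 1; ring), fun j h h' => ?_⟩
    subst h
    simp
  have hl : ∀ i g, ∃ f, R i f g := by
    intro i g
    refine ⟨fun j h => T.preimage ((x.str i).hom ≫ g (j + 1) (by omega) ≫ (y.str j).inv),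
      fun j h h' => ?_⟩
    simp
  have hru : ∀ i f g g', R i f g → R i f g' → g = g' := by
    intro i f g g' h h'
    funext j hj
    obtain rfl : j = i + p + 1 := by omega
    rw [← cancel_epi (x.str i).hom, ← h _ rfl, ← h' _ rfl]
  have hlu : ∀ i f f' g, R i f g → R i f' g → f = f' := by
    intro i f f' g h h'
    funext j hj
    apply T.map_injective
    rw [← cancel_mono (y.str j).hom, h j hj (by omega), h' j hj (by omega)]
  have key : ∀ a : ℤ, ∀ f : Y a, ∃ F : ∀ i, Y i, F a = f ∧ ∀ i, R i (F i) (F (i + 1)) := by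
    intro a
    have hup : ∀ a : ℤ, (∀ f : Y a, ∃ F : ∀ i, Y i, F a = f ∧ ∀ i, R i (F i) (F (i + 1))) →
        ∀ f : Y (a + 1), ∃ F : ∀ i, Y i, F (a + 1) = f ∧ ∀ i, R i (F i) (F (i + 1)) := by
      intro a ih f
      obtain ⟨e, he⟩ := hl a f
      obtain ⟨F, hF, hR⟩ := ih e
      exact ⟨F, hru a _ _ _ (hR a) (hF ▸ he), hR⟩
    have hdown : ∀ a : ℤ, (∀ f : Y (a + 1), ∃ F : ∀ i, Y i, F (a + 1) = f ∧
        ∀ i, R i (F i) (F (i + 1))) →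
        ∀ f : Y a, ∃ F : ∀ i, Y i, F a = f ∧ ∀ i, R i (F i) (F (i + 1)) := by
      intro a ih f
      obtain ⟨e, he⟩ := hr a f
      obtain ⟨F, hF, hR⟩ := ih e
      exact ⟨F, hlu a _ _ _ (hR a) (hF ▸ he), hR⟩
    induction a with
    | zero => exact fun f => exists_int_section R hr hl f
    | succ n ih => exact hup _ ih
    | pred n ih =>
      refine hdown _ ?_
      rwa [sub_add_cancel]
  obtain ⟨F, hF, hR⟩ := key a fun j h => f ≫ eqToHom (by rw [h])
  refine ⟨homOf p (fun i j h => F i j h) fun i j h h' => hR i j h h', homOf_mem _ _, ?_⟩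
  rw [homOf_mat _ _ a (a + p) rfl, hF]
  exact Category.comp_id f

end Entries

end OrbitCat

/-! ### Functors on the orbit category by the Auslander-Reiten functor -/

section Lift

variable {k : Type w} [Field k] {D : Type u} [Category.{v} D] [Preadditive D] [Linear k D]
  [HasShift D ℤ] [∀ n : ℤ, (shiftFunctor D n).Additive]
  [∀ n : ℤ, (shiftFunctor D n).Linear k]
  {𝒮 : SerreStructure k D}

namespace OrbitCat

/-- The structure isomorphism `T (x i) ≅ x (i + 1)` of an object, rewritten as an isomorphism
`Σ (x i) ≅ S (x (i + 1))`. -/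
def serreStr (x : OrbitCat 𝒮.arFunctor) (i : ℤ) :
    (shiftFunctor D (1 : ℤ)).obj (x.obj i) ≅ 𝒮.S.functor.obj (x.obj (i + 1)) :=
  (𝒮.S.counitIso.app ((shiftFunctor D (1 : ℤ)).obj (x.obj i))).symm ≪≫
    𝒮.S.functor.mapIso (x.str i)

/-- The object of the orbit category given by isomorphisms `Σ (x i) ≅ S (x (i + 1))`. -/
def ofSerreStr (𝒮 : SerreStructure k D) (x : ℤ → D)
    (σ : ∀ i, (shiftFunctor D (1 : ℤ)).obj (x i) ≅ 𝒮.S.functor.obj (x (i + 1))) :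
    OrbitCat 𝒮.arFunctor where
  obj := x
  str i := 𝒮.S.inverse.mapIso (σ i) ≪≫ (𝒮.S.unitIso.app (x (i + 1))).symm

theorem serreStr_ofSerreStr (x : ℤ → D)
    (σ : ∀ i, (shiftFunctor D (1 : ℤ)).obj (x i) ≅ 𝒮.S.functor.obj (x (i + 1))) (i : ℤ) :
    ((ofSerreStr 𝒮 x σ).serreStr i).hom = (σ i).hom := by
  change 𝒮.S.counitIso.inv.app _ ≫ 𝒮.S.functor.map (𝒮.S.inverse.map (σ i).hom ≫
    𝒮.S.unitIso.inv.app (x (i + 1))) = _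
  simp

/-- Compatibility of entries, expressed by the isomorphisms `Σ (x i) ≅ S (x (i + 1))`. -/
theorem compat_iff {x y : OrbitCat 𝒮.arFunctor} {i j : ℤ} (f : x.obj i ⟶ y.obj j)
    (g : x.obj (i + 1) ⟶ y.obj (j + 1)) :
    𝒮.arFunctor.map f ≫ (y.str j).hom = (x.str i).hom ≫ g ↔
      (shiftFunctor D (1 : ℤ)).map f ≫ (y.serreStr j).hom =
        (x.serreStr i).hom ≫ 𝒮.S.functor.map g := by
  have h1 : (shiftFunctor D (1 : ℤ)).map f ≫ (y.serreStr j).hom =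
      𝒮.S.counitIso.inv.app _ ≫ 𝒮.S.functor.map (𝒮.arFunctor.map f ≫ (y.str j).hom) := by
    change _ ≫ 𝒮.S.counitIso.inv.app _ ≫ 𝒮.S.functor.map (y.str j).hom = _ ≫
      𝒮.S.functor.map (𝒮.S.inverse.map ((shiftFunctor D (1 : ℤ)).map f) ≫ _)
    rw [𝒮.S.functor.map_comp]
    exact 𝒮.S.counitIso.inv.naturality_assoc _ _
  have h2 : (x.serreStr i).hom ≫ 𝒮.S.functor.map g =
      𝒮.S.counitIso.inv.app _ ≫ 𝒮.S.functor.map ((x.str i).hom ≫ g) := by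
    rw [𝒮.S.functor.map_comp]
    exact Category.assoc _ _ _
  rw [h1, h2, cancel_epi, 𝒮.S.functor.map_injective.eq_iff]

theorem serreStr_compat {x y : OrbitCat 𝒮.arFunctor} (f : x ⟶ y) (i j : ℤ) :
    (shiftFunctor D (1 : ℤ)).map (f.mat i j) ≫ (y.serreStr j).hom =
      (x.serreStr i).hom ≫ 𝒮.S.functor.map (f.mat (i + 1) (j + 1)) :=
  (compat_iff _ _).1 (f.compat i j)

end OrbitCat

variable (𝒮) in
/-- A functor `Ψ` on `D` with commutation isomorphisms with the shift and the Serre functor. -/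
structure CommutingFunctor where
  Ψ : D ⥤ D
  φ : shiftFunctor D (1 : ℤ) ⋙ Ψ ≅ Ψ ⋙ shiftFunctor D (1 : ℤ)
  ζ : Ψ ⋙ 𝒮.S.functor ≅ 𝒮.S.functor ⋙ Ψ

namespace CommutingFunctor

variable (A B : CommutingFunctor 𝒮)

/-- The components of the inverse of the commutation isomorphism with the shift. -/
def shiftIso (x : D) :
    (shiftFunctor D (1 : ℤ)).obj (A.Ψ.obj x) ≅ A.Ψ.obj ((shiftFunctor D (1 : ℤ)).obj x) :=
  (A.φ.app x).symm

/-- The components of the inverse of the commutation isomorphism with the Serre functor. -/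
def serreIso (x : D) : A.Ψ.obj (𝒮.S.functor.obj x) ≅ 𝒮.S.functor.obj (A.Ψ.obj x) :=
  (A.ζ.app x).symm

theorem shiftIso_naturality {x y : D} (f : x ⟶ y) :
    (shiftFunctor D (1 : ℤ)).map (A.Ψ.map f) ≫ (A.shiftIso y).hom =
      (A.shiftIso x).hom ≫ A.Ψ.map ((shiftFunctor D (1 : ℤ)).map f) :=
  A.φ.inv.naturality f

theorem serreIso_naturality {x y : D} (f : x ⟶ y) :
    A.Ψ.map (𝒮.S.functor.map f) ≫ (A.serreIso y).hom =
      (A.serreIso x).hom ≫ 𝒮.S.functor.map (A.Ψ.map f) :=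
  A.ζ.inv.naturality f

/-- The isomorphism `Σ (Ψ x) ≅ S (Ψ y)` obtained from an isomorphism `Σ x ≅ S y`. -/
def mapStr {x y : D} (σ : (shiftFunctor D (1 : ℤ)).obj x ≅ 𝒮.S.functor.obj y) :
    (shiftFunctor D (1 : ℤ)).obj (A.Ψ.obj x) ≅ 𝒮.S.functor.obj (A.Ψ.obj y) :=
  A.shiftIso x ≪≫ A.Ψ.mapIso σ ≪≫ A.serreIso y

theorem mapStr_hom {x y : D} (σ : (shiftFunctor D (1 : ℤ)).obj x ≅ 𝒮.S.functor.obj y) :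
    (A.mapStr σ).hom = (A.shiftIso x).hom ≫ A.Ψ.map σ.hom ≫ (A.serreIso y).hom := rfl

theorem mapStr_compat_iff [A.Ψ.Faithful] {x x' y y' : D}
    (σ : (shiftFunctor D (1 : ℤ)).obj x ≅ 𝒮.S.functor.obj x')
    (τ : (shiftFunctor D (1 : ℤ)).obj y ≅ 𝒮.S.functor.obj y') (f : x ⟶ y) (g : x' ⟶ y') :
    (shiftFunctor D (1 : ℤ)).map (A.Ψ.map f) ≫ (A.mapStr τ).hom =
        (A.mapStr σ).hom ≫ 𝒮.S.functor.map (A.Ψ.map g) ↔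
      (shiftFunctor D (1 : ℤ)).map f ≫ τ.hom = σ.hom ≫ 𝒮.S.functor.map g := by
  have e1 : (shiftFunctor D (1 : ℤ)).map (A.Ψ.map f) ≫ (A.mapStr τ).hom =
      (A.shiftIso x).hom ≫ A.Ψ.map ((shiftFunctor D (1 : ℤ)).map f ≫ τ.hom) ≫
        (A.serreIso y').hom := by
    rw [mapStr_hom, A.Ψ.map_comp, Category.assoc, ← Category.assoc, shiftIso_naturality,
      Category.assoc]
  have e2 : (A.mapStr σ).hom ≫ 𝒮.S.functor.map (A.Ψ.map g) =
      (A.shiftIso x).hom ≫ A.Ψ.map (σ.hom ≫ 𝒮.S.functor.map g) ≫ (A.serreIso y').hom := by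
    rw [mapStr_hom, A.Ψ.map_comp, Category.assoc, Category.assoc, Category.assoc,
      serreIso_naturality]
  rw [e1, e2, cancel_epi, cancel_mono, A.Ψ.map_injective.eq_iff]

/-- The action on objects of the orbit category. -/
def liftObj (x : OrbitCat 𝒮.arFunctor) : OrbitCat 𝒮.arFunctor :=
  OrbitCat.ofSerreStr 𝒮 (fun i => A.Ψ.obj (x.obj i)) fun i => A.mapStr (x.serreStr i)

theorem liftObj_serreStr (x : OrbitCat 𝒮.arFunctor) (i : ℤ) :
    ((A.liftObj x).serreStr i).hom = (A.mapStr (x.serreStr i)).hom :=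
  OrbitCat.serreStr_ofSerreStr _ _ i

theorem liftObj_compat_iff [A.Ψ.Faithful] {x y : OrbitCat 𝒮.arFunctor} {i j : ℤ}
    (f : x.obj i ⟶ y.obj j) (g : x.obj (i + 1) ⟶ y.obj (j + 1)) :
    𝒮.arFunctor.map (A.Ψ.map f) ≫ ((A.liftObj y).str j).hom =
        ((A.liftObj x).str i).hom ≫ A.Ψ.map g ↔
      𝒮.arFunctor.map f ≫ (y.str j).hom = (x.str i).hom ≫ g := by
  refine (OrbitCat.compat_iff (x := A.liftObj x) (y := A.liftObj y) _ _).trans ?_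
  rw [liftObj_serreStr, liftObj_serreStr]
  exact (A.mapStr_compat_iff _ _ f g).trans (OrbitCat.compat_iff f g).symm

variable [A.Ψ.Additive] [B.Ψ.Additive] [A.Ψ.Faithful] [B.Ψ.Faithful]

/-- The functor on the orbit category, given on morphisms by applying `Ψ` to all entries. -/
def lift : OrbitCat 𝒮.arFunctor ⥤ OrbitCat 𝒮.arFunctor where
  obj := A.liftObj
  map {x y} f :=
    { mat := fun i j => A.Ψ.map (f.mat i j)
      compat := fun i j => (A.liftObj_compat_iff _ _).2 (f.compat i j)
      finite := fun i => (f.finite i).subset fun j hj h =>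
        hj ((congrArg A.Ψ.map h).trans (A.Ψ.map_zero _ _)) }
  map_id x := OrbitCat.hom_ext fun i j => by
    change A.Ψ.map (OrbitCat.Hom.mat (𝟙 x) i j) = OrbitCat.Hom.mat (𝟙 (A.liftObj x)) i j
    rw [OrbitCat.id_mat, OrbitCat.id_mat]
    by_cases h : i = j
    · subst h
      simp
      rfl
    · rw [dif_neg h, dif_neg h]
      exact A.Ψ.map_zero _ _
  map_comp {x y z} f g := OrbitCat.hom_ext fun i l => by
    have hf : ∀ j, f.mat i j ≠ 0 → j ∈ (f.finite i).toFinset := fun j hj => by simpa using hj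
    change A.Ψ.map ((f ≫ g).mat i l) = _
    rw [OrbitCat.comp_mat f g i l _ hf, Functor.map_sum, OrbitCat.comp_mat _ _ i l
      (f.finite i).toFinset]
    · exact Finset.sum_congr rfl fun j _ => A.Ψ.map_comp _ _
    · exact fun j hj => hf j fun h => hj ((congrArg A.Ψ.map h).trans (A.Ψ.map_zero _ _))

instance : A.lift.Additive where
  map_add := OrbitCat.hom_ext fun _ _ => A.Ψ.map_add

instance [A.Ψ.Linear k] : A.lift.Linear k where
  map_smul f c := OrbitCat.hom_ext fun i j => A.Ψ.map_smul c (f.mat i j)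

instance : A.lift.Faithful where
  map_injective h := OrbitCat.hom_ext fun i j =>
    A.Ψ.map_injective (congrArg (fun f => OrbitCat.Hom.mat f i j) h)

instance [A.Ψ.Full] : A.lift.Full where
  map_surjective {x y} g := by
    have h : ∀ i j, ∃ f : x.obj i ⟶ y.obj j, A.Ψ.map f = g.mat i j := fun i j =>
      A.Ψ.map_surjective _
    choose f hf using h
    refine ⟨
      { mat := f
        compat := fun i j => (A.liftObj_compat_iff _ _).1 ?_
        finite := fun i => (g.finite i).subset fun j hj h => hj (A.Ψ.map_injective ?_) },
      OrbitCat.hom_ext hf⟩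
    · rw [hf, hf]
      exact g.compat i j
    · exact (hf i j).trans (h.trans (A.Ψ.map_zero _ _).symm)

theorem lift_isGraded : IsGradedFunctor k A.lift := fun _ _ hf i j h =>
  (congrArg A.Ψ.map (hf i j h)).trans (A.Ψ.map_zero _ _)

end CommutingFunctor

end Lift

/-! ### Natural isomorphisms between functors on the orbit category -/

namespace OrbitCat

section NatIso

variable {k : Type w} [Field k] {D : Type u} [Category.{v} D] [Preadditive D] [Linear k D]
  {T : D ⥤ D} [T.Additive] [T.Linear k] [T.IsEquivalence]

variable (k) in
/-- A homogeneous morphism with invertible entries is invertible. -/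
theorem isIso_of_mat {x y : OrbitCat T} {p : ℤ} {f : x ⟶ y} (hf : f ∈ gr k x y p)
    (h : ∀ i j, j = i + p → IsIso (f.mat i j)) : IsIso f := by
  choose g hg using fun i j (hj : j = i + p) => (h i j hj).out
  let f' : y ⟶ x := homOf (-p) (fun i j hj => g j i (by omega)) fun i j hj hj' => by
    have h1 := f.compat j i
    have hi : i = j + p := by omega
    have := h (j + 1) (i + 1) (by omega)
    rw [← cancel_mono (f.mat (j + 1) (i + 1)), Category.assoc, Category.assoc,
      (hg (j + 1) (i + 1) (by omega)).2, Category.comp_id, ← h1, ← Category.assoc, ← T.map_comp,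
      (hg j i hi).2, T.map_id, Category.id_comp]
  have hf' : f' ∈ gr k y x (-p) := homOf_mem _ _
  refine ⟨f', gr_ext k (p := 0) ?_ (HomGraded.id_mem (k := k) x) fun i j hj => ?_,
    gr_ext k (p := 0) ?_ (HomGraded.id_mem (k := k) y) fun i j hj => ?_⟩
  · exact HomGraded.comp_mem_of_eq (k := k) hf hf' (by ring)
  · obtain rfl : i = j := by omega
    rw [comp_mat_left k hf _ i (i + p) i rfl, homOf_mat _ _ _ _ (by ring), (hg _ _ _).1, id_mat,
      dif_pos rfl, eqToHom_refl]
  · exact HomGraded.comp_mem_of_eq (k := k) hf' hf (by ring)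
  · obtain rfl : i = j := by omega
    rw [comp_mat_left k hf' _ i (i - p) i (by ring), homOf_mat _ _ _ _ (by ring), (hg _ _ _).2,
      id_mat, dif_pos rfl, eqToHom_refl]

variable (k) in
/-- A natural isomorphism given by homogeneous morphisms of the same degree, with naturality
checked on entries. -/
def natIsoOfMat {G G' : OrbitCat T ⥤ OrbitCat T} (p : ℤ) (θ : ∀ x, G.obj x ⟶ G'.obj x)
    (hθ : ∀ x, θ x ∈ gr k (G.obj x) (G'.obj x) p)
    (hiso : ∀ x i j, j = i + p → IsIso ((θ x).mat i j))
    (hnat : ∀ {x y : OrbitCat T} (f : x ⟶ y) (i j i' j' : ℤ), i' = i + p → j' = j + p →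
      (G.map f).mat i j ≫ (θ y).mat j j' = (θ x).mat i i' ≫ (G'.map f).mat i' j') : G ≅ G' :=
  NatIso.ofComponents (fun x => @asIso _ _ _ _ (θ x) (isIso_of_mat k (hθ x) (hiso x)))
    fun {x y} f => hom_ext fun i l => by
      change (G.map f ≫ θ y).mat i l = (θ x ≫ G'.map f).mat i l
      rw [comp_mat_right k _ (hθ y) i (l - p) l (by ring), comp_mat_left k (hθ x) _ i (i + p) l rfl]
      exact hnat f i (l - p) (i + p) l rfl (by ring)

variable (k) in
/-- A natural isomorphism of degree `0` given by diagonal entries. -/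
theorem exists_natIso_of_diag {G G' : OrbitCat T ⥤ OrbitCat T}
    (θ : ∀ x i, (G.obj x).obj i ≅ (G'.obj x).obj i)
    (hθ : ∀ x i, T.map (θ x i).hom ≫ ((G'.obj x).str i).hom =
      ((G.obj x).str i).hom ≫ (θ x (i + 1)).hom)
    (hnat : ∀ {x y : OrbitCat T} (f : x ⟶ y) (i j : ℤ),
      (G.map f).mat i j ≫ (θ y j).hom = (θ x i).hom ≫ (G'.map f).mat i j) :
    ∃ Θ : G ≅ G', ∀ x, Θ.hom.app x ∈ HomGraded.gr (k := k) (G.obj x) (G'.obj x) 0 := by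
  refine ⟨natIsoOfMat k 0 (fun x => diag (fun i => (θ x i).hom) (hθ x)) (fun x => diag_mem _ (hθ x))
    (fun x i j h => ?_) fun {x y} f i j i' j' hi hj => ?_, fun x => diag_mem _ (hθ x)⟩
  · obtain rfl : i = j := by omega
    rw [diag_mat_self]
    infer_instance
  · obtain rfl : i' = i := by omega
    obtain rfl : j' = j := by omega
    rw [diag_mat_self, diag_mat_self]
    exact hnat f _ _

end NatIso

end OrbitCat

section Lift

variable {k : Type w} [Field k] {D : Type u} [Category.{v} D] [Preadditive D] [Linear k D]
  [HasShift D ℤ] [∀ n : ℤ, (shiftFunctor D n).Additive]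
  [∀ n : ℤ, (shiftFunctor D n).Linear k]
  {𝒮 : SerreStructure k D}

namespace CommutingFunctor

variable (A B C : CommutingFunctor 𝒮)
variable [A.Ψ.Additive] [B.Ψ.Additive] [A.Ψ.Faithful] [B.Ψ.Faithful]

/-- Natural isomorphisms compatible with the commutation isomorphisms give natural isomorphisms
of degree `0` on the orbit category. -/
theorem exists_lift_iso (θ : A.Ψ ≅ B.Ψ)
    (hφ : ∀ x, (A.shiftIso x).hom ≫ θ.hom.app ((shiftFunctor D (1 : ℤ)).obj x) =
      (shiftFunctor D (1 : ℤ)).map (θ.hom.app x) ≫ (B.shiftIso x).hom)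
    (hζ : ∀ x, (A.serreIso x).hom ≫ 𝒮.S.functor.map (θ.hom.app x) =
      θ.hom.app (𝒮.S.functor.obj x) ≫ (B.serreIso x).hom) :
    ∃ Θ : A.lift ≅ B.lift,
      ∀ x, Θ.hom.app x ∈ HomGraded.gr (k := k) (A.lift.obj x) (B.lift.obj x) 0 := by
  refine OrbitCat.exists_natIso_of_diag k (fun x i => θ.app (x.obj i)) (fun x i => ?_)
    fun {x y} f i j => θ.hom.naturality (f.mat i j)
  refine (OrbitCat.compat_iff (x := A.liftObj x) (y := B.liftObj x) _ _).2 ?_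
  rw [liftObj_serreStr, liftObj_serreStr, mapStr_hom, mapStr_hom]
  change (shiftFunctor D (1 : ℤ)).map (θ.hom.app (x.obj i)) ≫ (B.shiftIso (x.obj i)).hom ≫
    B.Ψ.map (x.serreStr i).hom ≫ (B.serreIso (x.obj (i + 1))).hom =
    ((A.shiftIso (x.obj i)).hom ≫ A.Ψ.map (x.serreStr i).hom ≫
      (A.serreIso (x.obj (i + 1))).hom) ≫ 𝒮.S.functor.map (θ.hom.app (x.obj (i + 1)))
  rw [← Category.assoc, ← hφ, Category.assoc, Category.assoc, Category.assoc, hζ,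
    ← θ.hom.naturality_assoc]

/-- The lift of a composite. -/
theorem exists_lift_comp_iso [C.Ψ.Additive] [C.Ψ.Faithful] (e : C.Ψ ≅ A.Ψ ⋙ B.Ψ)
    (hφ : ∀ x, (C.shiftIso x).hom ≫ e.hom.app ((shiftFunctor D (1 : ℤ)).obj x) =
      (shiftFunctor D (1 : ℤ)).map (e.hom.app x) ≫ (B.shiftIso (A.Ψ.obj x)).hom ≫
        B.Ψ.map (A.shiftIso x).hom)
    (hζ : ∀ x, (C.serreIso x).hom ≫ 𝒮.S.functor.map (e.hom.app x) =
      e.hom.app (𝒮.S.functor.obj x) ≫ B.Ψ.map (A.serreIso x).hom ≫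
        (B.serreIso (A.Ψ.obj x)).hom) :
    ∃ Θ : C.lift ≅ A.lift ⋙ B.lift,
      ∀ x, Θ.hom.app x ∈ HomGraded.gr (k := k) (C.lift.obj x) ((A.lift ⋙ B.lift).obj x) 0 := by
  refine OrbitCat.exists_natIso_of_diag k (fun x i => e.app (x.obj i)) (fun x i => ?_)
    fun {x y} f i j => e.hom.naturality (f.mat i j)
  refine (OrbitCat.compat_iff (x := C.liftObj x) (y := B.liftObj (A.liftObj x)) _ _).2 ?_
  rw [liftObj_serreStr, liftObj_serreStr, mapStr_hom, mapStr_hom, liftObj_serreStr, mapStr_hom]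
  change (shiftFunctor D (1 : ℤ)).map (e.hom.app (x.obj i)) ≫
    (B.shiftIso (A.Ψ.obj (x.obj i))).hom ≫ B.Ψ.map ((A.shiftIso (x.obj i)).hom ≫
      A.Ψ.map (x.serreStr i).hom ≫ (A.serreIso (x.obj (i + 1))).hom) ≫
      (B.serreIso (A.Ψ.obj (x.obj (i + 1)))).hom =
    ((C.shiftIso (x.obj i)).hom ≫ C.Ψ.map (x.serreStr i).hom ≫
      (C.serreIso (x.obj (i + 1))).hom) ≫ 𝒮.S.functor.map (e.hom.app (x.obj (i + 1)))
  have h1 := e.hom.naturality (x.serreStr i).hom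
  rw [Functor.comp_map] at h1
  have h2 := hφ (x.obj i)
  have h3 := hζ (x.obj (i + 1))
  rw [Category.assoc, Category.assoc, h3, reassoc_of% h1, reassoc_of% h2, B.Ψ.map_comp,
    B.Ψ.map_comp, Category.assoc, Category.assoc]

/-- The lift of the identity functor. -/
theorem exists_lift_id_iso (e : A.Ψ ≅ 𝟭 D)
    (hφ : ∀ x, (A.shiftIso x).hom ≫ e.hom.app ((shiftFunctor D (1 : ℤ)).obj x) =
      (shiftFunctor D (1 : ℤ)).map (e.hom.app x))
    (hζ : ∀ x, (A.serreIso x).hom ≫ 𝒮.S.functor.map (e.hom.app x) =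
      e.hom.app (𝒮.S.functor.obj x)) :
    ∃ Θ : A.lift ≅ 𝟭 _,
      ∀ x, Θ.hom.app x ∈ HomGraded.gr (k := k) (A.lift.obj x) ((𝟭 _ : _ ⥤ _).obj x) 0 := by
  refine OrbitCat.exists_natIso_of_diag k (fun x i => e.app (x.obj i)) (fun x i => ?_)
    fun {x y} f i j => e.hom.naturality (f.mat i j)
  refine (OrbitCat.compat_iff (x := A.liftObj x) (y := x) _ _).2 ?_
  rw [liftObj_serreStr, mapStr_hom]
  change (shiftFunctor D (1 : ℤ)).map (e.hom.app (x.obj i)) ≫ (x.serreStr i).hom =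
    ((A.shiftIso (x.obj i)).hom ≫ A.Ψ.map (x.serreStr i).hom ≫
      (A.serreIso (x.obj (i + 1))).hom) ≫ 𝒮.S.functor.map (e.hom.app (x.obj (i + 1)))
  have h1 := e.hom.naturality (x.serreStr i).hom
  rw [Category.assoc, Category.assoc, hζ, ← hφ, Category.assoc]
  congr 1
  exact h1.symm

/-- A natural transformation of degree `0` between lifts is determined by its diagonal entries,
which are natural for all morphisms of `D`. -/
theorem diag_naturality (Θ : A.lift ⟶ B.lift)
    (hΘ : ∀ x, Θ.app x ∈ HomGraded.gr (k := k) (A.lift.obj x) (B.lift.obj x) 0)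
    {x y : OrbitCat 𝒮.arFunctor} {i j : ℤ} (f : x.obj i ⟶ y.obj j) :
    A.Ψ.map f ≫ ((Θ.app y).mat j j : A.Ψ.obj (y.obj j) ⟶ B.Ψ.obj (y.obj j)) =
      ((Θ.app x).mat i i : A.Ψ.obj (x.obj i) ⟶ B.Ψ.obj (x.obj i)) ≫ B.Ψ.map f := by
  obtain ⟨g, hg, rfl⟩ := OrbitCat.exists_mat_eq k x y i j f
  have h := congrArg (fun f => OrbitCat.Hom.mat f i j) (Θ.naturality g)
  have h1 := OrbitCat.comp_mat_right k (A.lift.map g) (hΘ y) i j j (by ring)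
  have h2 := OrbitCat.comp_mat_left k (hΘ x) (B.lift.map g) i i j (by ring)
  exact h1.symm.trans (h.trans h2)

/-- A natural isomorphism of degree `0` between lifts comes from a natural isomorphism on `D`
which is compatible with the shift. -/
theorem exists_iso_of_lift_iso (Θ : A.lift ≅ B.lift)
    (hΘ : ∀ x, Θ.hom.app x ∈ HomGraded.gr (k := k) (A.lift.obj x) (B.lift.obj x) 0)
    (hζ : ∀ (θ : A.Ψ ≅ B.Ψ) (x : D), (A.serreIso x).hom ≫ 𝒮.S.functor.map (θ.hom.app x) =
      θ.hom.app (𝒮.S.functor.obj x) ≫ (B.serreIso x).hom) :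
    ∃ θ : A.Ψ ≅ B.Ψ, ∀ x, (A.shiftIso x).hom ≫
      θ.hom.app ((shiftFunctor D (1 : ℤ)).obj x) =
        (shiftFunctor D (1 : ℤ)).map (θ.hom.app x) ≫ (B.shiftIso x).hom := by
  have hΘ' : ∀ x, Θ.inv.app x ∈ HomGraded.gr (k := k) (B.lift.obj x) (A.lift.obj x) 0 := fun x => by
    simpa using HomGraded.inv_mem (k := k) (Θ.app x) (hΘ x)
  choose h h0 using fun d : D => OrbitCat.exists_obj_zero (T := 𝒮.arFunctor) d
  -- The isomorphism attached to an entry of an object of the orbit category.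
  let η : ∀ (x : OrbitCat 𝒮.arFunctor) (i : ℤ), A.Ψ.obj (x.obj i) ≅ B.Ψ.obj (x.obj i) :=
    fun x i =>
    { hom := (Θ.hom.app x).mat i i
      inv := (Θ.inv.app x).mat i i
      hom_inv_id := by
        have h1 := OrbitCat.comp_mat_left k (hΘ x) (Θ.inv.app x) i i i (by ring)
        rw [Iso.hom_inv_id_app, OrbitCat.id_mat, dif_pos rfl] at h1
        exact h1.symm
      inv_hom_id := by
        have h1 := OrbitCat.comp_mat_left k (hΘ' x) (Θ.hom.app x) i i i (by ring)
        rw [Iso.inv_hom_id_app, OrbitCat.id_mat, dif_pos rfl] at h1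
        exact h1.symm }
  have hη : ∀ {x y : OrbitCat 𝒮.arFunctor} {i j : ℤ} (f : x.obj i ⟶ y.obj j),
      A.Ψ.map f ≫ (η y j).hom = (η x i).hom ≫ B.Ψ.map f := fun f =>
    A.diag_naturality B Θ.hom hΘ f
  let c : ∀ d, (h d).obj 0 ≅ d := fun d => eqToIso (h0 d)
  let θ : A.Ψ ≅ B.Ψ := NatIso.ofComponents
    (fun d => A.Ψ.mapIso (c d).symm ≪≫ η (h d) 0 ≪≫ B.Ψ.mapIso (c d))
    fun {d d'} f => by
      have h1 := hη (x := h d) (y := h d') (i := 0) (j := 0) ((c d).hom ≫ f ≫ (c d').inv)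
      simp only [Functor.map_comp, Category.assoc] at h1
      simp only [Iso.trans_hom, Functor.mapIso_hom, Iso.symm_hom, Category.assoc]
      rw [← cancel_epi (A.Ψ.map (c d).hom), reassoc_of% h1]
      simp only [← Functor.map_comp, ← Functor.map_comp_assoc, Iso.hom_inv_id, Iso.inv_hom_id,
        Category.comp_id, CategoryTheory.Functor.map_id, Category.id_comp]
  have hθ : ∀ x i, θ.hom.app (x.obj i) = (η x i).hom := by
    intro x i
    have h1 := hη (x := h (x.obj i)) (y := x) (i := 0) (j := i) (c _).hom
    change A.Ψ.map (c _).inv ≫ (η (h (x.obj i)) 0).hom ≫ B.Ψ.map (c _).hom = _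
    rw [← h1, ← Category.assoc, ← A.Ψ.map_comp, Iso.inv_hom_id, A.Ψ.map_id, Category.id_comp]
  refine ⟨θ, fun d => ?_⟩
  obtain ⟨x, rfl⟩ : ∃ x : OrbitCat 𝒮.arFunctor, x.obj 0 = d := ⟨h d, h0 d⟩
  have h1 := OrbitCat.serreStr_compat (Θ.hom.app x) 0 0
  have h2 : (shiftFunctor D (1 : ℤ)).map (θ.hom.app (x.obj 0)) ≫
      (B.mapStr (x.serreStr 0)).hom =
      (A.mapStr (x.serreStr 0)).hom ≫ 𝒮.S.functor.map (θ.hom.app (x.obj (0 + 1))) := by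
    rw [hθ, hθ, ← liftObj_serreStr, ← liftObj_serreStr]
    exact h1
  rw [mapStr_hom, mapStr_hom, Category.assoc, Category.assoc, hζ θ, θ.hom.naturality_assoc] at h2
  rw [← cancel_mono (B.Ψ.map (x.serreStr 0).hom ≫ (B.serreIso (x.obj (0 + 1))).hom),
    Category.assoc, Category.assoc, h2]

end CommutingFunctor

end Lift

/-! ### Graded functors on the idempotent completion -/

section GrKaroubi

variable {k : Type w} [Field k] {C : Type u} [Category.{v} C] [Preadditive C] [Linear k C]
  [HomGraded k C]

namespace GrKaroubi

theorem hom_ext {P Q : GrKaroubi k C} {f g : P ⟶ Q} (h : f.hom.f = g.hom.f) : f = g := by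
  apply ObjectProperty.hom_ext
  apply Karoubi.hom_ext
  exact h

/-- A morphism of the idempotent completion from a morphism fixed by the idempotents. -/
def mkHom {P Q : GrKaroubi k C} (f : P.obj.X ⟶ Q.obj.X) (h : P.obj.p ≫ f ≫ Q.obj.p = f) :
    P ⟶ Q := ObjectProperty.homMk ⟨f, h⟩

theorem p_comp {P Q : GrKaroubi k C} (f : P ⟶ Q) : P.obj.p ≫ f.hom.f = f.hom.f :=
  Karoubi.p_comp f.hom

theorem comp_p {P Q : GrKaroubi k C} (f : P ⟶ Q) : f.hom.f ≫ Q.obj.p = f.hom.f :=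
  Karoubi.comp_p f.hom

/-- An object of `C`, with the identity as idempotent. -/
def of (k : Type w) [Field k] [Linear k C] [HomGraded k C] (x : C) : GrKaroubi k C :=
  ⟨⟨x, 𝟙 x, Category.id_comp _⟩, HomGraded.id_mem x⟩

variable (k C) in
theorem degreeZeroIdempotentsSplit : DegreeZeroIdempotentsSplit k (GrKaroubi k C) := by
  intro P e he hee
  have h : e.hom.f ≫ e.hom.f = e.hom.f := congrArg (fun f => f.hom.f) hee
  let Q : GrKaroubi k C := ⟨⟨P.obj.X, e.hom.f, h⟩, he⟩
  refine ⟨Q, mkHom e.hom.f ?_, mkHom e.hom.f ?_, hom_ext h, hom_ext h⟩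
  · change e.hom.f ≫ e.hom.f ≫ P.obj.p = e.hom.f
    rw [comp_p, h]
  · change P.obj.p ≫ e.hom.f ≫ e.hom.f = e.hom.f
    rw [h, p_comp]

theorem finite_hom (hfin : ∀ x y : C, Module.Finite k (x ⟶ y)) (P Q : GrKaroubi k C) :
    Module.Finite k (P ⟶ Q) :=
  Module.Finite.of_injective (grKaroubiHomMap (k := k) P Q) fun _ _ h => hom_ext h

variable (G : C ⥤ C) (hG : IsGradedFunctor k G)

/-- The functor on the idempotent completion induced by a graded functor. -/
def mapFunctor : GrKaroubi k C ⥤ GrKaroubi k C where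
  obj P := ⟨⟨G.obj P.obj.X, G.map P.obj.p, by rw [← G.map_comp, P.obj.idem]⟩, hG 0 _ P.property⟩
  map {P Q} f := mkHom (G.map f.hom.f) (by
    change G.map P.obj.p ≫ G.map f.hom.f ≫ G.map Q.obj.p = _
    rw [← G.map_comp, ← G.map_comp, comp_p, p_comp])
  map_id _ := rfl
  map_comp _ _ := hom_ext (G.map_comp _ _)

theorem mapFunctor_isGraded : IsGradedFunctor k (mapFunctor G hG) := fun p f hf => hG p f.hom.f hf

instance [G.Additive] : (mapFunctor G hG).Additive where
  map_add := hom_ext G.map_add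

instance [G.Linear k] : (mapFunctor G hG).Linear k where
  map_smul f c := hom_ext (G.map_smul c f.hom.f)

instance [G.Faithful] : (mapFunctor G hG).Faithful where
  map_injective h := hom_ext (G.map_injective (congrArg (fun f => f.hom.f) h))

instance [G.Full] [G.Faithful] : (mapFunctor G hG).Full where
  map_surjective {P Q} g := by
    obtain ⟨f, hf⟩ := G.map_surjective (g.hom.f : G.obj P.obj.X ⟶ G.obj Q.obj.X)
    refine ⟨mkHom f (G.map_injective ?_), hom_ext hf⟩
    rw [G.map_comp, G.map_comp, hf]
    exact (congrArg (G.map P.obj.p ≫ ·) (comp_p g)).trans (p_comp g)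

variable {G} {G' : C ⥤ C} {hG} {hG' : IsGradedFunctor k G'}

variable (hG hG') in
/-- A homogeneous natural isomorphism extends to the idempotent completion. -/
theorem exists_mapFunctor_iso (p : ℤ) (θ : G ≅ G')
    (hθ : ∀ x, θ.hom.app x ∈ HomGraded.gr (k := k) (G.obj x) (G'.obj x) p) :
    ∃ Θ : mapFunctor G hG ≅ mapFunctor G' hG', ∀ P, Θ.hom.app P ∈ HomGraded.gr (k := k) _ _ p := by
  have h1 : ∀ P : GrKaroubi k C, P.obj.p ≫ P.obj.p = P.obj.p := fun P => P.obj.idem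
  refine ⟨NatIso.ofComponents (fun P =>
    { hom := mkHom (G.map P.obj.p ≫ θ.hom.app P.obj.X) ?_
      inv := mkHom (G'.map P.obj.p ≫ θ.inv.app P.obj.X) ?_
      hom_inv_id := hom_ext ?_
      inv_hom_id := hom_ext ?_ }) fun {P Q} f => hom_ext ?_, fun P => ?_⟩
  · change G.map P.obj.p ≫ (G.map P.obj.p ≫ θ.hom.app P.obj.X) ≫ G'.map P.obj.p = _
    rw [Category.assoc, ← θ.hom.naturality, ← G.map_comp_assoc, ← G.map_comp_assoc, h1, h1]
    rfl
  · change G'.map P.obj.p ≫ (G'.map P.obj.p ≫ θ.inv.app P.obj.X) ≫ G.map P.obj.p = _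
    rw [Category.assoc, ← θ.inv.naturality, ← G'.map_comp_assoc, ← G'.map_comp_assoc, h1, h1]
    rfl
  · change (G.map P.obj.p ≫ θ.hom.app P.obj.X) ≫ G'.map P.obj.p ≫ θ.inv.app P.obj.X =
      G.map P.obj.p
    rw [Category.assoc, θ.inv.naturality, θ.hom_inv_id_app_assoc, ← G.map_comp, h1]
  · change (G'.map P.obj.p ≫ θ.inv.app P.obj.X) ≫ G.map P.obj.p ≫ θ.hom.app P.obj.X =
      G'.map P.obj.p
    rw [Category.assoc, θ.hom.naturality, θ.inv_hom_id_app_assoc, ← G'.map_comp, h1]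
  · change G.map f.hom.f ≫ G.map Q.obj.p ≫ θ.hom.app Q.obj.X =
      (G.map P.obj.p ≫ θ.hom.app P.obj.X) ≫ G'.map f.hom.f
    rw [Category.assoc, ← θ.hom.naturality, ← G.map_comp_assoc, ← G.map_comp_assoc, comp_p, p_comp]
  · exact HomGraded.comp_mem_of_eq (k := k) (hG 0 _ P.property) (hθ P.obj.X) (by ring)

theorem exists_mapFunctor_comp_iso {G'' : C ⥤ C} {hG'' : IsGradedFunctor k G''}
    (θ : G'' ≅ G ⋙ G')
    (hθ : ∀ x, θ.hom.app x ∈ HomGraded.gr (k := k) (G''.obj x) ((G ⋙ G').obj x) 0) :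
    ∃ Θ : mapFunctor G'' hG'' ≅ mapFunctor G hG ⋙ mapFunctor G' hG',
      ∀ P, Θ.hom.app P ∈ HomGraded.gr (k := k) _ _ 0 := by
  have h : IsGradedFunctor k (G ⋙ G') := fun p f hf => hG' p (G.map f) (hG p f hf)
  obtain ⟨Θ, hΘ⟩ := exists_mapFunctor_iso hG'' h 0 θ hθ
  exact ⟨Θ, hΘ⟩

theorem exists_mapFunctor_id_iso (θ : G ≅ 𝟭 C)
    (hθ : ∀ x, θ.hom.app x ∈ HomGraded.gr (k := k) (G.obj x) ((𝟭 C : C ⥤ C).obj x) 0) :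
    ∃ Θ : mapFunctor G hG ≅ 𝟭 _, ∀ P, Θ.hom.app P ∈ HomGraded.gr (k := k) _ _ 0 := by
  obtain ⟨Θ, hΘ⟩ := exists_mapFunctor_iso hG (hG' := fun _ _ hf => hf) 0 θ hθ
  exact ⟨Θ, hΘ⟩

/-- A natural isomorphism of degree `0` on the idempotent completion restricts to `C`. -/
theorem exists_iso_of_mapFunctor_iso (Θ : mapFunctor G hG ≅ mapFunctor G' hG')
    (hΘ : ∀ P, Θ.hom.app P ∈ HomGraded.gr (k := k) _ _ 0) :
    ∃ θ : G ≅ G', ∀ x, θ.hom.app x ∈ HomGraded.gr (k := k) (G.obj x) (G'.obj x) 0 := by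
  refine ⟨NatIso.ofComponents (fun x =>
    { hom := (Θ.hom.app (of k x)).hom.f
      inv := (Θ.inv.app (of k x)).hom.f
      hom_inv_id := ?_
      inv_hom_id := ?_ }) fun {x y} f => ?_, fun x => hΘ (of k x)⟩
  · exact (congrArg (fun f => f.hom.f) (Θ.hom_inv_id_app (of k x))).trans (G.map_id x)
  · exact (congrArg (fun f => f.hom.f) (Θ.inv_hom_id_app (of k x))).trans (G'.map_id x)
  · exact congrArg (fun f => f.hom.f) (Θ.hom.naturality (mkHom f (by
      change 𝟙 x ≫ f ≫ 𝟙 y = f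
      simp) : of k x ⟶ of k y))

end GrKaroubi

end GrKaroubi

/-! ### The Serre functor of the orbit category -/

section Serre

variable {k : Type w} [Field k] {D : Type u} [Category.{v} D] [Preadditive D] [Linear k D]
  [HasShift D ℤ] [∀ n : ℤ, (shiftFunctor D n).Additive]
  [∀ n : ℤ, (shiftFunctor D n).Linear k]

namespace SerreStructure

variable (𝒮 : SerreStructure k D)

/-- The suspension with the commutation isomorphism `-id`. -/
def shiftCommuting (ζ : shiftFunctor D (1 : ℤ) ⋙ 𝒮.S.functor ≅
    𝒮.S.functor ⋙ shiftFunctor D (1 : ℤ)) : CommutingFunctor 𝒮 :=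
  ⟨shiftFunctor D (1 : ℤ), - Iso.refl _, ζ⟩

/-- The Serre functor, which commutes with itself through the identity. -/
def serreCommuting (s : shiftFunctor D (1 : ℤ) ⋙ 𝒮.S.functor ≅
    𝒮.S.functor ⋙ shiftFunctor D (1 : ℤ)) : CommutingFunctor 𝒮 :=
  ⟨𝒮.S.functor, s, Iso.refl _⟩

variable {𝒮}
variable {ζ s : shiftFunctor D (1 : ℤ) ⋙ 𝒮.S.functor ≅ 𝒮.S.functor ⋙ shiftFunctor D (1 : ℤ)}

theorem inv_app_eq_neg (hs : ∀ x, s.hom.app x = - ζ.hom.app x) (x : D) :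
    s.inv.app x = - ζ.inv.app x := by
  rw [← cancel_epi (s.hom.app x), Iso.hom_inv_id_app, hs]
  simp

theorem shiftCommuting_mapStr {x y : D}
    (σ : (shiftFunctor D (1 : ℤ)).obj x ≅ 𝒮.S.functor.obj y) :
    ((𝒮.shiftCommuting ζ).mapStr σ).hom =
      - ((shiftFunctor D (1 : ℤ)).map σ.hom ≫ ζ.inv.app y) := by
  change (- 𝟙 _) ≫ (shiftFunctor D (1 : ℤ)).map σ.hom ≫ ζ.inv.app y = _
  rw [Preadditive.neg_comp]
  exact congrArg Neg.neg (Category.id_comp _)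

theorem serreCommuting_mapStr {x y : D}
    (σ : (shiftFunctor D (1 : ℤ)).obj x ≅ 𝒮.S.functor.obj y) :
    ((𝒮.serreCommuting s).mapStr σ).hom = s.inv.app x ≫ 𝒮.S.functor.map σ.hom := by
  change s.inv.app x ≫ 𝒮.S.functor.map σ.hom ≫ 𝟙 _ = _
  exact congrArg _ (Category.comp_id _)

instance : (𝒮.shiftCommuting ζ).Ψ.Additive :=
  inferInstanceAs (shiftFunctor D (1 : ℤ)).Additive
instance : (𝒮.shiftCommuting ζ).Ψ.Faithful :=
  inferInstanceAs (shiftFunctor D (1 : ℤ)).Faithful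
instance : (𝒮.serreCommuting s).Ψ.Additive := inferInstanceAs 𝒮.S.functor.Additive
instance : (𝒮.serreCommuting s).Ψ.Faithful := inferInstanceAs 𝒮.S.functor.Faithful

/-- The structure isomorphisms `Σ (x i) ≅ S (x (i + 1))` form an isomorphism of degree `1` from
the suspension to the Serre functor on the orbit category. -/
theorem exists_shift_lift_iso_serre_lift (hs : ∀ x, s.hom.app x = - ζ.hom.app x) :
    ∃ Θ : (𝒮.shiftCommuting ζ).lift ≅ (𝒮.serreCommuting s).lift,
      ∀ x, Θ.hom.app x ∈ HomGraded.gr (k := k) ((𝒮.shiftCommuting ζ).lift.obj x)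
        ((𝒮.serreCommuting s).lift.obj x) 1 := by
  let w : ∀ x : OrbitCat 𝒮.arFunctor, (𝒮.shiftCommuting ζ).liftObj x ⟶
      (𝒮.serreCommuting s).liftObj x := fun x =>
    OrbitCat.homOf 1 (fun i j h => (x.serreStr i).hom ≫ eqToHom (by rw [h]; rfl))
      fun i j h h' => by
        subst h
        refine (OrbitCat.compat_iff (x := (𝒮.shiftCommuting ζ).liftObj x)
          (y := (𝒮.serreCommuting s).liftObj x) _ _).2 ?_
        rw [CommutingFunctor.liftObj_serreStr, CommutingFunctor.liftObj_serreStr,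
          shiftCommuting_mapStr, serreCommuting_mapStr, inv_app_eq_neg hs]
        have e1 : (x.serreStr i).hom ≫ eqToHom rfl = (x.serreStr i).hom := Category.comp_id _
        have e2 : (x.serreStr (i + 1)).hom ≫ eqToHom rfl = (x.serreStr (i + 1)).hom :=
          Category.comp_id _
        change (shiftFunctor D (1 : ℤ)).map ((x.serreStr i).hom ≫ eqToHom rfl) ≫
          (- ζ.inv.app (x.obj (i + 1))) ≫ 𝒮.S.functor.map (x.serreStr (i + 1)).hom =
          (- ((shiftFunctor D (1 : ℤ)).map (x.serreStr i).hom ≫ ζ.inv.app (x.obj (i + 1)))) ≫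
            𝒮.S.functor.map ((x.serreStr (i + 1)).hom ≫ eqToHom rfl)
        rw [e1, e2, Preadditive.neg_comp, Preadditive.comp_neg, Preadditive.neg_comp,
          Category.assoc]
  have hw : ∀ x i, (w x).mat i (i + 1) = (x.serreStr i).hom := fun x i =>
    (OrbitCat.homOf_mat _ _ i (i + 1) rfl).trans (Category.comp_id _)
  have hmem : ∀ x, w x ∈ OrbitCat.gr k _ _ 1 := fun x i j h => dif_neg h
  refine ⟨OrbitCat.natIsoOfMat k 1 w hmem (fun x i j h => ?_)
    fun {x y} f i j i' j' hi hj => ?_, hmem⟩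
  · subst h
    rw [hw]
    exact (x.serreStr i).isIso_hom
  · subst hi hj
    rw [hw, hw]
    exact OrbitCat.serreStr_compat f i j

/-- The trace of the orbit category changes sign along the diagonal, as `s` is the negative of the
trace-preserving commutation isomorphism. -/
theorem tr_mat_succ (hζ : 𝒮.IsTraceComm (shiftFunctor D (1 : ℤ)) ζ)
    (hs : ∀ x, s.hom.app x = - ζ.hom.app x) {x : OrbitCat 𝒮.arFunctor}
    (h : x ⟶ (𝒮.serreCommuting s).lift.obj x) (i : ℤ) :
    𝒮.tr (x.obj (i + 1)) (h.mat (i + 1) (i + 1)) = - 𝒮.tr (x.obj i) (h.mat i i) := by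
  let a : x.obj i ⟶ 𝒮.S.functor.obj (x.obj i) := h.mat i i
  let b : x.obj (i + 1) ⟶ 𝒮.S.functor.obj (x.obj (i + 1)) := h.mat (i + 1) (i + 1)
  change 𝒮.tr _ b = - 𝒮.tr _ a
  have h1 := OrbitCat.serreStr_compat h i i
  have h2 : (shiftFunctor D (1 : ℤ)).map a ≫ ((𝒮.serreCommuting s).mapStr (x.serreStr i)).hom =
      (x.serreStr i).hom ≫ 𝒮.S.functor.map b := by
    rw [← CommutingFunctor.liftObj_serreStr]
    exact h1
  rw [serreCommuting_mapStr, inv_app_eq_neg hs] at h2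
  rw [← tr_map, ← (x.serreStr i).inv_hom_id_assoc (𝒮.S.functor.map b), ← h2]
  have h3 := 𝒮.tr_comp (x.serreStr i).hom ((x.serreStr i).inv ≫
    (shiftFunctor D (1 : ℤ)).map a ≫ (- ζ.inv.app (x.obj i)))
  rw [Iso.hom_inv_id_assoc, Category.assoc, Category.assoc] at h3
  refine h3.symm.trans ?_
  rw [Preadditive.comp_neg, map_neg]
  exact congrArg Neg.neg (hζ _ a)

theorem tr_mat (hζ : 𝒮.IsTraceComm (shiftFunctor D (1 : ℤ)) ζ)
    (hs : ∀ x, s.hom.app x = - ζ.hom.app x) {x : OrbitCat 𝒮.arFunctor}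
    (h : x ⟶ (𝒮.serreCommuting s).lift.obj x) (i : ℤ) :
    𝒮.tr (x.obj i) (h.mat i i) = charVal (sgn k) i * 𝒮.tr (x.obj 0) (h.mat 0 0) := by
  induction i with
  | zero => rw [charVal_zero, one_mul]
  | succ n ih => rw [tr_mat_succ hζ hs, ih, charVal_add, charVal_sgn_one]; ring
  | pred n ih =>
    have h1 := tr_mat_succ hζ hs h (-(n : ℤ) - 1)
    rw [sub_add_cancel, ih] at h1
    have h2 : charVal (sgn k) (-(n : ℤ)) = - charVal (sgn k) (-(n : ℤ) - 1) := by
      conv_lhs => rw [← sub_add_cancel (-(n : ℤ)) 1, charVal_add, charVal_sgn_one]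
      ring
    rw [h2, neg_mul, neg_inj] at h1
    exact h1.symm

/-- The signed trace of the idempotent completion of the orbit category: the trace of the diagonal
entry at `0`. A morphism of degree `p` moves this entry to the one at `p` when it is cycled around,
which explains the sign. -/
def signedTrace (hζ : 𝒮.IsTraceComm (shiftFunctor D (1 : ℤ)) ζ)
    (hs : ∀ x, s.hom.app x = - ζ.hom.app x) :
    SignedTrace k (GrKaroubi.mapFunctor (𝒮.serreCommuting s).lift
      (𝒮.serreCommuting s).lift_isGraded) where
  τ P :=
    { toFun := fun f => 𝒮.tr (P.obj.X.obj 0) (f.hom.f.mat 0 0)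
      map_add' := fun f g => map_add (𝒮.tr (P.obj.X.obj 0)) _ _
      map_smul' := fun c f => map_smul (𝒮.tr (P.obj.X.obj 0)) c _ }
  eq_zero {P p} f hf hp := by
    have h : f.hom.f.mat 0 0 = 0 := hf 0 0 (by omega)
    exact (congrArg (𝒮.tr (P.obj.X.obj 0)) h).trans (map_zero _)
  cyclic {P Q p} f hf g := by
    change 𝒮.tr (P.obj.X.obj 0) ((f.hom.f ≫ g.hom.f).mat 0 0) = _ *
      𝒮.tr (Q.obj.X.obj 0) ((g.hom.f ≫ (𝒮.serreCommuting s).lift.map f.hom.f).mat 0 0)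
    have h1 := tr_mat hζ hs (g.hom.f ≫ (𝒮.serreCommuting s).lift.map f.hom.f) p
    have h2 := OrbitCat.comp_mat_left k hf g.hom.f 0 p 0 (by ring)
    have h3 := OrbitCat.comp_mat_right k g.hom.f
      ((𝒮.serreCommuting s).lift_isGraded p _ hf) p 0 p (by ring)
    have h4 : 𝒮.tr (Q.obj.X.obj p)
        ((g.hom.f ≫ (𝒮.serreCommuting s).lift.map f.hom.f).mat p p) =
        𝒮.tr (P.obj.X.obj 0) ((f.hom.f ≫ g.hom.f).mat 0 0) :=
      ((congrArg (𝒮.tr (Q.obj.X.obj p)) h3).trans (𝒮.tr_comp _ _).symm).trans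
        (congrArg (𝒮.tr (P.obj.X.obj 0)) h2.symm)
    rw [← h4, h1]
  nondeg {P Q} f hf := by
    apply GrKaroubi.hom_ext
    have h0 : ∀ p, f.hom.f.mat 0 p = 0 := by
      intro p
      -- A test morphism `m` for the entry `(0, p)` extends to a homogeneous morphism of the orbit
      -- category, which is then cut down by the idempotents of `P` and `Q`.
      refine 𝒮.eq_zero_of_tr_comp fun m => ?_
      obtain ⟨g, hg, hgm⟩ := OrbitCat.exists_mat_eq k Q.obj.X
        ((𝒮.serreCommuting s).lift.obj P.obj.X) p 0 m
      let e := (𝒮.serreCommuting s).lift.map P.obj.p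
      have he : e ∈ OrbitCat.gr k _ _ 0 := (𝒮.serreCommuting s).lift_isGraded 0 _ P.property
      have hee : e ≫ e = e := by
        rw [← Functor.map_comp, P.obj.idem]
      have h1 := hf (GrKaroubi.mkHom (Q.obj.p ≫ g ≫ e) (by
        change Q.obj.p ≫ (Q.obj.p ≫ g ≫ e) ≫ e = _
        rw [Category.assoc, Category.assoc, hee, ← Category.assoc, Q.obj.idem]
        rfl))
      have h2 : f.hom.f ≫ Q.obj.p ≫ g ≫ e = (f.hom.f ≫ g) ≫ e := by
        rw [← Category.assoc, GrKaroubi.comp_p, Category.assoc]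
      have h3 : 𝒮.tr (P.obj.X.obj 0) (((f.hom.f ≫ g) ≫ e).mat 0 0) = 0 :=
        (congrArg (fun h => 𝒮.tr (P.obj.X.obj 0) (OrbitCat.Hom.mat h 0 0)) h2).symm.trans h1
      have h4 := OrbitCat.comp_mat_right k (f.hom.f ≫ g) he 0 0 0 (by ring)
      have h5 := OrbitCat.comp_mat_left k P.property (f.hom.f ≫ g) 0 0 0 (by ring)
      rw [← Category.assoc, GrKaroubi.p_comp] at h5
      have h6 := OrbitCat.comp_mat_right k f.hom.f hg 0 p 0 (by ring)
      have h7 : 𝒮.tr (P.obj.X.obj 0) ((f.hom.f ≫ g).mat 0 0) = 0 :=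
        (congrArg (𝒮.tr (P.obj.X.obj 0)) h5).trans ((𝒮.tr_comp _ _).trans
          ((congrArg (𝒮.tr (P.obj.X.obj 0)) h4.symm).trans h3))
      rw [← hgm]
      exact (congrArg (𝒮.tr (P.obj.X.obj 0)) h6).symm.trans h7
    refine (OrbitCat.eq_sum_component (k := k) _ _ f.hom.f).trans
      (Finset.sum_eq_zero fun p _ => OrbitCat.component_eq_zero _ _ p _ (h0 p))

end SerreStructure

end Serre

/-! ### Equivariant autoequivalences and degree-adjusted automorphisms -/

section Induces

variable {k : Type w} [Field k] {D : Type u} [Category.{v} D] [Preadditive D] [Linear k D]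
  [HasShift D ℤ] [∀ n : ℤ, (shiftFunctor D n).Additive]
  [∀ n : ℤ, (shiftFunctor D n).Linear k]
  (𝒮 : SerreStructure k D)
  {ι : Type t} [Fintype ι] [DecidableEq ι] {X : ι → GrKaroubi k (OrbitCat 𝒮.arFunctor)}

namespace EquivariantAut

variable (A B : EquivariantAut (shiftEquiv D (1 : ℤ)).functor)

variable {𝒮} in
/-- An equivariant autoequivalence with a commutation isomorphism with the Serre functor. -/
def commuting (ζ : A.Φ.functor ⋙ 𝒮.S.functor ≅ 𝒮.S.functor ⋙ A.Φ.functor) :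
    CommutingFunctor 𝒮 := ⟨A.Φ.functor, A.comm, ζ⟩

variable {𝒮} {A B}

instance (ζ : A.Φ.functor ⋙ 𝒮.S.functor ≅ 𝒮.S.functor ⋙ A.Φ.functor)
    [A.Φ.functor.Additive] : (A.commuting ζ).Ψ.Additive :=
  inferInstanceAs A.Φ.functor.Additive

instance (ζ : A.Φ.functor ⋙ 𝒮.S.functor ≅ 𝒮.S.functor ⋙ A.Φ.functor)
    [A.Φ.functor.Linear k] : (A.commuting ζ).Ψ.Linear k :=
  inferInstanceAs (A.Φ.functor.Linear k)

instance (ζ : A.Φ.functor ⋙ 𝒮.S.functor ≅ 𝒮.S.functor ⋙ A.Φ.functor) :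
    (A.commuting ζ).Ψ.Faithful := inferInstanceAs A.Φ.functor.Faithful

instance (ζ : A.Φ.functor ⋙ 𝒮.S.functor ≅ 𝒮.S.functor ⋙ A.Φ.functor) :
    (A.commuting ζ).Ψ.Full := inferInstanceAs A.Φ.functor.Full

/-- The functor on the graded idempotent completion of the orbit category induced by an
equivariant autoequivalence. -/
def induced (ζ : A.Φ.functor ⋙ 𝒮.S.functor ≅ 𝒮.S.functor ⋙ A.Φ.functor)
    [A.Φ.functor.Additive] :
    GrKaroubi k (OrbitCat 𝒮.arFunctor) ⥤ GrKaroubi k (OrbitCat 𝒮.arFunctor) :=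
  GrKaroubi.mapFunctor (A.commuting ζ).lift (A.commuting ζ).lift_isGraded

theorem induced_isGraded (ζ : A.Φ.functor ⋙ 𝒮.S.functor ≅ 𝒮.S.functor ⋙ A.Φ.functor)
    [A.Φ.functor.Additive] : IsGradedFunctor k (induced ζ) :=
  GrKaroubi.mapFunctor_isGraded (A.commuting ζ).lift (A.commuting ζ).lift_isGraded

instance (ζ : A.Φ.functor ⋙ 𝒮.S.functor ≅ 𝒮.S.functor ⋙ A.Φ.functor)
    [A.Φ.functor.Additive] : (induced ζ).Additive :=
  inferInstanceAs (GrKaroubi.mapFunctor (A.commuting ζ).lift (A.commuting ζ).lift_isGraded).Additive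

instance (ζ : A.Φ.functor ⋙ 𝒮.S.functor ≅ 𝒮.S.functor ⋙ A.Φ.functor)
    [A.Φ.functor.Additive] [A.Φ.functor.Linear k] : (induced ζ).Linear k :=
  inferInstanceAs ((GrKaroubi.mapFunctor (A.commuting ζ).lift (A.commuting ζ).lift_isGraded).Linear k)

instance (ζ : A.Φ.functor ⋙ 𝒮.S.functor ≅ 𝒮.S.functor ⋙ A.Φ.functor)
    [A.Φ.functor.Additive] : (induced ζ).Full :=
  inferInstanceAs (GrKaroubi.mapFunctor (A.commuting ζ).lift (A.commuting ζ).lift_isGraded).Full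

instance (ζ : A.Φ.functor ⋙ 𝒮.S.functor ≅ 𝒮.S.functor ⋙ A.Φ.functor)
    [A.Φ.functor.Additive] : (induced ζ).Faithful :=
  inferInstanceAs (GrKaroubi.mapFunctor (A.commuting ζ).lift (A.commuting ζ).lift_isGraded).Faithful

variable (A B)

variable (X) in
/-- The linear equivariant autoequivalence `A` induces the degree-adjusted automorphism `F` of
the base algebra: `F` describes the effect on the objects `X i` of the functor induced by `A` and
its canonical commutation isomorphism with the Serre functor. -/
def Induces (F : DegAdjAut (CatAlg.grading k X) (CatAlg.vertex X)) : Prop :=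
  ∃ (_ : A.Φ.functor.Additive) (_ : A.Φ.functor.Linear k)
    (ζ : A.Φ.functor ⋙ 𝒮.S.functor ≅ 𝒮.S.functor ⋙ A.Φ.functor),
    𝒮.IsTraceComm A.Φ.functor ζ ∧ Realizes (induced ζ) F

variable {A B} in
/-- Natural isomorphisms of degree `0` between induced functors are isomorphisms of equivariant
functors. -/
theorem isIsomorphic_iff_induced_iso [A.Φ.functor.Additive] [B.Φ.functor.Additive]
    {ζ : A.Φ.functor ⋙ 𝒮.S.functor ≅ 𝒮.S.functor ⋙ A.Φ.functor}
    {ζ' : B.Φ.functor ⋙ 𝒮.S.functor ≅ 𝒮.S.functor ⋙ B.Φ.functor}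
    (hζ : 𝒮.IsTraceComm A.Φ.functor ζ) (hζ' : 𝒮.IsTraceComm B.Φ.functor ζ') :
    A.IsIsomorphic B ↔ ∃ Θ : induced ζ ≅ induced ζ',
      ∀ P, Θ.hom.app P ∈ HomGraded.gr (k := k) _ _ 0 := by
  -- Compatibility with the commutation isomorphisms, expressed by their inverses.
  have key : ∀ (θ : A.Φ.functor ≅ B.Φ.functor) (x : D),
      (A.comm.hom.app x ≫ (shiftFunctor D (1 : ℤ)).map (θ.hom.app x) =
        θ.hom.app ((shiftFunctor D (1 : ℤ)).obj x) ≫ B.comm.hom.app x) ↔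
      A.comm.inv.app x ≫ θ.hom.app ((shiftFunctor D (1 : ℤ)).obj x) =
        (shiftFunctor D (1 : ℤ)).map (θ.hom.app x) ≫ B.comm.inv.app x := by
    intro θ x
    have h : ∀ {a b c d : D} (u : a ≅ b) (v : c ≅ d) (f : b ⟶ d) (g : a ⟶ c),
        u.hom ≫ f = g ≫ v.hom ↔ u.inv ≫ g = f ≫ v.inv := by
      intro a b c d u v f g
      rw [Iso.inv_comp_eq, ← Category.assoc, Iso.eq_comp_inv, eq_comm]
    exact h (A.comm.app x) (B.comm.app x) _ _
  constructor
  · rintro ⟨θ, hθ⟩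
    obtain ⟨Θ, hΘ⟩ := CommutingFunctor.exists_lift_iso (A.commuting ζ) (B.commuting ζ') θ
      (fun x => (key θ x).1 (hθ x)) (fun x => hζ.naturality 𝒮 hζ' θ x)
    exact GrKaroubi.exists_mapFunctor_iso (A.commuting ζ).lift_isGraded
      (B.commuting ζ').lift_isGraded 0 Θ hΘ
  · rintro ⟨Θ, hΘ⟩
    obtain ⟨Θ', hΘ'⟩ := GrKaroubi.exists_iso_of_mapFunctor_iso
      (hG := (A.commuting ζ).lift_isGraded) (hG' := (B.commuting ζ').lift_isGraded) Θ hΘ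
    obtain ⟨θ, hθ⟩ := CommutingFunctor.exists_iso_of_lift_iso (A.commuting ζ) (B.commuting ζ')
      Θ' hΘ' (fun θ x => hζ.naturality 𝒮 hζ' θ x)
    exact ⟨θ, fun x => (key θ x).2 (hθ x)⟩

/-- Composition of equivariant autoequivalences, on the level of induced functors. -/
theorem exists_induced_comp_iso [A.Φ.functor.Additive] [B.Φ.functor.Additive]
    [(B.comp A).Φ.functor.Additive]
    (ζ : A.Φ.functor ⋙ 𝒮.S.functor ≅ 𝒮.S.functor ⋙ A.Φ.functor)
    (ζ' : B.Φ.functor ⋙ 𝒮.S.functor ≅ 𝒮.S.functor ⋙ B.Φ.functor)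
    (ζ'' : (B.comp A).Φ.functor ⋙ 𝒮.S.functor ≅ 𝒮.S.functor ⋙ (B.comp A).Φ.functor)
    (h : ∀ x, ζ''.inv.app x = B.Φ.functor.map (ζ.inv.app x) ≫ ζ'.inv.app (A.Φ.functor.obj x)) :
    ∃ Θ : induced ζ'' ≅ induced ζ ⋙ induced ζ',
      ∀ P, Θ.hom.app P ∈ HomGraded.gr (k := k) _ _ 0 := by
  have hφ : ∀ (x y : D) (f : (shiftFunctor D (1 : ℤ)).obj x ⟶ y),
      f ≫ 𝟙 y = (shiftFunctor D (1 : ℤ)).map (𝟙 x) ≫ f := by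
    intro x y f
    rw [CategoryTheory.Functor.map_id, Category.id_comp, Category.comp_id]
  have hS : ∀ (x y : D) (f : y ⟶ 𝒮.S.functor.obj x),
      f ≫ 𝒮.S.functor.map (𝟙 x) = 𝟙 y ≫ f := by
    intro x y f
    rw [CategoryTheory.Functor.map_id, Category.id_comp, Category.comp_id]
  obtain ⟨θ, hθ⟩ := CommutingFunctor.exists_lift_comp_iso (A.commuting ζ) (B.commuting ζ')
    ((B.comp A).commuting ζ'') (Iso.refl _) (fun x => hφ _ _ _)
    (fun x => (hS _ _ _).trans (congrArg (𝟙 _ ≫ ·) (h x)))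
  exact GrKaroubi.exists_mapFunctor_comp_iso (hG := (A.commuting ζ).lift_isGraded)
    (hG' := (B.commuting ζ').lift_isGraded) (hG'' := ((B.comp A).commuting ζ'').lift_isGraded)
    θ hθ

theorem exists_induced_one_iso [(one (shiftEquiv D (1 : ℤ)).functor).Φ.functor.Additive]
    (ζ : (one (shiftEquiv D (1 : ℤ)).functor).Φ.functor ⋙ 𝒮.S.functor ≅
      𝒮.S.functor ⋙ (one (shiftEquiv D (1 : ℤ)).functor).Φ.functor)
    (hζ : ∀ x, ζ.inv.app x = 𝟙 (𝒮.S.functor.obj x)) :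
    ∃ Θ : induced ζ ≅ 𝟭 _, ∀ P, Θ.hom.app P ∈ HomGraded.gr (k := k) _ _ 0 := by
  have hφ : ∀ x : D, 𝟙 ((shiftFunctor D (1 : ℤ)).obj x) ≫ 𝟙 _ =
      (shiftFunctor D (1 : ℤ)).map (𝟙 x) := by
    intro x
    rw [CategoryTheory.Functor.map_id, Category.id_comp]
  have hS : ∀ x : D, ζ.inv.app x ≫ 𝒮.S.functor.map (𝟙 x) = 𝟙 (𝒮.S.functor.obj x) := by
    intro x
    exact (congrArg (ζ.inv.app x ≫ ·) (𝒮.S.functor.map_id x)).trans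
      ((Category.comp_id _).trans (hζ x))
  obtain ⟨θ, hθ⟩ := CommutingFunctor.exists_lift_id_iso ((one _).commuting ζ)
    (Iso.refl _) hφ hS
  exact GrKaroubi.exists_mapFunctor_id_iso (hG := ((one _).commuting ζ).lift_isGraded) θ hθ

theorem induces_one : Induces X (one (shiftEquiv D (1 : ℤ)).functor) 1 := by
  let ζ : (one (shiftEquiv D (1 : ℤ)).functor).Φ.functor ⋙ 𝒮.S.functor ≅
      𝒮.S.functor ⋙ (one (shiftEquiv D (1 : ℤ)).functor).Φ.functor := Iso.refl 𝒮.S.functor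
  have h1 : (one (shiftEquiv D (1 : ℤ)).functor).Φ.functor.Additive :=
    inferInstanceAs (𝟭 D).Additive
  obtain ⟨Θ, hΘ⟩ := exists_induced_one_iso (k := k) ζ fun _ => rfl
  exact ⟨h1, inferInstanceAs ((𝟭 D).Linear k), ζ, 𝒮.isTraceComm_id _ fun _ => rfl,
    realizes_id.of_natIso_zero Θ fun _ => hΘ _⟩

variable {A B} {F G : DegAdjAut (CatAlg.grading k X) (CatAlg.vertex X)}

theorem Induces.comp (hA : Induces X A F) (hB : Induces X B G) :
    Induces X (B.comp A) (G * F) := by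
  obtain ⟨h1, h2, ζ, hζ, hF⟩ := hA
  obtain ⟨h1', h2', ζ', hζ', hG⟩ := hB
  let ζ'' : (B.comp A).Φ.functor ⋙ 𝒮.S.functor ≅ 𝒮.S.functor ⋙ (B.comp A).Φ.functor :=
    𝒮.commComp ζ ζ'
  have h3 : (B.comp A).Φ.functor.Additive :=
    inferInstanceAs (A.Φ.functor ⋙ B.Φ.functor).Additive
  obtain ⟨Θ, hΘ⟩ := exists_induced_comp_iso A B ζ ζ' ζ'' fun _ => rfl
  exact ⟨h3, inferInstanceAs ((A.Φ.functor ⋙ B.Φ.functor).Linear k), ζ'', hζ.comp 𝒮 hζ',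
    (hF.comp (induced_isGraded ζ') hG).of_natIso_zero Θ fun _ => hΘ _⟩

/-- Isomorphism of equivariant autoequivalences is isomorphism of the induced degree-adjusted
automorphisms. -/
theorem Induces.isIsomorphic_iff (hA : Induces X A F) (hB : Induces X B G)
    (hX : Generates (E := GrKaroubi k (OrbitCat 𝒮.arFunctor)) X) :
    A.IsIsomorphic B ↔ DegAdjAut.IsIsomorphic F G := by
  obtain ⟨h1, h2, ζ, hζ, hF⟩ := hA
  obtain ⟨h1', h2', ζ', hζ', hG⟩ := hB
  rw [isIsomorphic_iff_induced_iso hζ hζ',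
    hF.isIsomorphic_iff (induced_isGraded ζ) (induced_isGraded ζ') hX hG]

end EquivariantAut

end Induces

/-! ### Integer powers -/

namespace DegAdjAut

section Powers

variable {k : Type w} [Field k] {E : Type u} [Category.{v} E] [Preadditive E] [Linear k E]
  [HomGraded k E] {ι : Type t} [Fintype ι] [DecidableEq ι] {X : ι → E}
  {F G : DegAdjAut (CatAlg.grading k X) (CatAlg.vertex X)}

theorem isIsomorphic_iff_mk' :
    IsIsomorphic F G ↔ (isoCon k X).mk' F = (isoCon k X).mk' G :=
  (Con.eq (isoCon k X)).symm

theorem IsIsomorphic.refl (F : DegAdjAut (CatAlg.grading k X) (CatAlg.vertex X)) :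
    IsIsomorphic F F := (isoCon k X).refl F

theorem IsIsomorphic.trans {H : DegAdjAut (CatAlg.grading k X) (CatAlg.vertex X)}
    (h : IsIsomorphic F G) (h' : IsIsomorphic G H) : IsIsomorphic F H :=
  (isoCon k X).trans h h'

theorem IsIsomorphic.zpow (h : IsIsomorphic F G) (n : ℤ) : IsIsomorphic (F ^ n) (G ^ n) := by
  rw [isIsomorphic_iff_mk', map_zpow, map_zpow, isIsomorphic_iff_mk'.1 h]

theorem IsIsomorphic.pow_of_mul_eq_one (h : IsIsomorphic (F * G) 1) (n : ℕ) :
    IsIsomorphic (G ^ (n + 1)) (F ^ Int.negSucc n) := by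
  rw [isIsomorphic_iff_mk', map_mul, map_one] at h
  rw [isIsomorphic_iff_mk', map_pow, eq_inv_of_mul_eq_one_right h, map_zpow, zpow_negSucc, inv_pow]

/-- Twisting by the central element `const 1` shifts the exponents. -/
theorem isIsomorphic_iff_of_zpow {H H' : DegAdjAut (CatAlg.grading k X) (CatAlg.vertex X)}
    {N m : ℤ} (h : IsIsomorphic H (F ^ m)) (h' : IsIsomorphic H' ((F * const _ _ 1) ^ N)) :
    IsIsomorphic H H' ↔ IsIsomorphic (F ^ (m - N)) (const _ _ N) := by
  have hc : Commute ((isoCon k X).mk' F) ((isoCon k X).mk' (const _ _ 1)) := by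
    change _ * _ = _ * _
    rw [← map_mul, ← map_mul, const_mul_comm]
  rw [isIsomorphic_iff_mk'] at h h'
  rw [isIsomorphic_iff_mk', isIsomorphic_iff_mk', h, h', map_zpow, map_zpow, map_mul,
    hc.mul_zpow, ← const_one_zpow N, map_zpow, map_zpow, zpow_sub, mul_inv_eq_iff_eq_mul,
    ((hc.zpow_left N).zpow_right N).eq]

end Powers

end DegAdjAut

section Powers

variable {D : Type u} [Category.{v} D]

/-- The quasi-inverse of an equivariant autoequivalence is a right inverse. -/
theorem EquivariantAut.comp_inv_isIsomorphic {F : D ⥤ D} (A : EquivariantAut F) :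
    (A.comp A.inv).IsIsomorphic (one F) := by
  refine ⟨A.Φ.counitIso, fun x => ?_⟩
  change (A.Φ.functor.map (A.Φ.inverse.map (F.map (A.Φ.counitIso.inv.app x)) ≫
      A.Φ.inverse.map (A.comm.inv.app (A.Φ.inverse.obj x)) ≫
      A.Φ.unitIso.inv.app (F.obj (A.Φ.inverse.obj x))) ≫
        A.comm.hom.app (A.Φ.inverse.obj x)) ≫ F.map (A.Φ.counitIso.hom.app x) =
    A.Φ.counitIso.hom.app (F.obj x) ≫ 𝟙 (F.obj x)
  have h1 : A.Φ.functor.map (A.Φ.unitIso.inv.app (F.obj (A.Φ.inverse.obj x))) =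
      A.Φ.counitIso.hom.app (A.Φ.functor.obj (F.obj (A.Φ.inverse.obj x))) :=
    (A.Φ.counit_app_functor _).symm
  have h2 := A.Φ.counitIso.hom.naturality (A.comm.inv.app (A.Φ.inverse.obj x))
  have h3 := A.Φ.counitIso.hom.naturality (F.map (A.Φ.counitIso.inv.app x))
  simp only [Functor.comp_obj, Functor.comp_map, Functor.id_obj, Functor.id_map] at h2 h3
  have h4 : A.comm.inv.app (A.Φ.inverse.obj x) ≫ A.comm.hom.app (A.Φ.inverse.obj x) = 𝟙 _ :=
    A.comm.inv_hom_id_app _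
  have h5 : F.map (A.Φ.counitIso.inv.app x) ≫ F.map (A.Φ.counitIso.hom.app x) = 𝟙 _ := by
    rw [← F.map_comp, Iso.inv_hom_id_app, F.map_id]
  rw [Functor.map_comp, Functor.map_comp, h1, h2, reassoc_of% h3]
  simp only [Category.assoc]
  rw [reassoc_of% h4, h5]
  rfl

variable {k : Type w} [Field k] [Preadditive D] [Linear k D]
  [HasShift D ℤ] [∀ n : ℤ, (shiftFunctor D n).Additive]
  [∀ n : ℤ, (shiftFunctor D n).Linear k]
  {𝒮 : SerreStructure k D}
  {ι : Type t} [Fintype ι] [DecidableEq ι] {X : ι → GrKaroubi k (OrbitCat 𝒮.arFunctor)}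
  {A B : EquivariantAut (shiftEquiv D (1 : ℤ)).functor}
  {F G : DegAdjAut (CatAlg.grading k X) (CatAlg.vertex X)}

/-- If the orbit category is hom-finite, so is `D`. -/
theorem OrbitCat.finite_hom (hfin : ∀ x y : OrbitCat 𝒮.arFunctor, Module.Finite k (x ⟶ y))
    (x y : D) : Module.Finite k (x ⟶ y) := by
  obtain ⟨x, rfl⟩ := OrbitCat.exists_obj_zero (T := 𝒮.arFunctor) x
  obtain ⟨y, rfl⟩ := OrbitCat.exists_obj_zero (T := 𝒮.arFunctor) y
  let l : (x ⟶ y) →ₗ[k] (x.obj 0 ⟶ y.obj 0) :=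
    { toFun := fun f => f.mat 0 0
      map_add' := fun _ _ => rfl
      map_smul' := fun _ _ => rfl }
  have := hfin x y
  exact Module.Finite.of_surjective l fun f => by
    obtain ⟨g, -, hg⟩ := OrbitCat.exists_mat_eq k x y 0 0 f
    exact ⟨g, hg⟩

namespace EquivariantAut

theorem induced_essSurj (hfin : ∀ x y : OrbitCat 𝒮.arFunctor, Module.Finite k (x ⟶ y))
    [A.Φ.functor.Additive] [A.Φ.functor.Linear k]
    {ζ : A.Φ.functor ⋙ 𝒮.S.functor ≅ 𝒮.S.functor ⋙ A.Φ.functor}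
    (hζ : 𝒮.IsTraceComm A.Φ.functor ζ) : (induced ζ).EssSurj := by
  have h1 : A.inv.Φ.functor.Additive := inferInstanceAs A.Φ.inverse.Additive
  have h2 : A.inv.Φ.functor.Linear k := inferInstanceAs (A.Φ.inverse.Linear k)
  obtain ⟨ζ', hζ'⟩ := 𝒮.exists_isTraceComm (OrbitCat.finite_hom hfin) A.inv.Φ
  let ζ'' : (A.comp A.inv).Φ.functor ⋙ 𝒮.S.functor ≅ 𝒮.S.functor ⋙ (A.comp A.inv).Φ.functor :=
    𝒮.commComp ζ' ζ
  have h3 : (A.comp A.inv).Φ.functor.Additive :=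
    inferInstanceAs (A.inv.Φ.functor ⋙ A.Φ.functor).Additive
  let ζ₁ : (one (shiftEquiv D (1 : ℤ)).functor).Φ.functor ⋙ 𝒮.S.functor ≅
      𝒮.S.functor ⋙ (one (shiftEquiv D (1 : ℤ)).functor).Φ.functor := Iso.refl 𝒮.S.functor
  have h4 : (one (shiftEquiv D (1 : ℤ)).functor).Φ.functor.Additive :=
    inferInstanceAs (𝟭 D).Additive
  obtain ⟨Θ, -⟩ := exists_induced_comp_iso A.inv A ζ' ζ ζ'' fun _ => rfl
  obtain ⟨Θ₁, -⟩ := exists_induced_one_iso (k := k) ζ₁ fun _ => rfl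
  obtain ⟨Θ₂, -⟩ := (isIsomorphic_iff_induced_iso (ζ := ζ'') (ζ' := ζ₁) (hζ'.comp 𝒮 hζ)
    (𝒮.isTraceComm_id _ fun _ => rfl)).1 A.comp_inv_isIsomorphic
  exact ⟨fun P => ⟨(induced ζ').obj P, ⟨(Θ.symm ≪≫ Θ₂ ≪≫ Θ₁).app P⟩⟩⟩

theorem exists_realizes_induced (hX : IsIndecSkeleton X)
    (hfin : ∀ x y : OrbitCat 𝒮.arFunctor, Module.Finite k (x ⟶ y))
    [A.Φ.functor.Additive] [A.Φ.functor.Linear k]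
    {ζ : A.Φ.functor ⋙ 𝒮.S.functor ≅ 𝒮.S.functor ⋙ A.Φ.functor}
    (hζ : 𝒮.IsTraceComm A.Φ.functor ζ) :
    ∃ F : DegAdjAut (CatAlg.grading k X) (CatAlg.vertex X), Realizes (induced ζ) F := by
  have := induced_essSurj hfin hζ
  have : (induced ζ).IsEquivalence := { }
  exact exists_realizes hX (GrKaroubi.degreeZeroIdempotentsSplit k _)
    (GrKaroubi.finite_hom hfin) _ (induced_isGraded ζ)

theorem Induces.npow (h : Induces X A F) (n : ℕ) : Induces X (A.npow n) (F ^ n) := by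
  induction n with
  | zero => exact induces_one
  | succ n ih =>
    rw [pow_succ']
    exact ih.comp h

/-- Integer powers: the quasi-inverse of `A` induces an inverse up to isomorphism. -/
theorem Induces.zpow (hX : IsIndecSkeleton X)
    (hfin : ∀ x y : OrbitCat 𝒮.arFunctor, Module.Finite k (x ⟶ y))
    (h : Induces X A F) (n : ℤ) :
    ∃ G, Induces X (A.zpow n) G ∧ DegAdjAut.IsIsomorphic G (F ^ n) := by
  cases n with
  | ofNat n =>
    refine ⟨F ^ n, h.npow n, ?_⟩
    rw [Int.ofNat_eq_natCast, zpow_natCast]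
    exact DegAdjAut.IsIsomorphic.refl _
  | negSucc n =>
    have h0 := h
    obtain ⟨h1, h2, -⟩ := h0
    have h1' : A.inv.Φ.functor.Additive := inferInstanceAs A.Φ.inverse.Additive
    have h2' : A.inv.Φ.functor.Linear k := inferInstanceAs (A.Φ.inverse.Linear k)
    obtain ⟨ζ', hζ'⟩ := 𝒮.exists_isTraceComm (OrbitCat.finite_hom hfin) A.inv.Φ
    obtain ⟨G, hG⟩ := exists_realizes_induced hX hfin hζ'
    have hG' : Induces X A.inv G := ⟨h1', h2', ζ', hζ', hG⟩
    have hgen := hX.generates (GrKaroubi.finite_hom hfin)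
    have h3 := A.comp_inv_isIsomorphic
    have h4 := ((hG'.comp h).isIsomorphic_iff induces_one hgen).1 h3
    exact ⟨G ^ (n + 1), hG'.npow (n + 1), h4.pow_of_mul_eq_one n⟩

end EquivariantAut

/-! ### The Nakayama automorphism and the fractional Calabi-Yau property -/

/-- The Serre functor induces the Nakayama automorphism `ν` of a graded Frobenius structure, and
the suspension induces `ν * const 1`, since it differs from the Serre functor by an isomorphism
of degree `1` on the orbit category. -/
theorem exists_frobenius_of_isTraceComm (hX : IsIndecSkeleton X)
    (hfin : ∀ x y : OrbitCat 𝒮.arFunctor, Module.Finite k (x ⟶ y))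
    {ζ s : shiftFunctor D (1 : ℤ) ⋙ 𝒮.S.functor ≅ 𝒮.S.functor ⋙ shiftFunctor D (1 : ℤ)}
    (hζ : 𝒮.IsTraceComm (shiftFunctor D (1 : ℤ)) ζ) (hs : ∀ x, s.hom.app x = - ζ.hom.app x) :
    ∃ Fr : GradedFrobeniusStructure (sgn k) (CatAlg.grading k X) (CatAlg.vertex X),
      EquivariantAut.Induces X ⟨𝒮.S, s⟩ Fr.nakayama ∧
      EquivariantAut.Induces X (suspension D) (Fr.nakayama * DegAdjAut.const _ _ 1) := by
  have hS : 𝒮.IsTraceComm 𝒮.S.functor (Iso.refl _) := fun y f =>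
    (congrArg _ (Category.comp_id _)).trans (𝒮.tr_map f)
  obtain ⟨F, hF⟩ := EquivariantAut.exists_realizes_induced (X := X)
    (A := (⟨𝒮.S, s⟩ : EquivariantAut (shiftEquiv D (1 : ℤ)).functor)) hX hfin hS
  obtain ⟨Fr, rfl⟩ := (SerreStructure.signedTrace hζ hs).exists_frobenius
    (GrKaroubi.finite_hom hfin) hF
  obtain ⟨Θ, hΘ⟩ := SerreStructure.exists_shift_lift_iso_serre_lift hs
  obtain ⟨Θ', hΘ'⟩ := GrKaroubi.exists_mapFunctor_iso (𝒮.shiftCommuting ζ).lift_isGraded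
    (𝒮.serreCommuting s).lift_isGraded 1 Θ hΘ
  refine ⟨Fr, ⟨inferInstance, inferInstance, Iso.refl _, hS, hF⟩,
    inferInstanceAs (shiftFunctor D (1 : ℤ)).Additive,
    inferInstanceAs ((shiftFunctor D (1 : ℤ)).Linear k), ζ, hζ, ?_⟩
  exact Realizes.of_natIso 1 Θ' (fun _ => hΘ' _) hF

/-- Powers of the Serre functor and of the suspension in terms of the Nakayama automorphism. -/
theorem zpow_isIsomorphic_iff (hX : IsIndecSkeleton X)
    (hfin : ∀ x y : OrbitCat 𝒮.arFunctor, Module.Finite k (x ⟶ y))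
    {s : shiftFunctor D (1 : ℤ) ⋙ 𝒮.S.functor ≅ 𝒮.S.functor ⋙ shiftFunctor D (1 : ℤ)}
    (hS : EquivariantAut.Induces X ⟨𝒮.S, s⟩ F)
    (hT : EquivariantAut.Induces X (suspension D) (F * DegAdjAut.const _ _ 1)) (N m : ℤ) :
    EquivariantAut.IsIsomorphic (EquivariantAut.zpow ⟨𝒮.S, s⟩ m) ((suspension D).zpow N) ↔
      DegAdjAut.IsIsomorphic (F ^ (m - N)) (DegAdjAut.const _ _ N) := by
  obtain ⟨G, hG, hGF⟩ := hS.zpow hX hfin m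
  obtain ⟨G', hG', hGF'⟩ := hT.zpow hX hfin N
  have hgen := hX.generates (GrKaroubi.finite_hom hfin)
  exact (hG.isIsomorphic_iff hG' hgen).trans (DegAdjAut.isIsomorphic_iff_of_zpow hGF hGF')

theorem isEquivariant_sgn_iff
    (s : shiftFunctor D (1 : ℤ) ⋙ 𝒮.S.functor ≅ 𝒮.S.functor ⋙ shiftFunctor D (1 : ℤ)) :
    𝒮.IsEquivariant (sgn k) (shiftEquiv D (1 : ℤ)) s ↔
      ∃ ζ : shiftFunctor D (1 : ℤ) ⋙ 𝒮.S.functor ≅ 𝒮.S.functor ⋙ shiftFunctor D (1 : ℤ),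
        𝒮.IsTraceComm (shiftFunctor D (1 : ℤ)) ζ ∧ ∀ x, s.hom.app x = - ζ.hom.app x := by
  refine exists_congr fun ζ => and_congr (𝒮.isCanonicalComm_iff (shiftEquiv D (1 : ℤ)) ζ)
    (forall_congr' fun x => ?_)
  rw [charVal_sgn_one, neg_smul, one_smul]
  exact Iff.rfl

end Powers

end FracCY

end

theorem corollary4p14 {k : Type w} [Field k] {D : Type u} [Category.{v} D] [Preadditive D]
    [Linear k D] [HasZeroObject D] [HasShift D ℤ] [∀ n : ℤ, (shiftFunctor D n).Additive]
    [∀ n : ℤ, (shiftFunctor D n).Linear k] [Pretriangulated D] [IsTriangulated D]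
    (𝒮 : SerreStructure k D)
    (hC : IsFiniteCat k (OrbitCat 𝒮.arFunctor))
    {ι : Type t} [Fintype ι] [DecidableEq ι]
    (X : ι → GrKaroubi k (OrbitCat 𝒮.arFunctor)) (hX : IsIndecSkeleton X) (N m : ℤ) :
    IsFractionalCalabiYau 𝒮 N m ↔
      ∃ Fr : GradedFrobeniusStructure (sgn k) (CatAlg.grading k X) (CatAlg.vertex X),
        DegAdjAut.IsIsomorphic (Fr.nakayama ^ (m - N)) (DegAdjAut.const _ _ N) := by
  constructor
  · rintro ⟨s, hs, h⟩
    obtain ⟨ζ, hζ, hs⟩ := (isEquivariant_sgn_iff s).1 hs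
    obtain ⟨Fr, hS, hT⟩ := exists_frobenius_of_isTraceComm hX hC.hom_finite hζ hs
    exact ⟨Fr, (zpow_isIsomorphic_iff hX hC.hom_finite hS hT N m).1 h⟩
  · rintro ⟨Fr', h⟩
    have h1 : (shiftEquiv D (1 : ℤ)).functor.Additive :=
      inferInstanceAs (shiftFunctor D (1 : ℤ)).Additive
    have h2 : (shiftEquiv D (1 : ℤ)).functor.Linear k :=
      inferInstanceAs ((shiftFunctor D (1 : ℤ)).Linear k)
    obtain ⟨ζ, hζ⟩ := 𝒮.exists_isTraceComm (OrbitCat.finite_hom hC.hom_finite)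
      (shiftEquiv D (1 : ℤ))
    obtain ⟨Fr, hS, hT⟩ := exists_frobenius_of_isTraceComm (s := - ζ) hX hC.hom_finite hζ
      fun _ => rfl
    refine ⟨- ζ, (isEquivariant_sgn_iff _).2 ⟨ζ, hζ, fun _ => rfl⟩,
      (zpow_isIsomorphic_iff hX hC.hom_finite hS hT N m).2 ?_⟩
    exact ((Fr.nakayama_isIsomorphic Fr').zpow (m - N)).trans h
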